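/- For an $n\times n$ matrix $\Sigma\succ0$ let the graph of the Gaussian model $\mathcal N(\mu,\Sigma)$ on the vertex set $V=\{1,\dots,n\}$ have an edge between $i\neq j$ if and only if $(\Sigma^{-1})_{ij}\neq0$. For $F\subseteq V$ with $|F|=k$ and $T=V\setminus F$, let $\mathcal Q_F$ be the set of all Gaussian distributions $\mathcal N(\mu,\Sigma)$, $\Sigma\succ0$, whose graph becomes cycle-free when $F$ is removed (that is, $F$ is a feedback vertex set). Let $\hat\Sigma=\begin{pmatrix}\hat\Sigma_F&\hat\Sigma_M^T\\ \hat\Sigma_M&\hat\Sigma_T\end{pmatrix}\succ0$ (blocks with respect to $F$ and $T$). The Chow-Liu algorithm, on input a covariance matrix $A\succ0$ with correlation coefficients $\rho_{ij}=A_{ij}/\sqrt{A_{ii}A_{jj}}$, computes a maximum weight spanning tree $\mathcal E$ of the complete graph for the edge weights $|\rho_{ij}|$ and the matrix $\mathrm{CL}(A)$ that agrees with $A$ on the diagonal and on the edges of $\mathcal E$ and has the entry $\sqrt{A_{ii}A_{jj}}\prod_{(l,m)\in\mathrm{Path}(i,j)}\rho_{lm}$ at all other $(i,j)$, where $\mathrm{Path}(i,j)$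 is the path between $i$ and $j$ in $\mathcal E$. The conditioned Chow-Liu algorithm, on input $\hat\Sigma$ and $F$, runs the Chow-Liu algorithm on $\hat\Sigma_{T|F}=\hat\Sigma_T-\hat\Sigma_M\hat\Sigma_F^{-1}\hat\Sigma_M^T$, which gives a tree $\mathcal E_{\mathrm{ML}}$ on $T$ and $\Sigma_{\mathrm{CL}}=\mathrm{CL}(\hat\Sigma_{T|F})$, and returns $\mathcal E_{\mathrm{ML}}$ and $$\Sigma_{\mathrm{ML}}=\begin{pmatrix}\hat\Sigma_F&\hat\Sigma_M^T\\ \hat\Sigma_M&\Sigma_{\mathrm{CL}}+\hat\Sigma_M\hat\Sigma_F^{-1}\hat\Sigma_M^T\end{pmatrix}.$$ (1) For every choice of the maximum weight spanning tree, the output is an exact maximum likelihood estimate: $\mathcal E_{\mathrm{ML}}$ is a spanning tree on $T$ that contains every edge between vertices of $T$ in the graph of $\mathcal N(\mu,\Sigma_{\mathrm{ML}})$; $\Sigma_{\mathrm{ML}}\succ0$ and $\mathcal N(\mu,\Sigma_{\mathrm{ML}})\in\mathcal Q_F$ for all $\mu$; for every $\hat\mu$, $q=\mathcal N(\hat\mu,\Sigma_{\mathrm{ML}})$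 minimizes $D_{\mathrm{KL}}(\mathcal N(\hat\mu,\hat\Sigma)\,\|\,q)$ over $q\in\mathcal Q_F$; and for all samples $x^1,\dots,x^s\in\mathbb R^n$ with empirical mean $\hat\mu$ and empirical covariance matrix $\hat\Sigma$, the same $q$ maximizes $\sum_{i=1}^s\log q(x^i)$ over $q\in\mathcal Q_F$. (2) On a real random access machine (unit cost for arithmetic operations, square roots and comparisons of real numbers, for additions, subtractions and comparisons of natural numbers, and for memory accesses) one fixed program, for all $n$, $k$, $F$, $\hat\Sigma$, computes such an output $(\mathcal E_{\mathrm{ML}},\Sigma_{\mathrm{ML}})$; for $n\ge2$ it takes time $\mathcal O(kn^2+n^2\log n)$. (3) On the same machine one fixed program computes, from $F$, $\mathcal E_{\mathrm{ML}}$ and $\Sigma_{\mathrm{ML}}$ in memory, a list of entries of $J_{\mathrm{ML}}=\Sigma_{\mathrm{ML}}^{-1}$ (with positions) that contains all non-zero entries; for $n\ge1$ it takes extra time $\mathcal O(\max(1,k)^2n)$, that is, $\mathcal O(k^2n)$ if $k\ge1$ and $\mathcal O(n)$ if $k=0$. -/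

import Mathlib

open scoped Matrix

namespace FVSLearning

noncomputable section

/-! ### Gaussian models and feedback vertex sets -/

section Models

variable {V : Type*} [Fintype V] [DecidableEq V]

/-- The density of the Gaussian distribution with mean `μ` and covariance matrix `S ≻ 0`
(information matrix `S⁻¹`) with respect to Lebesgue measure. -/
def gaussianDensity (μ : V → ℝ) (S : Matrix V V ℝ) (x : V → ℝ) : ℝ :=
  (Real.sqrt ((2 * Real.pi) ^ Fintype.card V * S.det))⁻¹ *
    Real.exp (-(1 / 2) * ((x - μ) ⬝ᵥ (S⁻¹ *ᵥ (x - μ))))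

/-- The Gaussian distribution with mean `μ` and covariance matrix `S ≻ 0`. -/
def gaussian (μ : V → ℝ) (S : Matrix V V ℝ) : MeasureTheory.Measure (V → ℝ) :=
  MeasureTheory.volume.withDensity fun x => ENNReal.ofReal (gaussianDensity μ S x)

/-- The underlying graph of a Gaussian model with information matrix `J`: distinct `i`, `j` are
joined if and only if `J i j ≠ 0` (`J` is symmetric in all uses). -/
def sparsityGraph (J : Matrix V V ℝ) : SimpleGraph V :=
  SimpleGraph.fromRel fun i j => J i j ≠ 0

/-- The subgraph induced on the vertices outside `F`. -/
def nonFeedbackGraph (F : Finset V) (G : SimpleGraph V) : SimpleGraph {i // i ∉ F} :=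
  G.comap Subtype.val

/-- `F` is a feedback vertex set of `G`: removing `F` leaves a cycle-free graph. -/
def IsFVS (G : SimpleGraph V) (F : Finset V) : Prop :=
  (nonFeedbackGraph F G).IsAcyclic

/-- The covariance matrices of the models with feedback vertex set `F`. -/
def covFamily (F : Finset V) : Set (Matrix V V ℝ) :=
  {S | S.PosDef ∧ IsFVS (sparsityGraph S⁻¹) F}

/-- The family of nondegenerate Gaussian distributions with feedback vertex set `F`. -/
def modelFamily (F : Finset V) : Set (MeasureTheory.Measure (V → ℝ)) :=
  {q | ∃ μ : V → ℝ, ∃ S ∈ covFamily F, q = gaussian μ S}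

/-- The empirical mean of `s` samples. -/
def empiricalMean {s : ℕ} (x : Fin s → V → ℝ) : V → ℝ :=
  (1 / (s : ℝ)) • ∑ a, x a

/-- The empirical covariance matrix of `s` samples. -/
def empiricalCov {s : ℕ} (x : Fin s → V → ℝ) : Matrix V V ℝ :=
  (1 / (s : ℝ)) • (∑ a, Matrix.vecMulVec (x a) (x a)) -
    Matrix.vecMulVec (empiricalMean x) (empiricalMean x)

end Models

/-! ### The Chow-Liu algorithm and the conditioned Chow-Liu algorithm -/

section ChowLiu

variable {V : Type*} [Fintype V]

/-- Spanning trees of the complete graph on `V` (for empty `V`: the empty graph). -/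
def IsSpanningTree (G : SimpleGraph V) : Prop :=
  G.IsAcyclic ∧ G.Preconnected

open Classical in
/-- The total weight of the edges of `G`, for a symmetric weight function `w` (every edge occurs
twice in the double sum). -/
def totalWeight (w : V → V → ℝ) (G : SimpleGraph V) : ℝ :=
  (∑ i, ∑ j, if G.Adj i j then w i j else 0) / 2

/-- Maximum weight spanning trees of the complete graph on `V`. -/
def IsMaxSpanningTree (w : V → V → ℝ) (G : SimpleGraph V) : Prop :=
  IsSpanningTree G ∧ ∀ H : SimpleGraph V, IsSpanningTree H → totalWeight w H ≤ totalWeight w G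

/-- The correlation coefficients of a covariance matrix. -/
def correlation (S : Matrix V V ℝ) (i j : V) : ℝ :=
  S i j / Real.sqrt (S i i * S j j)

/-- `(E, S')` is an output of the Chow-Liu algorithm for Gaussian models on the input `S`: `E` is a
maximum weight spanning tree for the weights `|ρ i j|` (any choice is allowed if there are ties),
`S'` agrees with `S` on the diagonal and on the edges of `E`, and the other entries of `S'` are
obtained by multiplying the correlation coefficients along the path in `E`. -/
def IsChowLiuOutput (S : Matrix V V ℝ) (E : SimpleGraph V) (S' : Matrix V V ℝ) : Prop :=
  IsMaxSpanningTree (fun i j => |correlation S i j|) E ∧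
  (∀ i, S' i i = S i i) ∧
  (∀ i j, E.Adj i j → S' i j = S i j) ∧
  (∀ i j, i ≠ j → ¬ E.Adj i j → ∀ p : E.Walk i j, p.IsPath →
    S' i j = Real.sqrt (S i i * S j j) *
      (p.darts.map fun d => correlation S d.fst d.snd).prod)

variable [DecidableEq V]

/-- The block of `S` on the feedback vertices. -/
def blockF (F : Finset V) (S : Matrix V V ℝ) : Matrix {i // i ∈ F} {i // i ∈ F} ℝ :=
  S.submatrix Subtype.val Subtype.val

/-- The block of `S` with rows outside `F` and columns in `F`. -/
def blockM (F : Finset V) (S : Matrix V V ℝ) : Matrix {i // i ∉ F} {i // i ∈ F} ℝ :=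
  S.submatrix Subtype.val Subtype.val

/-- The block of `S` on the vertices outside `F`. -/
def blockT (F : Finset V) (S : Matrix V V ℝ) : Matrix {i // i ∉ F} {i // i ∉ F} ℝ :=
  S.submatrix Subtype.val Subtype.val

/-- The matrix with the blocks `A`, `Bᵀ` (rows in `F`) and `B`, `D` (rows outside `F`). -/
def assemble (F : Finset V) (A : Matrix {i // i ∈ F} {i // i ∈ F} ℝ)
    (B : Matrix {i // i ∉ F} {i // i ∈ F} ℝ) (D : Matrix {i // i ∉ F} {i // i ∉ F} ℝ) :
    Matrix V V ℝ :=
  (Matrix.fromBlocks A Bᵀ B D).submatrix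
    (Equiv.sumCompl fun i => i ∈ F).symm (Equiv.sumCompl fun i => i ∈ F).symm

/-- The conditional covariance matrix of the variables outside `F` given those in `F`. -/
def conditionalCov (F : Finset V) (S : Matrix V V ℝ) : Matrix {i // i ∉ F} {i // i ∉ F} ℝ :=
  blockT F S - blockM F S * (blockF F S)⁻¹ * (blockM F S)ᵀ

/-- `(E, S')` is an output of the conditioned Chow-Liu algorithm on the input `S`, `F`. -/
def IsConditionedChowLiuOutput (F : Finset V) (S : Matrix V V ℝ)
    (E : SimpleGraph {i // i ∉ F}) (S' : Matrix V V ℝ) : Prop :=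
  ∃ SCL : Matrix {i // i ∉ F} {i // i ∉ F} ℝ,
    IsChowLiuOutput (conditionalCov F S) E SCL ∧
    S' = assemble F (blockF F S) (blockM F S)
      (SCL + blockM F S * (blockF F S)⁻¹ * (blockM F S)ᵀ)

end ChowLiu

/-! ### A real random access machine with unit costs

Programs are structured; they have finitely many variables and two-dimensional arrays, holding
natural numbers (for indices) or real numbers. Natural numbers can only be added, subtracted and
compared, so that they stay small; there is no rounding of real numbers and no conversion
between the two types. -/

/-- A memory: natural number variables, real variables, natural number arrays, real arrays. -/
structure Mem where
  iv : ℕ → ℕ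
  rv : ℕ → ℝ
  ia : ℕ → ℕ → ℕ → ℕ
  ra : ℕ → ℕ → ℕ → ℝ

/-- Natural number expressions. -/
inductive IExp where
  | lit (c : ℕ)
  | var (x : ℕ)
  | get (a : ℕ) (i j : IExp)
  | add (e f : IExp)
  | sub (e f : IExp)

/-- The value of a natural number expression (subtraction is truncated). -/
def IExp.eval (σ : Mem) : IExp → ℕ
  | .lit c => c
  | .var x => σ.iv x
  | .get a i j => σ.ia a (i.eval σ) (j.eval σ)
  | .add e f => e.eval σ + f.eval σ
  | .sub e f => e.eval σ - f.eval σ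

/-- The number of steps for evaluating a natural number expression. -/
def IExp.cost : IExp → ℕ
  | .lit _ => 1
  | .var _ => 1
  | .get _ i j => i.cost + j.cost + 1
  | .add e f => e.cost + f.cost + 1
  | .sub e f => e.cost + f.cost + 1

/-- Real expressions. -/
inductive RExp where
  | lit (c : ℕ)
  | var (x : ℕ)
  | get (a : ℕ) (i j : IExp)
  | add (e f : RExp)
  | sub (e f : RExp)
  | mul (e f : RExp)
  | div (e f : RExp)
  | sqrt (e : RExp)

/-- The value of a real expression. -/
def RExp.eval (σ : Mem) : RExp → ℝ
  | .lit c => (c : ℝ)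
  | .var x => σ.rv x
  | .get a i j => σ.ra a (i.eval σ) (j.eval σ)
  | .add e f => e.eval σ + f.eval σ
  | .sub e f => e.eval σ - f.eval σ
  | .mul e f => e.eval σ * f.eval σ
  | .div e f => e.eval σ / f.eval σ
  | .sqrt e => Real.sqrt (e.eval σ)

/-- The number of steps for evaluating a real expression. -/
def RExp.cost : RExp → ℕ
  | .lit _ => 1
  | .var _ => 1
  | .get _ i j => i.cost + j.cost + 1
  | .add e f => e.cost + f.cost + 1
  | .sub e f => e.cost + f.cost + 1
  | .mul e f => e.cost + f.cost + 1
  | .div e f => e.cost + f.cost + 1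
  | .sqrt e => e.cost + 1

/-- Tests. -/
inductive BExp where
  | ilt (e f : IExp)
  | ieq (e f : IExp)
  | rlt (e f : RExp)
  | not (b : BExp)
  | and (b c : BExp)

/-- The truth of a test. -/
def BExp.Holds (σ : Mem) : BExp → Prop
  | .ilt e f => e.eval σ < f.eval σ
  | .ieq e f => e.eval σ = f.eval σ
  | .rlt e f => e.eval σ < f.eval σ
  | .not b => ¬ b.Holds σ
  | .and b c => b.Holds σ ∧ c.Holds σ

/-- The number of steps for evaluating a test. -/
def BExp.cost : BExp → ℕ
  | .ilt e f => e.cost + f.cost + 1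
  | .ieq e f => e.cost + f.cost + 1
  | .rlt e f => e.cost + f.cost + 1
  | .not b => b.cost + 1
  | .and b c => b.cost + c.cost + 1

/-- Programs: assignments to variables (`iset`, `rset`) and array cells (`iput`, `rput`),
sequential composition, branching, and loops. -/
inductive Cmd where
  | skip
  | iset (x : ℕ) (e : IExp)
  | rset (x : ℕ) (e : RExp)
  | iput (a : ℕ) (i j : IExp) (e : IExp)
  | rput (a : ℕ) (i j : IExp) (e : RExp)
  | seq (c d : Cmd)
  | branch (b : BExp) (c d : Cmd)
  | loop (b : BExp) (c : Cmd)

/-- `array` with the cell `(a, i, j)` overwritten by `v`. -/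
def updateCell {α : Type} (array : ℕ → ℕ → ℕ → α) (a i j : ℕ) (v : α) : ℕ → ℕ → ℕ → α :=
  fun a' i' j' => if a' = a ∧ i' = i ∧ j' = j then v else array a' i' j'

/-- `Exec c σ t σ'`: started in the memory `σ`, the program `c` halts after exactly `t` steps in the
memory `σ'`. -/
inductive Exec : Cmd → Mem → ℕ → Mem → Prop where
  | skip (σ : Mem) : Exec .skip σ 1 σ
  | iset (σ : Mem) (x : ℕ) (e : IExp) :
      Exec (.iset x e) σ (e.cost + 1) { σ with iv := Function.update σ.iv x (e.eval σ) }
  | rset (σ : Mem) (x : ℕ) (e : RExp) :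
      Exec (.rset x e) σ (e.cost + 1) { σ with rv := Function.update σ.rv x (e.eval σ) }
  | iput (σ : Mem) (a : ℕ) (i j : IExp) (e : IExp) :
      Exec (.iput a i j e) σ (i.cost + j.cost + e.cost + 1)
        { σ with ia := updateCell σ.ia a (i.eval σ) (j.eval σ) (e.eval σ) }
  | rput (σ : Mem) (a : ℕ) (i j : IExp) (e : RExp) :
      Exec (.rput a i j e) σ (i.cost + j.cost + e.cost + 1)
        { σ with ra := updateCell σ.ra a (i.eval σ) (j.eval σ) (e.eval σ) }
  | seq {c d : Cmd} {σ σ' σ'' : Mem} {t u : ℕ} (hc : Exec c σ t σ') (hd : Exec d σ' u σ'') :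
      Exec (.seq c d) σ (t + u) σ''
  | branchTrue {b : BExp} {c d : Cmd} {σ σ' : Mem} {t : ℕ} (hb : b.Holds σ) (hc : Exec c σ t σ') :
      Exec (.branch b c d) σ (b.cost + t + 1) σ'
  | branchFalse {b : BExp} {c d : Cmd} {σ σ' : Mem} {t : ℕ} (hb : ¬ b.Holds σ)
      (hd : Exec d σ t σ') : Exec (.branch b c d) σ (b.cost + t + 1) σ'
  | loopTrue {b : BExp} {c : Cmd} {σ σ' σ'' : Mem} {t u : ℕ} (hb : b.Holds σ)
      (hc : Exec c σ t σ') (hl : Exec (.loop b c) σ' u σ'') :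
      Exec (.loop b c) σ (b.cost + t + u + 1) σ''
  | loopFalse {b : BExp} {c : Cmd} {σ : Mem} (hb : ¬ b.Holds σ) :
      Exec (.loop b c) σ (b.cost + 1) σ

/-! ### Input and output conventions

Nothing is assumed about the cells that are not mentioned. -/

/-- Natural number variables 0 and 1 hold `n` and `k = |F|`, and natural number array 0 holds the
indicator function of `F`. -/
def Mem.HoldsFVS (σ : Mem) {n : ℕ} (F : Finset (Fin n)) : Prop :=
  σ.iv 0 = n ∧ σ.iv 1 = F.card ∧ ∀ i : Fin n, σ.ia 0 i 0 = if i ∈ F then 1 else 0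

/-- Real array `a` holds the matrix `S`. -/
def Mem.HoldsMatrix (σ : Mem) (a : ℕ) {n : ℕ} (S : Matrix (Fin n) (Fin n) ℝ) : Prop :=
  ∀ i j : Fin n, σ.ra a i j = S i j

/-- Natural number variable 2 holds the number of edges of `E`, and natural number array 1 holds
a list of the edges, one edge in each row (by counting, nothing else is in the list). -/
def Mem.HoldsEdges (σ : Mem) {n : ℕ} {F : Finset (Fin n)} (E : SimpleGraph {i // i ∉ F}) : Prop :=
  σ.iv 2 = E.edgeSet.ncard ∧
  ∀ u v : {i // i ∉ F}, E.Adj u v ↔ ∃ r < σ.iv 2,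
    (σ.ia 1 r 0 = (u : Fin n) ∧ σ.ia 1 r 1 = (v : Fin n)) ∨
    (σ.ia 1 r 0 = (v : Fin n) ∧ σ.ia 1 r 1 = (u : Fin n))

/-- The memory after the conditioned Chow-Liu algorithm: `n`, `F`, the edges of `E`, and `S` (in
real array 1). -/
def Mem.HoldsLearned (σ : Mem) {n : ℕ} (F : Finset (Fin n)) (E : SimpleGraph {i // i ∉ F})
    (S : Matrix (Fin n) (Fin n) ℝ) : Prop :=
  σ.HoldsFVS F ∧ σ.HoldsEdges E ∧ σ.HoldsMatrix 1 S

/-- The memory holds a list of entries of `J`, whose length is in natural number variable 3,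
with the positions in natural number array 2 and the values in real array 2; every non-zero entry
of `J` is in the list. -/
def Mem.HoldsNonzeroEntries (σ : Mem) {n : ℕ} (J : Matrix (Fin n) (Fin n) ℝ) : Prop :=
  (∀ r < σ.iv 3, ∃ i j : Fin n, σ.ia 2 r 0 = i ∧ σ.ia 2 r 1 = j ∧ σ.ra 2 r 0 = J i j) ∧
  ∀ i j : Fin n, J i j ≠ 0 → ∃ r < σ.iv 3, σ.ia 2 r 0 = i ∧ σ.ia 2 r 1 = j

end

end FVSLearning

namespace FVSLearning

noncomputable section

/-! ### Spanning trees, edge exchange and orders in which parents come first -/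

section SpanningTrees

variable {V : Type*}

/-! Write Σ̂ for the empirical covariance. Up to constants and positive factors, both the divergence
and the negative log-likelihood of a model with covariance S' are f(S') = log det S' + tr(S'⁻¹ Σ̂)
plus a nonnegative quadratic term in the mean, which vanishes at the empirical mean. So one
inequality for f serves both claims.

Given a competitor S', enlarge its forest outside `F` to a spanning tree H. Let Q keep the F-block
and the mixed block of Σ̂, and let its conditional covariance M' be obtained from the empirical one
by multiplying correlations along H. Q agrees with Σ̂ wherever S'⁻¹ is nonzero
(`trace_mul_assemble`), so f(S') = log det S' + tr(S'⁻¹ Q), and this is at least log det Q + n by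
Gibbs' inequality (`log_det_add_card_le`). The same trace identity gives f(S) = log det S + n for
the output S. Only determinants of tree models remain to be compared.

By the Schur complement, det Q is det Σ̂_F times det M'. Regressing every vertex on its parent is a
unitriangular change of variables that diagonalizes M' (`TreeCov.conj_residualMatrix`). Hence log
det M' is a constant plus the sum of log(1 - ρ²) over the edges (`TreeCov.log_det_eq`). The best
tree has maximum weight for -log(1 - ρ²). This weight increases with |ρ|, and maximum weight
spanning trees depend only on the order of the weights
(`IsMaxSpanningTree.totalWeight_le_of_monotone`). The same diagonalization shows that tree models
are positive definite with inverses supported on the tree. That inverse is the corresponding block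
of the full information matrix, so the output lies in the family.

For the running times, Gauss-Jordan elimination on the k rows of Σ̂ for `F`, extended by an identity
matrix, takes k²n steps up to constants and yields all regression coefficients. Each conditional
covariance is then a sum of k products, which gives kn² in total, and Prim's algorithm with arrays
takes n². The information matrix needs conditional covariances only on the diagonal and on the tree
edges. Explicit formulas give the sparse block outside `F`, multiplying it with the n × k
coefficients costs kn, and the block on `F` costs k²n. The programs are verified with loop
invariants (`Run.forLoop`); memory that a program cannot write is handled by `Exec.frame`. -/

theorem IsSpanningTree.eq_of_le {G H : SimpleGraph V} (hG : IsSpanningTree G)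
    (hH : IsSpanningTree H) (h : G ≤ H) : G = H := by
  refine le_antisymm h ?_
  -- `SimpleGraph.IsTree` includes nonemptiness, which `IsSpanningTree` does not.
  rcases isEmpty_or_nonempty V with hV | hV
  · intro u; exact (hV.false u).elim
  · have hG' : G.IsTree := { connected := ⟨hG.2⟩, isAcyclic := hG.1 }
    exact (SimpleGraph.maximal_isAcyclic_iff_isTree.2 hG').2 hH.1 h

/-- Competing models have only a forest outside `F`; this supplies the spanning tree with which the
learned tree is compared. -/
theorem exists_isSpanningTree_ge {G : SimpleGraph V} (hG : G.IsAcyclic) :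
    ∃ H, G ≤ H ∧ IsSpanningTree H := by
  rcases isEmpty_or_nonempty V with hV | hV
  · exact ⟨G, le_rfl, hG, fun u => (hV.false u).elim⟩
  · obtain ⟨F, h1, -, h3⟩ :=
      (SimpleGraph.connected_top (V := V)).exists_isTree_le_of_le_of_isAcyclic le_top hG
    exact ⟨F, h1, h3.isAcyclic, h3.connected.preconnected⟩

/-- Stop the walk just before it first uses the edge: the vertex reached is one of the two ends. -/
theorem reachable_deleteEdges_or {G : SimpleGraph V} {x y v : V} (h : G.Reachable v x) :
    (G.deleteEdges {s(x, y)}).Reachable v x ∨ (G.deleteEdges {s(x, y)}).Reachable v y := by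
  obtain ⟨p⟩ := h
  generalize hz : x = z at p
  induction p with
  | nil => subst hz; exact Or.inl (SimpleGraph.Reachable.refl _)
  | @cons a b c hab p ih =>
    subst hz
    by_cases he : s(a, b) = s(x, y)
    · rcases Sym2.eq_iff.1 he with ⟨rfl, rfl⟩ | ⟨rfl, rfl⟩
      · exact Or.inl (SimpleGraph.Reachable.refl _)
      · exact Or.inr (SimpleGraph.Reachable.refl _)
    · have hadj : (G.deleteEdges {s(x, y)}).Adj a b := by
        simp only [SimpleGraph.deleteEdges_adj, Set.mem_singleton_iff]
        exact ⟨hab, he⟩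
      exact (ih rfl).imp hadj.reachable.trans hadj.reachable.trans

/-- Replacing an edge of a spanning tree by one that joins the two components. -/
theorem IsSpanningTree.exchange {H : SimpleGraph V} (hH : IsSpanningTree H) {x y a b : V}
    (hab : ¬ (H.deleteEdges {s(x, y)}).Reachable a b) :
    IsSpanningTree (H.deleteEdges {s(x, y)} ⊔ SimpleGraph.edge a b) := by
  set G := H.deleteEdges {s(x, y)} with hG
  have hGle : G ≤ H := SimpleGraph.deleteEdges_le _
  have hne : a ≠ b := by rintro rfl; exact hab (SimpleGraph.Reachable.refl _)
  refine ⟨(hH.1.anti hGle).sup_edge_of_not_reachable hab, ?_⟩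
  have hle : G ≤ G ⊔ SimpleGraph.edge a b := le_sup_left
  have hadj : (G ⊔ SimpleGraph.edge a b).Adj a b := by
    simp [SimpleGraph.edge_adj, hne]
  have hor : ∀ v, G.Reachable v x ∨ G.Reachable v y := fun v => reachable_deleteEdges_or (hH.2 v x)
  -- Without the edge there are only the components of `x` and of `y`. Since `a` and `b` are
  -- separated, they lie in different ones, and the new edge joins the two.
  have hxy : (G ⊔ SimpleGraph.edge a b).Reachable x y := by
    rcases hor a with ha | ha <;> rcases hor b with hb | hb
    · exact (hab (ha.trans hb.symm)).elim
    · exact ((ha.mono hle).symm.trans hadj.reachable).trans (hb.mono hle)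
    · exact ((hb.mono hle).symm.trans hadj.reachable.symm).trans (ha.mono hle)
    · exact (hab (ha.trans hb.symm)).elim
  have hx : ∀ v, (G ⊔ SimpleGraph.edge a b).Reachable v x := fun v =>
    (hor v).elim (fun h => h.mono hle) fun h => (h.mono hle).trans hxy.symm
  exact fun u v => (hx u).trans (hx v).symm

/-- Paths in an acyclic graph are unique, so a path that avoids the edge would have to equal the
given path through it. -/
theorem not_reachable_deleteEdges_of_mem_path {H : SimpleGraph V} (hH : H.IsAcyclic) {a b : V}
    {p : H.Walk a b} (hp : p.IsPath) {x y : V} (he : s(x, y) ∈ p.edges) :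
    ¬ (H.deleteEdges {s(x, y)}).Reachable a b := by
  intro hr
  obtain ⟨q, hq⟩ := hr.exists_isPath
  have hle : H.deleteEdges {s(x, y)} ≤ H := SimpleGraph.deleteEdges_le _
  have h := (hH.subsingleton_path a b).elim ⟨p, hp⟩ ⟨q.mapLe hle, hq.mapLe hle⟩
  have h' : p = q.mapLe hle := congrArg Subtype.val h
  rw [h', SimpleGraph.Walk.edges_mapLe_eq_edges] at he
  have := q.edges_subset_edgeSet he
  simp at this

section Weight

variable [Fintype V]

theorem totalWeight_exchange (w : V → V → ℝ) (hw : ∀ i j, w i j = w j i) {H : SimpleGraph V}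
    {x y a b : V} (hxy : H.Adj x y) (hne : a ≠ b) (hab : ¬ H.Adj a b) :
    totalWeight w (H.deleteEdges {s(x, y)} ⊔ SimpleGraph.edge a b) =
      totalWeight w H - w x y + w a b := by
  classical
  have hxy' := hxy.ne
  -- An edge contributes to the double sum in both orientations; the division by two in
  -- `totalWeight` compensates for this.
  have key : ∀ c d : V, c ≠ d → (∑ i, ∑ j, if (i = c ∧ j = d) ∨ (i = d ∧ j = c) then w i j else 0)
      = 2 * w c d := by
    intro c d hcd
    have : ∀ i j, (if (i = c ∧ j = d) ∨ (i = d ∧ j = c) then w i j else 0) =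
        (if i = c then if j = d then w i j else 0 else 0) +
        (if i = d then if j = c then w i j else 0 else 0) := by
      intro i j
      by_cases h1 : i = c <;> by_cases h2 : i = d <;> simp_all
    simp only [this, Finset.sum_add_distrib]
    simp [hw d c]; ring
  have h1 : ∀ i j, (if (H.deleteEdges {s(x, y)} ⊔ SimpleGraph.edge a b).Adj i j then w i j else 0) =
      (if H.Adj i j then w i j else 0) -
      (if (i = x ∧ j = y) ∨ (i = y ∧ j = x) then w i j else 0) +
      (if (i = a ∧ j = b) ∨ (i = b ∧ j = a) then w i j else 0) := by
    intro i j
    have hA : (H.deleteEdges {s(x, y)} ⊔ SimpleGraph.edge a b).Adj i j ↔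
        (H.Adj i j ∧ ¬ ((i = x ∧ j = y) ∨ (i = y ∧ j = x))) ∨
          ((i = a ∧ j = b) ∨ (i = b ∧ j = a)) := by
      simp only [SimpleGraph.sup_adj, SimpleGraph.deleteEdges_adj, Set.mem_singleton_iff,
        Sym2.eq_iff, SimpleGraph.edge_adj]
      constructor
      · rintro (h | h)
        · exact Or.inl h
        · exact Or.inr h.1
      · rintro (h | h)
        · exact Or.inl h
        · refine Or.inr ⟨h, ?_⟩
          rcases h with ⟨rfl, rfl⟩ | ⟨rfl, rfl⟩
          · exact hne
          · exact hne.symm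
    by_cases hc : (i = a ∧ j = b) ∨ (i = b ∧ j = a)
    · have hn : ¬ H.Adj i j := by
        rcases hc with ⟨rfl, rfl⟩ | ⟨rfl, rfl⟩
        · exact hab
        · exact fun h => hab h.symm
      have hd : ¬ ((i = x ∧ j = y) ∨ (i = y ∧ j = x)) := by
        rintro (⟨rfl, rfl⟩ | ⟨rfl, rfl⟩)
        · exact hn hxy
        · exact hn hxy.symm
      rw [if_pos (hA.2 (Or.inr hc)), if_neg hn, if_neg hd, if_pos hc]; ring
    · by_cases hd : (i = x ∧ j = y) ∨ (i = y ∧ j = x)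
      · have hn : H.Adj i j := by
          rcases hd with ⟨rfl, rfl⟩ | ⟨rfl, rfl⟩
          · exact hxy
          · exact hxy.symm
        rw [if_neg (fun h => (hA.1 h).elim (fun h => h.2 hd) hc), if_pos hn, if_pos hd, if_neg hc]
        ring
      · by_cases hn : H.Adj i j
        · rw [if_pos (hA.2 (Or.inl ⟨hn, hd⟩)), if_pos hn, if_neg hd, if_neg hc]; ring
        · rw [if_neg (fun h => (hA.1 h).elim (fun h => hn h.1) hc), if_neg hn, if_neg hd, if_neg hc]
          ring
  -- The two sides differ only in their decidability instances.
  have h2 : ∀ G : SimpleGraph V, totalWeight w G =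
      (∑ i, ∑ j, if G.Adj i j then w i j else 0) / 2 := by
    intro G
    unfold totalWeight
    congr!
  have h3 : totalWeight w (H.deleteEdges {s(x, y)} ⊔ SimpleGraph.edge a b) = (∑ i, ∑ j,
      ((if H.Adj i j then w i j else 0) -
      (if (i = x ∧ j = y) ∨ (i = y ∧ j = x) then w i j else 0) +
      (if (i = a ∧ j = b) ∨ (i = b ∧ j = a) then w i j else 0))) / 2 := by
    simp only [← h1]
    unfold totalWeight
    congr!
  rw [h3, h2]
  simp only [Finset.sum_add_distrib, Finset.sum_sub_distrib, key x y hxy', key a b hne]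
  ring

/-- Maximum weight spanning trees only depend on the order of the weights. -/
theorem IsMaxSpanningTree.totalWeight_le_of_monotone {w w' : V → V → ℝ}
    (hw : ∀ i j, w i j = w j i) (hw' : ∀ i j, w' i j = w' j i)
    (hmono : ∀ a b c d, a ≠ b → c ≠ d → w a b ≤ w c d → w' a b ≤ w' c d)
    {E : SimpleGraph V} (hE : IsMaxSpanningTree w E) {H : SimpleGraph V} (hH : IsSpanningTree H) :
    totalWeight w' H ≤ totalWeight w' E := by
  classical
  -- Induction on the number of edges of `E` missing in `H`. Each exchange brings `H` closer to `E`
  -- without lowering its `w'`-weight.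
  induction hN : (E.edgeSet \ H.edgeSet).ncard using Nat.strong_induction_on generalizing H with
  | _ N ih =>
  by_cases hsub : E ≤ H
  · rw [hE.1.eq_of_le hH hsub]
  · obtain ⟨a, b, hab, hnab⟩ : ∃ a b, E.Adj a b ∧ ¬ H.Adj a b := by
      by_contra hcon
      push Not at hcon
      exact hsub fun a b h => hcon a b h
    obtain ⟨p, hp⟩ := (hH.2 a b).exists_isPath
    have hbr : ¬ (E.deleteEdges {s(a, b)}).Reachable a b :=
      SimpleGraph.isBridge_iff.1 (SimpleGraph.isAcyclic_iff_forall_isBridge.1 hE.1.1 hab)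
    -- Symmetric exchange: the path of `H` from `a` to `b` crosses the cut that deleting `ab` makes
    -- in `E`, along an edge `xy`. Both E - ab + xy and H - xy + ab are then spanning trees.
    -- Maximality of `E` compares `w` on the two edges, and monotonicity transfers this to `w'`.
    obtain ⟨d, hd, hx, hy⟩ := p.exists_boundary_dart
      {v | (E.deleteEdges {s(a, b)}).Reachable a v} (SimpleGraph.Reachable.refl _) hbr
    set x := d.fst
    set y := d.snd
    have hxy : H.Adj x y := d.adj
    have hmem : s(x, y) ∈ p.edges := List.mem_map.2 ⟨d, hd, rfl⟩
    have hxyE : ¬ (E.deleteEdges {s(a, b)}).Reachable x y := fun h =>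
      hy (SimpleGraph.Reachable.trans hx h)
    have hne : s(x, y) ≠ s(a, b) := by
      intro h
      have : s(a, b) ∈ H.edgeSet := h ▸ (SimpleGraph.mem_edgeSet H).2 hxy
      exact hnab this
    have hnE : ¬ E.Adj x y := fun h => hxyE (SimpleGraph.Adj.reachable (by
      simp only [SimpleGraph.deleteEdges_adj, Set.mem_singleton_iff]; exact ⟨h, hne⟩))
    have hE' := hE.2 _ (hE.1.exchange hxyE)
    rw [totalWeight_exchange w hw hab hxy.ne hnE] at hE'
    have hwle : w' x y ≤ w' a b := hmono _ _ _ _ hxy.ne hab.ne (by linarith)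
    have hH' := hH.exchange (not_reachable_deleteEdges_of_mem_path hH.1 hp hmem)
    have htw := totalWeight_exchange w' hw' hxy hab.ne hnab
    refine le_trans (by rw [htw]; linarith) (ih _ ?_ hH' rfl)
    rw [← hN]
    apply Set.ncard_lt_ncard _ (Set.toFinite _)
    refine ⟨?_, ?_⟩
    · intro e he
      refine ⟨he.1, fun h => he.2 ?_⟩
      have hexy : e ≠ s(x, y) := by
        rintro rfl; exact hnE he.1
      rw [SimpleGraph.edgeSet_sup]
      left
      rw [SimpleGraph.edgeSet_deleteEdges]
      exact ⟨h, hexy⟩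
    · intro h
      have := h (show s(a, b) ∈ E.edgeSet \ H.edgeSet from ⟨hab, hnab⟩)
      apply this.2
      rw [SimpleGraph.edgeSet_sup]
      right
      simp [hab.ne]

end Weight

/-- The vertices of the tree `E` in an order in which every vertex except the first comes after
its parent. -/
structure TreeOrder (E : SimpleGraph V) (rank : V → ℕ) (par : V → Option V) : Prop where
  inj : Function.Injective rank
  rank_lt : ∀ {v p}, par v = some p → rank p < rank v
  exists_par : ∀ {u v}, rank u < rank v → ∃ p, par v = some p
  adj_iff : ∀ u v, E.Adj u v ↔ par u = some v ∨ par v = some u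

namespace TreeOrder

variable {E : SimpleGraph V} {rank : V → ℕ} {par : V → Option V}

theorem adj_par (h : TreeOrder E rank par) {v p : V} (hv : par v = some p) : E.Adj v p :=
  (h.adj_iff v p).2 (Or.inl hv)

/-- Replace the end of larger rank by its parent until the ends meet. The bound on the ranks is
needed later: a path between earlier vertices cannot pass through a later one. -/
theorem exists_walk (h : TreeOrder E rank par) (r : ℕ) (u v : V) (hu : rank u ≤ r)
    (hv : rank v ≤ r) : ∃ p : E.Walk u v, ∀ x ∈ p.support, rank x ≤ r := by
  induction hN : rank u + rank v using Nat.strong_induction_on generalizing u v with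
  | _ N ih =>
  rcases lt_trichotomy (rank u) (rank v) with hlt | heq | hlt
  · obtain ⟨p, hp⟩ := h.exists_par hlt
    have hr := h.rank_lt hp
    obtain ⟨q, hq⟩ := ih _ (by omega) u p hu (by omega) rfl
    refine ⟨q.concat (h.adj_par hp).symm, ?_⟩
    intro x hx
    rw [SimpleGraph.Walk.support_concat, List.mem_append] at hx
    rcases hx with hx | hx
    · exact hq x hx
    · simp at hx; subst hx; exact hv
  · obtain rfl := h.inj heq
    exact ⟨SimpleGraph.Walk.nil, by simpa using hu⟩
  · obtain ⟨p, hp⟩ := h.exists_par hlt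
    have hr := h.rank_lt hp
    obtain ⟨q, hq⟩ := ih _ (by omega) p v (by omega) hv rfl
    refine ⟨SimpleGraph.Walk.cons (h.adj_par hp) q, ?_⟩
    intro x hx
    rw [SimpleGraph.Walk.support_cons, List.mem_cons] at hx
    rcases hx with rfl | hx
    · exact hu
    · exact hq x hx

theorem exists_path (h : TreeOrder E rank par) (r : ℕ) (u v : V) (hu : rank u ≤ r)
    (hv : rank v ≤ r) : ∃ p : E.Walk u v, p.IsPath ∧ ∀ x ∈ p.support, rank x ≤ r := by
  classical
  obtain ⟨p, hp⟩ := h.exists_walk r u v hu hv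
  exact ⟨p.bypass, p.bypass_isPath, fun x hx => hp x (p.support_bypass_subset_support hx)⟩

theorem preconnected (h : TreeOrder E rank par) : E.Preconnected := fun u v =>
  (h.exists_walk (max (rank u) (rank v)) u v (le_max_left _ _) (le_max_right _ _)).elim
    fun p _ => ⟨p⟩

/-- Charge every edge to its child. The vertex of smallest rank has no parent and is never charged.
-/
theorem card_edgeSet_lt [Fintype V] [Nonempty V] (h : TreeOrder E rank par) :
    Nat.card E.edgeSet + 1 ≤ Nat.card V := by
  classical
  obtain ⟨r, -, hr⟩ := Finset.exists_min_image Finset.univ rank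
    (Finset.univ_nonempty (α := V))
  have hrn : par r = none := by
    cases hp : par r with
    | none => rfl
    | some p => exact absurd (h.rank_lt hp) (not_lt.2 (hr p (Finset.mem_univ _)))
  have hsub : E.edgeSet ⊆ ((Finset.univ.erase r).image fun v => s(v, (par v).getD v) :
      Finset (Sym2 V)) := by
    intro e
    induction e with
    | _ u v =>
    intro he
    have he' : E.Adj u v := he
    rw [Finset.coe_image]
    rcases (h.adj_iff u v).1 he' with hp | hp
    · refine ⟨u, ?_, by simp [hp]⟩
      simp only [Finset.coe_erase, Finset.coe_univ, Set.mem_sdiff, Set.mem_univ, true_and,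
        Set.mem_singleton_iff]
      rintro rfl; simp [hrn] at hp
    · refine ⟨v, ?_, by simp [hp, Sym2.eq_swap]⟩
      simp only [Finset.coe_erase, Finset.coe_univ, Set.mem_sdiff, Set.mem_univ, true_and,
        Set.mem_singleton_iff]
      rintro rfl; simp [hrn] at hp
  have h1 : E.edgeSet.ncard ≤ Fintype.card V - 1 := by
    refine (Set.ncard_le_ncard hsub (Finset.finite_toSet _)).trans ?_
    rw [Set.ncard_coe_finset]
    refine Finset.card_image_le.trans ?_
    rw [Finset.card_erase_of_mem (Finset.mem_univ _), Finset.card_univ]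
  have h2 : 0 < Fintype.card V := Fintype.card_pos
  rw [Nat.card_eq_fintype_card (α := V)]
  have h3 : Nat.card E.edgeSet = E.edgeSet.ncard := rfl
  omega

theorem ncard_edgeSet [Fintype V] (h : TreeOrder E rank par) :
    E.edgeSet.ncard = Fintype.card V - 1 := by
  rcases isEmpty_or_nonempty V with hV | hV
  · have : E.edgeSet = ∅ := by
      ext e
      induction e with
      | _ u v => exact (hV.false u).elim
    simp [this]
  · have h1 := h.card_edgeSet_lt
    have hc : E.Connected := ⟨h.preconnected⟩
    have h2 := hc.card_vert_le_card_edgeSet_add_one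
    have h3 : Nat.card E.edgeSet = E.edgeSet.ncard := rfl
    rw [Nat.card_eq_fintype_card (α := V)] at h1 h2
    omega

/-- A connected graph with at most one edge less than vertices is a tree. -/
theorem isSpanningTree [Fintype V] (h : TreeOrder E rank par) : IsSpanningTree E := by
  rcases isEmpty_or_nonempty V with hV | hV
  · exact ⟨SimpleGraph.IsAcyclic.of_subsingleton, fun u => (hV.false u).elim⟩
  · have h1 := h.card_edgeSet_lt
    have hc : E.Connected := ⟨h.preconnected⟩
    have h2 := hc.card_vert_le_card_edgeSet_add_one
    exact ⟨(SimpleGraph.isTree_iff_connected_and_card.2 ⟨hc, by omega⟩).isAcyclic, h.preconnected⟩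

open Classical in
-- Each edge is counted once, at its child; the parent relation cannot hold in both directions
-- because ranks decrease.
theorem totalWeight_eq [Fintype V] (h : TreeOrder E rank par) (w : V → V → ℝ)
    (hw : ∀ i j, w i j = w j i) :
    totalWeight w E = ∑ v, ∑ p, if par v = some p then w v p else 0 := by
  have h1 : ∀ i j, (if E.Adj i j then w i j else 0) =
      (if par i = some j then w i j else 0) + (if par j = some i then w j i else 0) := by
    intro i j
    by_cases h1 : par i = some j
    · have h2 : ¬ par j = some i := fun h2 => by
        have := h.rank_lt h1; have := h.rank_lt h2; omega
      rw [if_pos ((h.adj_iff i j).2 (Or.inl h1)), if_pos h1, if_neg h2, add_zero]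
    · by_cases h2 : par j = some i
      · rw [if_pos ((h.adj_iff i j).2 (Or.inr h2)), if_neg h1, if_pos h2, zero_add, hw]
      · rw [if_neg (fun hE => ((h.adj_iff i j).1 hE).elim h1 h2), if_neg h1, if_neg h2, add_zero]
  unfold totalWeight
  simp only [h1, Finset.sum_add_distrib]
  rw [Finset.sum_comm (f := fun i j => if par j = some i then w j i else 0)]
  ring

/-- A tree grown by adding an edge of maximum weight in each step is a maximum weight spanning
tree. -/
theorem isMaxSpanningTree [Fintype V] (h : TreeOrder E rank par) {w : V → V → ℝ}
    (hw : ∀ i j, w i j = w j i)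
    (hmax : ∀ v p, par v = some p → ∀ u x, rank u < rank v → rank v ≤ rank x → w x u ≤ w v p) :
    IsMaxSpanningTree w E := by
  classical
  refine ⟨h.isSpanningTree, fun H hH => ?_⟩
  -- An arbitrary spanning tree is turned into `E` one vertex at a time, in the order of the ranks,
  -- without losing weight.
  have key : ∀ r : ℕ, ∃ H' : SimpleGraph V, IsSpanningTree H' ∧
      totalWeight w H ≤ totalWeight w H' ∧
      ∀ v p, par v = some p → rank v < r → H'.Adj v p := by
    intro r
    induction r with
    | zero => exact ⟨H, hH, le_rfl, fun v p _ hr => absurd hr (Nat.not_lt_zero _)⟩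
    | succ r ih =>
      obtain ⟨G, hG, hGw, hGr⟩ := ih
      by_cases hall : ∀ v p, par v = some p → rank v < r + 1 → G.Adj v p
      · exact ⟨G, hG, hGw, hall⟩
      push Not at hall
      obtain ⟨v, p, hvp, hvr, hnadj⟩ := hall
      have hvr' : rank v = r := by
        by_contra hne
        exact hnadj (hGr v p hvp (by omega))
      have hpr := h.rank_lt hvp
      obtain ⟨q, hq⟩ := (hG.2 v p).exists_isPath
      -- The path from `v` to its parent leaves the set of vertices not earlier than `v`. By `hmax`,
      -- the crossing edge is no heavier than the edge from `v` to its parent, which replaces it.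
      obtain ⟨d, hd, hx, hy⟩ := q.exists_boundary_dart {x | rank v ≤ rank x}
        (show rank v ≤ rank v from le_rfl) (by simpa using hpr)
      set x := d.fst
      set y := d.snd
      have hx' : rank v ≤ rank x := hx
      have hy' : rank y < rank v := not_le.1 hy
      have hxy : G.Adj x y := d.adj
      have hmem : s(x, y) ∈ q.edges := List.mem_map.2 ⟨d, hd, rfl⟩
      have hne : v ≠ p := (h.adj_par hvp).ne
      refine ⟨_, hG.exchange (not_reachable_deleteEdges_of_mem_path hG.1 hq hmem), ?_, ?_⟩
      · rw [totalWeight_exchange w hw hxy hne hnadj]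
        have := hmax v p hvp y x hy' hx'
        linarith
      · intro v' p' hv' hr'
        rcases eq_or_ne v' v with rfl | hv
        · rw [hvp] at hv'
          obtain rfl := Option.some.inj hv'
          simp [SimpleGraph.edge_adj, hne]
        · have hrv : rank v' ≠ rank v := fun e => hv (h.inj e)
          have hlt : rank v' < r := by omega
          have hp' := h.rank_lt hv'
          rw [SimpleGraph.sup_adj]
          left
          simp only [SimpleGraph.deleteEdges_adj, Set.mem_singleton_iff]
          refine ⟨hGr _ _ hv' hlt, fun he => ?_⟩
          -- The deleted edge has the end `x` of rank at least `rank v`, so it is none of the edges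
          -- secured before.
          rcases Sym2.eq_iff.1 he with ⟨h1, h2⟩ | ⟨h1, h2⟩
          · rw [← h1] at hx'; omega
          · rw [← h2] at hx'; omega
  obtain ⟨H', hH', hw1, hr⟩ := key (Finset.univ.sup rank + 1)
  have hle : E ≤ H' := by
    intro u v huv
    have hb : ∀ v, rank v < Finset.univ.sup rank + 1 := fun v =>
      Nat.lt_succ_of_le (Finset.le_sup (Finset.mem_univ v))
    rcases (h.adj_iff u v).1 huv with hp | hp
    · exact hr _ _ hp (hb _)
    · exact (hr _ _ hp (hb _)).symm
  rw [h.isSpanningTree.eq_of_le hH' hle]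
  exact hw1

end TreeOrder

/-- Order the vertices by distance from a root and let the parent be a neighbour closer to the root.
The parent edges form a spanning tree inside `E`, hence all of `E`. -/
theorem IsSpanningTree.exists_treeOrder [Fintype V] {E : SimpleGraph V} (hE : IsSpanningTree E) :
    ∃ rank par, TreeOrder E rank par := by
  classical
  rcases isEmpty_or_nonempty V with hV | hV
  · refine ⟨fun _ => 0, fun _ => none, ?_, ?_, ?_, ?_⟩
    · exact fun u => (hV.false u).elim
    · exact fun {u} => (hV.false u).elim
    · exact fun {u} => (hV.false u).elim
    · exact fun u => (hV.false u).elim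
  obtain ⟨r⟩ := hV
  have hstep : ∀ v, v ≠ r → ∃ p, E.Adj v p ∧ E.dist r p < E.dist r v := by
    intro v hv
    obtain ⟨q, hq⟩ := (hE.2 v r).exists_walk_length_eq_dist
    cases q with
    | nil => exact absurd rfl hv
    | @cons _ p _ hadj q =>
      refine ⟨p, hadj, ?_⟩
      rw [SimpleGraph.dist_comm (u := r) (v := v), ← hq, SimpleGraph.dist_comm]
      have := SimpleGraph.dist_le q
      simp only [SimpleGraph.Walk.length_cons]; omega
  choose! f hf using hstep
  set N := Fintype.card V
  let idx : V → ℕ := fun v => (Fintype.equivFin V v : ℕ)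
  have hidx : ∀ v, idx v < N := fun v => (Fintype.equivFin V v).2
  -- Indices are smaller than `N`, so distance decides first; the index only makes the rank
  -- injective.
  let rank : V → ℕ := fun v => E.dist r v * N + idx v
  let par : V → Option V := fun v => if v = r then none else some (f v)
  have hlt : ∀ u v, E.dist r u < E.dist r v → rank u < rank v := by
    intro u v h
    have h1 : (E.dist r u + 1) * N ≤ E.dist r v * N := Nat.mul_le_mul_right _ h
    have h2 := hidx u
    change E.dist r u * N + idx u < E.dist r v * N + idx v
    rw [Nat.add_mul] at h1
    omega
  have hpar : ∀ {v p}, par v = some p → v ≠ r ∧ p = f v := by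
    intro v p h
    by_cases hv : v = r
    · simp [par, hv] at h
    · simp only [par, hv, if_false, Option.some.injEq] at h
      exact ⟨hv, h.symm⟩
  let E' : SimpleGraph V :=
    { Adj := fun u v => par u = some v ∨ par v = some u
      symm := ⟨fun u v h => h.symm⟩
      loopless := ⟨fun u h => by
        have h' : par u = some u := h.elim id id
        obtain ⟨h1, h2⟩ := hpar h'
        exact (hf u h1).1.ne h2⟩ }
  have hord : TreeOrder E' rank par := by
    refine ⟨?_, ?_, ?_, fun _ _ => Iff.rfl⟩
    · intro u v h
      have hd : E.dist r u = E.dist r v := by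
        rcases lt_trichotomy (E.dist r u) (E.dist r v) with h1 | h1 | h1
        · exact absurd h (hlt u v h1).ne
        · exact h1
        · exact absurd h (hlt v u h1).ne'
      have hi : idx u = idx v := by
        change E.dist r u * N + idx u = E.dist r v * N + idx v at h
        rw [hd] at h; omega
      exact (Fintype.equivFin V).injective (Fin.ext hi)
    · intro v p h
      obtain ⟨h1, rfl⟩ := hpar h
      exact hlt _ _ (hf v h1).2
    · intro u v h
      by_cases hv : v = r
      · subst hv
        exfalso
        rcases Nat.eq_zero_or_pos (E.dist v u) with h0 | h0
        · have : v = u := (hE.2 v u).dist_eq_zero_iff.1 h0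
          subst this; exact lt_irrefl _ h
        · have := hlt v u (by simpa using h0)
          omega
      · exact ⟨f v, by simp [par, hv]⟩
  have hle : E' ≤ E := by
    intro u v h
    rcases h with h | h
    · obtain ⟨h1, rfl⟩ := hpar h
      exact (hf u h1).1
    · obtain ⟨h1, rfl⟩ := hpar h
      exact (hf v h1).1.symm
  have := hord.isSpanningTree.eq_of_le hE hle
  exact ⟨rank, par, this ▸ hord⟩

end SpanningTrees

/-! ### Covariance matrices that are Markov on a tree -/

section TreeCovariance

variable {V : Type*}

/-- `M` is obtained from `A` by regressing each vertex on its parent. -/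
structure TreeCov (rank : V → ℕ) (par : V → Option V) (A M : Matrix V V ℝ) : Prop where
  symm : ∀ i j, M i j = M j i
  diag : ∀ i, M i i = A i i
  step : ∀ {i j p}, par i = some p → rank j < rank i → M i j = A i p / A p p * M p j

/-- The last three conditions on an output of the Chow-Liu algorithm. -/
structure PathCov (E : SimpleGraph V) (A M : Matrix V V ℝ) : Prop where
  diag : ∀ i, M i i = A i i
  edge : ∀ i j, E.Adj i j → M i j = A i j
  path : ∀ i j, i ≠ j → ¬ E.Adj i j → ∀ p : E.Walk i j, p.IsPath →
    M i j = Real.sqrt (A i i * A j j) * (p.darts.map fun d => correlation A d.fst d.snd).prod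

theorem PosDef.apply_comm {A : Matrix V V ℝ} (hA : A.PosDef) (i j : V) : A i j = A j i := by
  have := hA.isHermitian.apply j i
  simpa using this

/-- The `2 × 2` principal minors of a positive definite matrix are positive. -/
theorem PosDef.minor_pos {A : Matrix V V ℝ} (hA : A.PosDef) {i j : V} (hij : i ≠ j) :
    0 < A i i * A j j - A i j ^ 2 := by
  have hinj : Function.Injective ![i, j] := by
    intro a b h
    fin_cases a <;> fin_cases b <;> simp_all
  have h := (hA.submatrix hinj).det_pos
  rw [Matrix.det_fin_two] at h
  simp only [Matrix.submatrix_apply, Matrix.cons_val_zero, Matrix.cons_val_one] at h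
  rw [PosDef.apply_comm hA j i] at h
  nlinarith [h]

theorem correlation_comm {A : Matrix V V ℝ} (hA : A.PosDef) (i j : V) :
    correlation A i j = correlation A j i := by
  rw [correlation, correlation, PosDef.apply_comm hA i j, mul_comm (A i i)]

theorem correlation_mul_sqrt {A : Matrix V V ℝ} (hA : A.PosDef) (i j : V) :
    Real.sqrt (A i i * A j j) * correlation A i j = A i j := by
  have h : Real.sqrt (A i i * A j j) ≠ 0 :=
    (Real.sqrt_pos.2 (mul_pos hA.diag_pos hA.diag_pos)).ne'
  rw [correlation, mul_div_cancel₀ _ h]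

theorem sq_correlation {A : Matrix V V ℝ} (hA : A.PosDef) (i j : V) :
    correlation A i j ^ 2 = A i j ^ 2 / (A i i * A j j) := by
  rw [correlation, div_pow, Real.sq_sqrt (mul_pos hA.diag_pos hA.diag_pos).le]

theorem sq_correlation_lt_one {A : Matrix V V ℝ} (hA : A.PosDef) {i j : V} (hij : i ≠ j) :
    correlation A i j ^ 2 < 1 := by
  rw [sq_correlation hA, div_lt_one (mul_pos hA.diag_pos hA.diag_pos)]
  linarith [PosDef.minor_pos hA hij]

namespace PathCov

variable {E : SimpleGraph V} {A M : Matrix V V ℝ} {rank : V → ℕ} {par : V → Option V}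

/-- Extends the product formula to tree edges, where the unique path is the edge itself. -/
theorem eq_prod (h : PathCov E A M) (hA : A.PosDef) (hE : E.IsAcyclic) {i j : V}
    (hij : i ≠ j) {p : E.Walk i j} (hp : p.IsPath) :
    M i j = Real.sqrt (A i i * A j j) * (p.darts.map fun d => correlation A d.fst d.snd).prod := by
  by_cases hadj : E.Adj i j
  · have h1 : p = SimpleGraph.Walk.cons hadj SimpleGraph.Walk.nil := by
      have h2 : (SimpleGraph.Walk.cons hadj SimpleGraph.Walk.nil : E.Walk i j).IsPath := by
        simp [hij]
      exact congrArg Subtype.val ((hE.subsingleton_path i j).elim ⟨p, hp⟩ ⟨_, h2⟩)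
    rw [h1, h.edge i j hadj]
    simp [correlation_mul_sqrt hA]
  · exact h.path i j hij hadj p hp

theorem symm (h : PathCov E A M) (hA : A.PosDef) (hE : IsSpanningTree E) (i j : V) :
    M i j = M j i := by
  rcases eq_or_ne i j with rfl | hij
  · rfl
  obtain ⟨p, hp⟩ := (hE.2 i j).exists_isPath
  rw [h.eq_prod hA hE.1 hij hp, h.eq_prod hA hE.1 hij.symm hp.reverse, mul_comm (A i i)]
  congr 1
  rw [SimpleGraph.Walk.darts_reverse, List.map_reverse, List.prod_reverse, List.map_map]
  congr 1
  exact List.map_congr_left fun d _ => correlation_comm hA _ _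

/-- The path from `i` to an earlier vertex starts with the edge to the parent `p`, because the path
from `p` onwards stays at ranks below that of `i`. Splitting off this factor and rescaling by
standard deviations turns the correlation into the regression coefficient `A i p / A p p`. -/
theorem treeCov (h : PathCov E A M) (hA : A.PosDef) (hE : IsSpanningTree E)
    (ho : TreeOrder E rank par) : TreeCov rank par A M := by
  refine ⟨h.symm hA hE, h.diag, ?_⟩
  intro i j p hp hij
  have hadj := ho.adj_par hp
  have hpp : A p p ≠ 0 := hA.diag_pos.ne'
  rcases eq_or_ne p j with rfl | hpj
  · rw [h.edge i p hadj, h.diag]; field_simp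
  have hrp := ho.rank_lt hp
  obtain ⟨q, hq, hqr⟩ := ho.exists_path (max (rank p) (rank j)) p j (le_max_left _ _)
    (le_max_right _ _)
  have hiq : i ∉ q.support := fun hi => by
    have := hqr i hi
    omega
  have hne : i ≠ j := by rintro rfl; exact lt_irrefl _ hij
  have hc : (SimpleGraph.Walk.cons hadj q).IsPath := hq.cons hiq
  rw [h.eq_prod hA hE.1 hne hc, h.eq_prod hA hE.1 hpj hq]
  simp only [SimpleGraph.Walk.darts_cons, List.map_cons, List.prod_cons]
  rw [← mul_assoc, ← mul_assoc]
  congr 1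
  have hi := (hA.diag_pos (i := i)).le
  have hj := (hA.diag_pos (i := j)).le
  have hp' := hA.diag_pos (i := p)
  rw [correlation, Real.sqrt_mul hi, Real.sqrt_mul hi, Real.sqrt_mul hp'.le]
  have h1 : Real.sqrt (A i i) ≠ 0 := (Real.sqrt_pos.2 hA.diag_pos).ne'
  have h2 : Real.sqrt (A p p) ≠ 0 := (Real.sqrt_pos.2 hA.diag_pos).ne'
  have h3 : A p p = Real.sqrt (A p p) * Real.sqrt (A p p) := (Real.mul_self_sqrt hp'.le).symm
  generalize Real.sqrt (A p p) = s at h2 h3 ⊢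
  rw [h3]
  field_simp

end PathCov

/-- Paths in a tree are unique, so evaluating the product on one chosen path satisfies the condition
for all paths. -/
theorem exists_pathCov {E : SimpleGraph V} (hE : IsSpanningTree E) (A : Matrix V V ℝ) :
    ∃ M, PathCov E A M := by
  classical
  refine ⟨fun i j => if i = j then A i i else if E.Adj i j then A i j else
    Real.sqrt (A i i * A j j) *
      ((hE.2 i j).exists_isPath.choose.darts.map fun d => correlation A d.fst d.snd).prod,
    ?_, ?_, ?_⟩
  · intro i; simp
  · intro i j h; simp [h, h.ne]
  · intro i j hij hadj p hp
    have h1 : (hE.2 i j).exists_isPath.choose = p := congrArg Subtype.val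
      ((hE.1.subsingleton_path i j).elim ⟨_, (hE.2 i j).exists_isPath.choose_spec⟩ ⟨p, hp⟩)
    simp only [if_neg hij, if_neg hadj, h1]

/-! ### Diagonalization, inverse and determinant of a tree covariance -/

namespace TreeCov

variable {E : SimpleGraph V} {rank : V → ℕ} {par : V → Option V} {A M : Matrix V V ℝ}

theorem apply_par (ho : TreeOrder E rank par) (hA : A.PosDef) (h : TreeCov rank par A M) {i p : V}
    (hp : par i = some p) : M i p = A i p := by
  rw [h.step hp (ho.rank_lt hp), h.diag, div_mul_cancel₀ _ (hA.diag_pos (i := p)).ne']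

variable [Fintype V] [DecidableEq V]

/-- The unit triangular matrix whose inverse maps independent residuals to the variables. -/
def residualMatrix (par : V → Option V) (A : Matrix V V ℝ) : Matrix V V ℝ :=
  1 - Matrix.of fun v u => if par v = some u then A v u / A u u else 0

/-- The variance of the residual of `v` given its parent. -/
def residualVariance (par : V → Option V) (A : Matrix V V ℝ) (v : V) : ℝ :=
  A v v - ∑ u, if par v = some u then A v u ^ 2 / A u u else 0

theorem residualMatrix_mul (par : V → Option V) (A X : Matrix V V ℝ) (v j : V) :
    (residualMatrix par A * X) v j =
      X v j - ∑ u, if par v = some u then A v u / A u u * X u j else 0 := by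
  rw [residualMatrix, Matrix.sub_mul, Matrix.one_mul, Matrix.sub_apply, Matrix.mul_apply]
  simp [ite_mul]

theorem mul_residualMatrix_transpose (par : V → Option V) (A X : Matrix V V ℝ) (i v : V) :
    (X * (residualMatrix par A)ᵀ) i v =
      X i v - ∑ u, if par v = some u then A v u / A u u * X i u else 0 := by
  have h := residualMatrix_mul par A Xᵀ v i
  have h2 : X * (residualMatrix par A)ᵀ = (residualMatrix par A * Xᵀ)ᵀ := by
    rw [Matrix.transpose_mul, Matrix.transpose_transpose]
  rw [h2, Matrix.transpose_apply, h]
  rfl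

/-- The residual of a vertex given its parent is uncorrelated with every earlier vertex; this is
what `TreeCov.step` says. Earlier residuals combine earlier vertices only, so entries with the row
later than the column vanish, and symmetry removes the others. -/
theorem conj_residualMatrix (ho : TreeOrder E rank par) (hA : A.PosDef)
    (h : TreeCov rank par A M) :
    residualMatrix par A * M * (residualMatrix par A)ᵀ =
      Matrix.diagonal (residualVariance par A) := by
  set L := residualMatrix par A with hL
  have hzero : ∀ i j, rank j < rank i → (L * M) i j = 0 := by
    intro i j hij
    obtain ⟨p, hp⟩ := ho.exists_par hij
    rw [hL, residualMatrix_mul]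
    simp [hp, h.step hp hij]
  have hzero' : ∀ i j, rank j < rank i → (L * M * Lᵀ) i j = 0 := by
    intro i j hij
    rw [hL, mul_residualMatrix_transpose, ← hL, hzero i j hij, zero_sub, neg_eq_zero]
    refine Finset.sum_eq_zero fun u _ => ?_
    split_ifs with hu
    · rw [hzero i u ((ho.rank_lt hu).trans hij), mul_zero]
    · rfl
  have hsymm : (L * M * Lᵀ)ᵀ = L * M * Lᵀ := by
    have hM : Mᵀ = M := by ext i j; exact h.symm j i
    rw [Matrix.transpose_mul, Matrix.transpose_mul, Matrix.transpose_transpose, hM,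
      Matrix.mul_assoc]
  ext i j
  rcases lt_trichotomy (rank i) (rank j) with hlt | heq | hlt
  · have hne : i ≠ j := by rintro rfl; exact lt_irrefl _ hlt
    rw [Matrix.diagonal_apply_ne _ hne, ← hsymm, Matrix.transpose_apply, hzero' j i hlt]
  · obtain rfl := ho.inj heq
    rw [Matrix.diagonal_apply_eq, hL, mul_residualMatrix_transpose, ← hL, hL, residualMatrix_mul,
      residualVariance]
    cases hp : par i with
    | none => simp [h.diag]
    | some p =>
      have h1 := hzero i p (ho.rank_lt hp)
      rw [hL] at h1
      have hpp : A p p ≠ 0 := hA.diag_pos.ne'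
      simp only [Option.some.injEq, Finset.sum_ite_eq, Finset.mem_univ, if_true]
      rw [h1, h.diag, h.symm p i, h.apply_par ho hA hp]
      field_simp
      ring
  · have hne : i ≠ j := by rintro rfl; exact lt_irrefl _ hlt
    rw [Matrix.diagonal_apply_ne _ hne, hzero' i j hlt]

/-- Parents have smaller rank, so the matrix is lower unitriangular for the linear order pulled back
along `rank`. -/
theorem det_residualMatrix (ho : TreeOrder E rank par) (A : Matrix V V ℝ) :
    (residualMatrix par A).det = 1 := by
  let _ : LinearOrder V := LinearOrder.lift' rank ho.inj
  have hlt : ∀ i j : V, i < j ↔ rank i < rank j := fun i j => Iff.rfl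
  rw [Matrix.det_of_isLowerTriangular]
  · refine Finset.prod_eq_one fun i _ => ?_
    have : par i ≠ some i := fun h => lt_irrefl _ (ho.rank_lt h)
    simp [residualMatrix, this]
  · intro i j hij
    have hij' : rank i < rank j := hij
    have hne : i ≠ j := by rintro rfl; exact lt_irrefl _ hij'
    have : par i ≠ some j := fun h => by have := ho.rank_lt h; omega
    simp [residualMatrix, this, hne]

theorem residualVariance_none {v : V} (hv : par v = none) : residualVariance par A v = A v v := by
  simp [residualVariance, hv]

theorem residualVariance_some (hA : A.PosDef) {v p : V} (hv : par v = some p) :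
    residualVariance par A v = (A v v * A p p - A v p ^ 2) / A p p := by
  have hpp : A p p ≠ 0 := hA.diag_pos.ne'
  simp only [residualVariance, hv, Option.some.injEq, Finset.sum_ite_eq, Finset.mem_univ, if_true]
  field_simp

theorem residualVariance_pos (ho : TreeOrder E rank par) (hA : A.PosDef) (v : V) :
    0 < residualVariance par A v := by
  cases hv : par v with
  | none => rw [residualVariance_none hv]; exact hA.diag_pos
  | some p =>
    rw [residualVariance_some hA hv]
    exact div_pos (PosDef.minor_pos hA (ho.adj_par hv).ne) hA.diag_pos

theorem isUnit_residualMatrix (ho : TreeOrder E rank par) (A : Matrix V V ℝ) :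
    IsUnit (residualMatrix par A) :=
  (Matrix.isUnit_iff_isUnit_det _).2 (by rw [det_residualMatrix ho]; exact isUnit_one)

/-- A matrix congruent to a positive diagonal matrix is positive definite. -/
theorem posDef (ho : TreeOrder E rank par) (hA : A.PosDef) (h : TreeCov rank par A M) :
    M.PosDef := by
  rw [← Matrix.IsUnit.posDef_star_right_conjugate_iff (isUnit_residualMatrix ho A)]
  rw [Matrix.star_eq_conjTranspose, Matrix.conjTranspose_eq_transpose_of_trivial,
    h.conj_residualMatrix ho hA]
  exact Matrix.PosDef.diagonal (residualVariance_pos ho hA)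

theorem det_eq (ho : TreeOrder E rank par) (hA : A.PosDef) (h : TreeCov rank par A M) :
    M.det = ∏ v, residualVariance par A v := by
  have := congrArg Matrix.det (h.conj_residualMatrix ho hA)
  simpa [Matrix.det_mul, det_residualMatrix ho, Matrix.det_diagonal] using this

theorem inv_eq (ho : TreeOrder E rank par) (hA : A.PosDef) (h : TreeCov rank par A M) :
    M⁻¹ = (residualMatrix par A)ᵀ * Matrix.diagonal (fun v => (residualVariance par A v)⁻¹) *
      residualMatrix par A := by
  have hD : (Matrix.diagonal (residualVariance par A))⁻¹ =
      Matrix.diagonal (fun v => (residualVariance par A v)⁻¹) := by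
    refine Matrix.inv_eq_right_inv ?_
    rw [Matrix.diagonal_mul_diagonal, ← Matrix.diagonal_one]
    congr 1
    ext v
    exact mul_inv_cancel₀ (residualVariance_pos ho hA v).ne'
  have hu : IsUnit (residualMatrix par A).det := by rw [det_residualMatrix ho]; exact isUnit_one
  have hu' : IsUnit ((residualMatrix par A)ᵀ).det := by rwa [Matrix.det_transpose]
  rw [← hD, ← h.conj_residualMatrix ho hA, Matrix.mul_inv_rev, Matrix.mul_inv_rev,
    ← Matrix.mul_assoc, ← Matrix.mul_assoc, Matrix.mul_nonsing_inv _ hu', Matrix.one_mul,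
    Matrix.mul_assoc, Matrix.nonsing_inv_mul _ hu, Matrix.mul_one]

/-- Expand Lᵀ D⁻¹ L, where each row of L has a unit entry and at most one parent entry. The four
products are unit-unit, the two mixed ones and parent-parent; the last needs a vertex with both `i`
and `j` as parent, hence `i = j`. -/
theorem inv_apply_aux (ho : TreeOrder E rank par) (hA : A.PosDef) (h : TreeCov rank par A M)
    (i j : V) : M⁻¹ i j = (if i = j then (residualVariance par A i)⁻¹ else 0)
      - (if par i = some j then (residualVariance par A i)⁻¹ * (A i j / A j j) else 0)
      - (if par j = some i then (residualVariance par A j)⁻¹ * (A j i / A i i) else 0)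
      + if i = j then
          ∑ v, if par v = some i then (residualVariance par A v)⁻¹ * (A v i / A i i) ^ 2 else 0
        else 0 := by
  rw [h.inv_eq ho hA, Matrix.mul_apply]
  simp only [Matrix.mul_diagonal, Matrix.transpose_apply, residualMatrix, Matrix.sub_apply,
    Matrix.of_apply, Matrix.one_apply]
  have : ∀ v, ((if v = i then (1 : ℝ) else 0) - if par v = some i then A v i / A i i else 0) *
      (residualVariance par A v)⁻¹ *
      ((if v = j then 1 else 0) - if par v = some j then A v j / A j j else 0) =
      (if v = i then if v = j then (residualVariance par A v)⁻¹ else 0 else 0)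
      - (if v = i then
          if par v = some j then (residualVariance par A v)⁻¹ * (A v j / A j j) else 0 else 0)
      - (if v = j then
          if par v = some i then (residualVariance par A v)⁻¹ * (A v i / A i i) else 0 else 0)
      + if par v = some i then if par v = some j then
          (residualVariance par A v)⁻¹ * (A v i / A i i) * (A v j / A j j) else 0 else 0 := by
    intro v
    split_ifs <;> ring
  simp only [this, Finset.sum_add_distrib, Finset.sum_sub_distrib, Finset.sum_ite_eq',
    Finset.mem_univ, if_true]
  congr 1
  by_cases hij : i = j
  · subst hij
    rw [if_pos rfl]
    refine Finset.sum_congr rfl fun v _ => ?_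
    split_ifs <;> ring
  · rw [if_neg hij]
    refine Finset.sum_eq_zero fun v _ => ?_
    by_cases h1 : par v = some i
    · have h2 : par v ≠ some j := by rw [h1]; simpa using hij
      rw [if_pos h1, if_neg h2]
    · rw [if_neg h1]

theorem inv_apply_of_not_adj (ho : TreeOrder E rank par) (hA : A.PosDef)
    (h : TreeCov rank par A M) {i j : V} (hij : i ≠ j) (hadj : ¬ E.Adj i j) : M⁻¹ i j = 0 := by
  rw [ho.adj_iff, not_or] at hadj
  rw [h.inv_apply_aux ho hA, if_neg hij, if_neg hadj.1, if_neg hadj.2, if_neg hij]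
  simp

/-- The value does not depend on which end is the parent, so a program can compute it from an
unoriented edge list. -/
theorem inv_apply_of_adj (ho : TreeOrder E rank par) (hA : A.PosDef)
    (h : TreeCov rank par A M) {i j : V} (hadj : E.Adj i j) :
    M⁻¹ i j = - A i j / (A i i * A j j - A i j ^ 2) := by
  have hne := hadj.ne
  have key : ∀ v p, par v = some p → (residualVariance par A v)⁻¹ * (A v p / A p p) =
      A v p / (A v v * A p p - A v p ^ 2) := by
    intro v p hv
    have h1 := (PosDef.minor_pos hA (ho.adj_par hv).ne).ne'
    have h2 : A p p ≠ 0 := hA.diag_pos.ne'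
    rw [residualVariance_some hA hv]
    field_simp
  rw [h.inv_apply_aux ho hA, if_neg hne, if_neg hne]
  rcases (ho.adj_iff i j).1 hadj with hp | hp
  · have hn : par j ≠ some i := fun h2 => by
      have := ho.rank_lt hp; have := ho.rank_lt h2; omega
    rw [if_pos hp, if_neg hn, key i j hp]
    ring
  · have hn : par i ≠ some j := fun h2 => by
      have := ho.rank_lt hp; have := ho.rank_lt h2; omega
    rw [if_neg hn, if_pos hp, key j i hp, PosDef.apply_comm hA j i, mul_comm (A j j)]
    ring

open Classical in
-- The contributions of the parent and of the children take the same form, which gives a sum over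
-- neighbours without reference to a root.
theorem inv_apply_self (ho : TreeOrder E rank par) (hA : A.PosDef)
    (h : TreeCov rank par A M) (i : V) :
    M⁻¹ i i = 1 / A i i + ∑ j, if E.Adj i j then
      A i j ^ 2 / (A i i * (A i i * A j j - A i j ^ 2)) else 0 := by
  have hni : par i ≠ some i := fun h => lt_irrefl _ (ho.rank_lt h)
  rw [h.inv_apply_aux ho hA, if_pos rfl, if_neg hni, if_pos rfl]
  have hsum : ∀ j, (if E.Adj i j then
      A i j ^ 2 / (A i i * (A i i * A j j - A i j ^ 2)) else 0) =
      (if par i = some j then A i j ^ 2 / (A i i * (A i i * A j j - A i j ^ 2)) else 0) +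
      (if par j = some i then (residualVariance par A j)⁻¹ * (A j i / A i i) ^ 2 else 0) := by
    intro j
    by_cases hp : par i = some j
    · have hn : par j ≠ some i := fun h2 => by
        have := ho.rank_lt hp; have := ho.rank_lt h2; omega
      rw [if_pos ((ho.adj_iff i j).2 (Or.inl hp)), if_pos hp, if_neg hn, add_zero]
    · by_cases hp' : par j = some i
      · have h1 := (PosDef.minor_pos hA (ho.adj_par hp').ne').ne'
        have h2 : A i i ≠ 0 := hA.diag_pos.ne'
        rw [if_pos ((ho.adj_iff i j).2 (Or.inr hp')), if_neg hp, if_pos hp', zero_add,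
          residualVariance_some hA hp', PosDef.apply_comm hA j i, mul_comm (A j j)]
        field_simp
      · rw [if_neg (fun hE => ((ho.adj_iff i j).1 hE).elim hp hp'), if_neg hp, if_neg hp', add_zero]
  simp only [hsum, Finset.sum_add_distrib]
  -- Splitting `1 / A i i` off the inverse residual variance leaves a parent term of the same shape
  -- as the terms of the children.
  have hfirst : (residualVariance par A i)⁻¹ = 1 / A i i + ∑ j, if par i = some j then
      A i j ^ 2 / (A i i * (A i i * A j j - A i j ^ 2)) else 0 := by
    cases hp : par i with
    | none => simp [residualVariance_none hp]
    | some p =>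
      have h1 := (PosDef.minor_pos hA (ho.adj_par hp).ne).ne'
      have h2 : A i i ≠ 0 := hA.diag_pos.ne'
      have h3 : A p p ≠ 0 := hA.diag_pos.ne'
      simp only [Option.some.injEq, Finset.sum_ite_eq, Finset.mem_univ, if_true]
      rw [residualVariance_some hA hp]
      field_simp
      ring
  rw [hfirst]
  ring

open Classical in
-- The determinant is the product of the residual variances, and each is the variance times 1 - ρ²
-- for the edge to the parent. Minimizing the determinant thus becomes a maximum weight spanning
-- tree problem.
theorem log_det_eq (ho : TreeOrder E rank par) (hA : A.PosDef) (h : TreeCov rank par A M) :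
    Real.log M.det = (∑ v, Real.log (A v v)) -
      totalWeight (fun i j => - Real.log (1 - correlation A i j ^ 2)) E := by
  rw [h.det_eq ho hA, Real.log_prod (fun v _ => (residualVariance_pos ho hA v).ne'),
    ho.totalWeight_eq _ (fun i j => by rw [correlation_comm hA]), ← Finset.sum_sub_distrib]
  refine Finset.sum_congr rfl fun v _ => ?_
  cases hv : par v with
  | none => simp [residualVariance_none hv]
  | some p =>
    have h0 := PosDef.minor_pos hA (ho.adj_par hv).ne
    have h2 : 0 < A p p := hA.diag_pos
    have h3 : 0 < A v v := hA.diag_pos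
    have h4 := sq_correlation_lt_one hA (ho.adj_par hv).ne
    simp only [Option.some.injEq, Finset.sum_ite_eq, Finset.mem_univ, if_true, sub_neg_eq_add]
    rw [← Real.log_mul h3.ne' (by linarith), residualVariance_some hA hv, sq_correlation hA]
    congr 1
    field_simp

end TreeCov

end TreeCovariance

set_option linter.unusedSectionVars false

/-! ### Block matrices and Schur complements -/

section Blocks

variable {V : Type*} [Fintype V] [DecidableEq V] (F : Finset V)

theorem assemble_apply_FF (A : Matrix {i // i ∈ F} {i // i ∈ F} ℝ)
    (B : Matrix {i // i ∉ F} {i // i ∈ F} ℝ) (D : Matrix {i // i ∉ F} {i // i ∉ F} ℝ)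
    (i j : {i // i ∈ F}) : assemble F A B D i j = A i j := by
  simp [assemble, Equiv.sumCompl_symm_apply_of_pos i.2, Equiv.sumCompl_symm_apply_of_pos j.2]

theorem assemble_apply_TF (A : Matrix {i // i ∈ F} {i // i ∈ F} ℝ)
    (B : Matrix {i // i ∉ F} {i // i ∈ F} ℝ) (D : Matrix {i // i ∉ F} {i // i ∉ F} ℝ)
    (i : {i // i ∉ F}) (j : {i // i ∈ F}) : assemble F A B D i j = B i j := by
  simp [assemble, Equiv.sumCompl_symm_apply_of_neg (p := fun i => i ∈ F) i.2,
    Equiv.sumCompl_symm_apply_of_pos j.2]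

theorem assemble_apply_FT (A : Matrix {i // i ∈ F} {i // i ∈ F} ℝ)
    (B : Matrix {i // i ∉ F} {i // i ∈ F} ℝ) (D : Matrix {i // i ∉ F} {i // i ∉ F} ℝ)
    (i : {i // i ∈ F}) (j : {i // i ∉ F}) : assemble F A B D i j = B j i := by
  simp [assemble, Equiv.sumCompl_symm_apply_of_neg (p := fun i => i ∈ F) j.2,
    Equiv.sumCompl_symm_apply_of_pos i.2]

theorem assemble_apply_TT (A : Matrix {i // i ∈ F} {i // i ∈ F} ℝ)
    (B : Matrix {i // i ∉ F} {i // i ∈ F} ℝ) (D : Matrix {i // i ∉ F} {i // i ∉ F} ℝ)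
    (i j : {i // i ∉ F}) : assemble F A B D i j = D i j := by
  simp [assemble, Equiv.sumCompl_symm_apply_of_neg (p := fun i => i ∈ F) i.2,
    Equiv.sumCompl_symm_apply_of_neg (p := fun i => i ∈ F) j.2]

/-- A matrix is determined by its four blocks. -/
theorem eq_assemble {S : Matrix V V ℝ} {A : Matrix {i // i ∈ F} {i // i ∈ F} ℝ}
    {B : Matrix {i // i ∉ F} {i // i ∈ F} ℝ} {D : Matrix {i // i ∉ F} {i // i ∉ F} ℝ}
    (h1 : ∀ i j : {i // i ∈ F}, S i j = A i j)
    (h2 : ∀ (i : {i // i ∉ F}) (j : {i // i ∈ F}), S i j = B i j)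
    (h3 : ∀ (i : {i // i ∉ F}) (j : {i // i ∈ F}), S j i = B i j)
    (h4 : ∀ i j : {i // i ∉ F}, S i j = D i j) : S = assemble F A B D := by
  ext i j
  by_cases hi : i ∈ F <;> by_cases hj : j ∈ F
  · rw [assemble_apply_FF F A B D ⟨i, hi⟩ ⟨j, hj⟩, ← h1]
  · rw [assemble_apply_FT F A B D ⟨i, hi⟩ ⟨j, hj⟩, ← h3]
  · rw [assemble_apply_TF F A B D ⟨i, hi⟩ ⟨j, hj⟩, ← h2]
  · rw [assemble_apply_TT F A B D ⟨i, hi⟩ ⟨j, hj⟩, ← h4]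

theorem blockF_assemble (A : Matrix {i // i ∈ F} {i // i ∈ F} ℝ)
    (B : Matrix {i // i ∉ F} {i // i ∈ F} ℝ) (D : Matrix {i // i ∉ F} {i // i ∉ F} ℝ) :
    blockF F (assemble F A B D) = A := by
  ext i j; exact assemble_apply_FF F A B D i j

theorem blockM_assemble (A : Matrix {i // i ∈ F} {i // i ∈ F} ℝ)
    (B : Matrix {i // i ∉ F} {i // i ∈ F} ℝ) (D : Matrix {i // i ∉ F} {i // i ∉ F} ℝ) :
    blockM F (assemble F A B D) = B := by
  ext i j; exact assemble_apply_TF F A B D i j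

theorem blockT_assemble (A : Matrix {i // i ∈ F} {i // i ∈ F} ℝ)
    (B : Matrix {i // i ∉ F} {i // i ∈ F} ℝ) (D : Matrix {i // i ∉ F} {i // i ∉ F} ℝ) :
    blockT F (assemble F A B D) = D := by
  ext i j; exact assemble_apply_TT F A B D i j

theorem assemble_blocks {S : Matrix V V ℝ} (hS : S.PosDef) :
    assemble F (blockF F S) (blockM F S) (blockT F S) = S :=
  (eq_assemble F (fun _ _ => rfl) (fun _ _ => rfl) (fun i j => PosDef.apply_comm hS j i)
    (fun _ _ => rfl)).symm

theorem posDef_assemble_iff (A : Matrix {i // i ∈ F} {i // i ∈ F} ℝ)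
    (B : Matrix {i // i ∉ F} {i // i ∈ F} ℝ) (D : Matrix {i // i ∉ F} {i // i ∉ F} ℝ) :
    (assemble F A B D).PosDef ↔ (Matrix.fromBlocks A Bᵀ B D).PosDef := by
  constructor
  · intro h
    have := h.submatrix (Equiv.sumCompl fun i => i ∈ F).injective
    rw [assemble, Matrix.submatrix_submatrix] at this
    simpa using this
  · intro h
    exact h.submatrix (Equiv.sumCompl fun i => i ∈ F).symm.injective

theorem blockF_posDef {S : Matrix V V ℝ} (hS : S.PosDef) : (blockF F S).PosDef :=
  hS.submatrix Subtype.val_injective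

variable {F} in
theorem PosDef.transpose_eq {W : Type*} {A : Matrix W W ℝ} (hA : A.PosDef) : Aᵀ = A := by
  ext i j; exact PosDef.apply_comm hA j i

theorem PosDef.mul_inv' {W : Type*} [Fintype W] [DecidableEq W] {A : Matrix W W ℝ}
    (hA : A.PosDef) : A * A⁻¹ = 1 :=
  Matrix.mul_nonsing_inv _ ((Matrix.isUnit_iff_isUnit_det _).1 hA.isUnit)

theorem PosDef.inv_mul' {W : Type*} [Fintype W] [DecidableEq W] {A : Matrix W W ℝ}
    (hA : A.PosDef) : A⁻¹ * A = 1 :=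
  Matrix.nonsing_inv_mul _ ((Matrix.isUnit_iff_isUnit_det _).1 hA.isUnit)

section Sum

variable {m n : Type*} [Fintype m] [DecidableEq m] [Fintype n] [DecidableEq n]

/-- Block LDLᵀ factorization: subtracting the regression on the first block decouples the blocks.
With the last block written as P + B A⁻¹ Bᵀ, the Schur complement P becomes a free parameter. -/
theorem fromBlocks_factor {A : Matrix m m ℝ} (hA : A.PosDef) (B : Matrix n m ℝ)
    (P : Matrix n n ℝ) :
    Matrix.fromBlocks A Bᵀ B (P + B * A⁻¹ * Bᵀ) =
      Matrix.fromBlocks 1 0 (B * A⁻¹) 1 * Matrix.fromBlocks A 0 0 P *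
        star (Matrix.fromBlocks 1 0 (B * A⁻¹) 1) := by
  have h1 : (A⁻¹)ᵀ = A⁻¹ := PosDef.transpose_eq hA.inv
  rw [Matrix.star_eq_conjTranspose, Matrix.conjTranspose_eq_transpose_of_trivial,
    Matrix.fromBlocks_transpose, Matrix.fromBlocks_multiply, Matrix.fromBlocks_multiply]
  simp only [Matrix.transpose_one, Matrix.transpose_zero, Matrix.transpose_mul, h1,
    Matrix.one_mul, Matrix.zero_mul, Matrix.mul_zero, Matrix.mul_one, add_zero, zero_add]
  congr 1
  · rw [← Matrix.mul_assoc, PosDef.mul_inv' hA, Matrix.one_mul]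
  · rw [Matrix.mul_assoc, PosDef.inv_mul' hA, Matrix.mul_one]
  · rw [Matrix.mul_assoc B A⁻¹ A, PosDef.inv_mul' hA, Matrix.mul_one, add_comm, ← Matrix.mul_assoc]

theorem isUnit_fromBlocks_unitriangular (G : Matrix n m ℝ) :
    IsUnit (Matrix.fromBlocks 1 0 G 1 : Matrix (m ⊕ n) (m ⊕ n) ℝ) := by
  rw [Matrix.isUnit_iff_isUnit_det, Matrix.det_fromBlocks_zero₁₂]
  simp

/-- Semidefiniteness comes from the Schur criterion, and the nonzero determinant upgrades it. -/
theorem posDef_fromBlocks_diagonal {A : Matrix m m ℝ} {P : Matrix n n ℝ} (hA : A.PosDef)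
    (hP : P.PosDef) : (Matrix.fromBlocks A 0 0 P).PosDef := by
  have hinv : Invertible A := hA.isUnit.invertible
  have h : (Matrix.fromBlocks A 0 0 P).PosSemidef := by
    have := (Matrix.PosDef.fromBlocks₁₁ (0 : Matrix m n ℝ) P hA).2 (by simpa using hP.posSemidef)
    simpa using this
  rw [h.posDef_iff_det_ne_zero, Matrix.det_fromBlocks_zero₁₂]
  exact (mul_pos hA.det_pos hP.det_pos).ne'

theorem posDef_fromBlocks_schur_iff {A : Matrix m m ℝ} (hA : A.PosDef) (B : Matrix n m ℝ)
    (P : Matrix n n ℝ) :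
    (Matrix.fromBlocks A Bᵀ B (P + B * A⁻¹ * Bᵀ)).PosDef ↔ P.PosDef := by
  rw [fromBlocks_factor hA,
    Matrix.IsUnit.posDef_star_right_conjugate_iff (isUnit_fromBlocks_unitriangular _)]
  constructor
  · intro h
    have := h.submatrix (Sum.inr_injective (α := m) (β := n))
    exact this
  · exact posDef_fromBlocks_diagonal hA

theorem det_fromBlocks_schur {A : Matrix m m ℝ} (hA : A.PosDef) (B : Matrix n m ℝ)
    (P : Matrix n n ℝ) :
    (Matrix.fromBlocks A Bᵀ B (P + B * A⁻¹ * Bᵀ)).det = A.det * P.det := by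
  rw [fromBlocks_factor hA, Matrix.star_eq_conjTranspose,
    Matrix.conjTranspose_eq_transpose_of_trivial, Matrix.det_mul, Matrix.det_mul,
    Matrix.det_transpose, Matrix.det_fromBlocks_zero₁₂, Matrix.det_fromBlocks_zero₁₂]
  simp

/-- The last block of the inverse is P⁻¹: conditioning on the first variables in the covariance
amounts to deleting them in the information matrix. This is why a tree-structured conditional
covariance yields a tree outside `F`. -/
theorem inv_fromBlocks_schur {A : Matrix m m ℝ} (hA : A.PosDef) (B : Matrix n m ℝ)
    {P : Matrix n n ℝ} (hP : P.PosDef) :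
    (Matrix.fromBlocks A Bᵀ B (P + B * A⁻¹ * Bᵀ))⁻¹ =
      Matrix.fromBlocks (A⁻¹ + A⁻¹ * Bᵀ * (P⁻¹ * (B * A⁻¹))) (-(P⁻¹ * (B * A⁻¹)))ᵀ
        (-(P⁻¹ * (B * A⁻¹))) P⁻¹ := by
  have h1 : (A⁻¹)ᵀ = A⁻¹ := PosDef.transpose_eq hA.inv
  have h2 : (P⁻¹)ᵀ = P⁻¹ := PosDef.transpose_eq hP.inv
  have hAA := PosDef.mul_inv' hA
  have hPP := PosDef.mul_inv' hP
  refine Matrix.inv_eq_right_inv ?_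
  rw [Matrix.fromBlocks_multiply, ← Matrix.fromBlocks_one]
  have hA' := (Matrix.isUnit_iff_isUnit_det _).1 hA.isUnit
  have hP' := (Matrix.isUnit_iff_isUnit_det _).1 hP.isUnit
  congr 1
  · simp only [Matrix.mul_add, Matrix.mul_neg, Matrix.mul_assoc, Matrix.mul_nonsing_inv_cancel_left _ _ hA',
      hAA]
    abel
  · simp only [Matrix.transpose_neg, Matrix.transpose_mul, h1, h2, Matrix.mul_neg,
      Matrix.mul_assoc, Matrix.mul_nonsing_inv_cancel_left _ _ hA']
    abel
  · simp only [Matrix.mul_add, Matrix.add_mul, Matrix.mul_neg, Matrix.mul_assoc,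
      Matrix.mul_nonsing_inv_cancel_left _ _ hP']
    abel
  · simp only [Matrix.transpose_neg, Matrix.transpose_mul, h1, h2, Matrix.mul_neg, Matrix.add_mul,
      Matrix.mul_assoc, hPP]
    abel

end Sum

variable {F} {A : Matrix {i // i ∈ F} {i // i ∈ F} ℝ} {B : Matrix {i // i ∉ F} {i // i ∈ F} ℝ}
  {P : Matrix {i // i ∉ F} {i // i ∉ F} ℝ}

theorem assemble_posDef (hA : A.PosDef) (hP : P.PosDef) :
    (assemble F A B (P + B * A⁻¹ * Bᵀ)).PosDef :=
  (posDef_assemble_iff F _ _ _).2 ((posDef_fromBlocks_schur_iff hA B P).2 hP)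

theorem det_assemble (hA : A.PosDef) :
    (assemble F A B (P + B * A⁻¹ * Bᵀ)).det = A.det * P.det := by
  rw [assemble, Matrix.det_submatrix_equiv_self, det_fromBlocks_schur hA]

theorem inv_assemble (hA : A.PosDef) (hP : P.PosDef) :
    (assemble F A B (P + B * A⁻¹ * Bᵀ))⁻¹ =
      assemble F (A⁻¹ + A⁻¹ * Bᵀ * (P⁻¹ * (B * A⁻¹))) (-(P⁻¹ * (B * A⁻¹))) P⁻¹ := by
  rw [assemble, Matrix.inv_submatrix_equiv, inv_fromBlocks_schur hA B hP, assemble]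

theorem conditionalCov_assemble :
    conditionalCov F (assemble F A B (P + B * A⁻¹ * Bᵀ)) = P := by
  rw [conditionalCov, blockF_assemble, blockM_assemble, blockT_assemble, add_sub_cancel_right]

theorem assemble_conditionalCov {S : Matrix V V ℝ} (hS : S.PosDef) :
    assemble F (blockF F S) (blockM F S)
      (conditionalCov F S + blockM F S * (blockF F S)⁻¹ * (blockM F S)ᵀ) = S := by
  rw [conditionalCov, sub_add_cancel, assemble_blocks F hS]

theorem conditionalCov_posDef {S : Matrix V V ℝ} (hS : S.PosDef) : (conditionalCov F S).PosDef := by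
  rw [← posDef_fromBlocks_schur_iff (blockF_posDef F hS) (blockM F S), ← posDef_assemble_iff,
    assemble_conditionalCov hS]
  exact hS

end Blocks

/-! ### Gibbs' inequality and optimality of the learned covariance -/

section Information

variable {V : Type*} [Fintype V] [DecidableEq V]

/-- Sum log λ ≤ λ - 1 over the eigenvalues. -/
theorem card_le_trace_sub_log_det {X : Matrix V V ℝ} (hX : X.PosDef) :
    (Fintype.card V : ℝ) ≤ X.trace - Real.log X.det := by
  have h1 : X.trace = ∑ i, hX.isHermitian.eigenvalues i := by
    simpa using hX.isHermitian.trace_eq_sum_eigenvalues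
  have h2 : X.det = ∏ i, hX.isHermitian.eigenvalues i := by
    simpa using hX.isHermitian.det_eq_prod_eigenvalues
  rw [h1, h2, Real.log_prod (fun i _ => (hX.eigenvalues_pos i).ne'), ← Finset.sum_sub_distrib]
  have : (Fintype.card V : ℝ) = ∑ _i : V, (1 : ℝ) := by simp
  rw [this]
  refine Finset.sum_le_sum fun i _ => ?_
  have := Real.log_le_sub_one_of_pos (hX.eigenvalues_pos i)
  linarith

theorem PosDef.exists_factor {Q : Matrix V V ℝ} (hQ : Q.PosDef) :
    ∃ R : Matrix V V ℝ, IsUnit R ∧ Q = R * Rᵀ := by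
  open scoped MatrixOrder in
  obtain ⟨R, hR⟩ := CStarAlgebra.nonneg_iff_eq_star_mul_self.1 hQ.posSemidef.nonneg
  refine ⟨Rᵀ, ?_, ?_⟩
  · rw [Matrix.isUnit_iff_isUnit_det, Matrix.det_transpose, isUnit_iff_ne_zero]
    intro h0
    have := hQ.det_pos
    rw [hR, Matrix.det_mul, h0, mul_zero] at this
    exact lt_irrefl _ this
  · rw [hR, Matrix.transpose_transpose, Matrix.star_eq_conjTranspose,
      Matrix.conjTranspose_eq_transpose_of_trivial]

/-- Gibbs' inequality for centered Gaussian distributions. -/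
theorem log_det_add_card_le {B Q : Matrix V V ℝ} (hB : B.PosDef) (hQ : Q.PosDef) :
    Real.log Q.det + Fintype.card V ≤ Real.log B.det + (B⁻¹ * Q).trace := by
  obtain ⟨R, hR, hQR⟩ := PosDef.exists_factor hQ
  -- B⁻¹ Q need not be symmetric; Rᵀ B⁻¹ R has the same trace and determinant and is positive
  -- definite.
  have hX : (star R * B⁻¹ * R).PosDef :=
    (Matrix.IsUnit.posDef_star_left_conjugate_iff hR).2 hB.inv
  rw [Matrix.star_eq_conjTranspose, Matrix.conjTranspose_eq_transpose_of_trivial] at hX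
  have h := card_le_trace_sub_log_det hX
  have ht : (Rᵀ * B⁻¹ * R).trace = (B⁻¹ * Q).trace := by
    rw [hQR, Matrix.mul_assoc, Matrix.trace_mul_comm, Matrix.mul_assoc]
  have hd : (Rᵀ * B⁻¹ * R).det = Q.det / B.det := by
    rw [hQR, Matrix.det_mul, Matrix.det_mul, Matrix.det_mul, Matrix.det_nonsing_inv,
      Matrix.det_transpose, Ring.inverse_eq_inv']
    ring
  rw [ht, hd, Real.log_div hQ.det_pos.ne' hB.det_pos.ne'] at h
  linarith

theorem trace_mul_congr {K Q S : Matrix V V ℝ} (h : ∀ i j, K i j ≠ 0 → Q j i = S j i) :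
    (K * Q).trace = (K * S).trace := by
  simp only [Matrix.trace, Matrix.diag, Matrix.mul_apply]
  refine Finset.sum_congr rfl fun i _ => Finset.sum_congr rfl fun j _ => ?_
  by_cases hK : K i j = 0
  · rw [hK, zero_mul, zero_mul]
  · rw [h i j hK]

variable {F : Finset V}

theorem sparsityGraph_adj {J : Matrix V V ℝ} {i j : V} (hij : i ≠ j) (h : J i j ≠ 0) :
    (sparsityGraph J).Adj i j := by
  rw [sparsityGraph, SimpleGraph.fromRel_adj]
  exact ⟨hij, Or.inl h⟩

/-- If a model is assembled from the moments of `Sh` and a tree-structured conditional covariance,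
then it has the same moments as `Sh` on the support of every compatible information matrix. -/
theorem trace_mul_assemble {Sh K : Matrix V V ℝ} (hSh : Sh.PosDef)
    {E : SimpleGraph {i // i ∉ F}} {M : Matrix {i // i ∉ F} {i // i ∉ F} ℝ}
    (hM : PathCov E (conditionalCov F Sh) M)
    (hK : nonFeedbackGraph F (sparsityGraph K) ≤ E) :
    (K * assemble F (blockF F Sh) (blockM F Sh)
      (M + blockM F Sh * (blockF F Sh)⁻¹ * (blockM F Sh)ᵀ)).trace = (K * Sh).trace := by
  refine trace_mul_congr fun i j hij => ?_
  by_cases hi : i ∈ F <;> by_cases hj : j ∈ F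
  · exact assemble_apply_FF F _ _ _ ⟨j, hj⟩ ⟨i, hi⟩
  · exact assemble_apply_TF F _ _ _ ⟨j, hj⟩ ⟨i, hi⟩
  · rw [assemble_apply_FT F _ _ _ ⟨j, hj⟩ ⟨i, hi⟩, PosDef.apply_comm hSh]
    rfl
  · rw [assemble_apply_TT F _ _ _ ⟨j, hj⟩ ⟨i, hi⟩, Matrix.add_apply]
    have hkey : M ⟨j, hj⟩ ⟨i, hi⟩ = conditionalCov F Sh ⟨j, hj⟩ ⟨i, hi⟩ := by
      rcases eq_or_ne i j with rfl | hne
      · exact hM.diag _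
      · have hadj : (nonFeedbackGraph F (sparsityGraph K)).Adj ⟨i, hi⟩ ⟨j, hj⟩ :=
          sparsityGraph_adj hne hij
        exact hM.edge _ _ (hK hadj).symm
    rw [hkey, conditionalCov, Matrix.sub_apply, sub_add_cancel]
    rfl

/-- Relates the weights used by the algorithm to those in the likelihood. Only the pair with the
larger correlation must be off the diagonal, since it suffices that its 1 - ρ² is positive. -/
theorem neg_log_one_sub_sq_correlation_mono {W : Type*} {A : Matrix W W ℝ} (hA : A.PosDef)
    {a b c d : W} (hcd : c ≠ d) (h : |correlation A a b| ≤ |correlation A c d|) :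
    - Real.log (1 - correlation A a b ^ 2) ≤ - Real.log (1 - correlation A c d ^ 2) := by
  have h1 := sq_le_sq.2 h
  have h2 := sq_correlation_lt_one hA hcd
  exact neg_le_neg (Real.log_le_log (by linarith) (by linarith))

/-- The block of the inverse outside `F` is P⁻¹, which vanishes off the tree because P is a tree
covariance. -/
theorem nonFeedbackGraph_assemble_le {A : Matrix {i // i ∈ F} {i // i ∈ F} ℝ}
    {B : Matrix {i // i ∉ F} {i // i ∈ F} ℝ} {P C : Matrix {i // i ∉ F} {i // i ∉ F} ℝ}
    (hA : A.PosDef) (hC : C.PosDef) {E : SimpleGraph {i // i ∉ F}} (hE : IsSpanningTree E)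
    (hP : PathCov E C P) :
    nonFeedbackGraph F (sparsityGraph (assemble F A B (P + B * A⁻¹ * Bᵀ))⁻¹) ≤ E := by
  obtain ⟨rank, par, ho⟩ := hE.exists_treeOrder
  have ht := hP.treeCov hC hE ho
  intro i j hij
  by_contra hn
  rw [inv_assemble hA (ht.posDef ho hC)] at hij
  have hij' := (SimpleGraph.fromRel_adj _ _ _).1 (show (sparsityGraph _).Adj i.1 j.1 from hij)
  have hne : i ≠ j := fun h => hij'.1 (congrArg Subtype.val h)
  rw [assemble_apply_TT, assemble_apply_TT, ht.inv_apply_of_not_adj ho hC hne hn,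
    ht.inv_apply_of_not_adj ho hC hne.symm fun h => hn h.symm] at hij'
  simp at hij'

theorem IsConditionedChowLiuOutput.exists_treeCov {Sh S : Matrix V V ℝ}
    {E : SimpleGraph {i // i ∉ F}} (h : IsConditionedChowLiuOutput F Sh E S) :
    ∃ M, IsMaxSpanningTree (fun i j => |correlation (conditionalCov F Sh) i j|) E ∧
      PathCov E (conditionalCov F Sh) M ∧
      S = assemble F (blockF F Sh) (blockM F Sh)
        (M + blockM F Sh * (blockF F Sh)⁻¹ * (blockM F Sh)ᵀ) := by
  obtain ⟨M, ⟨h1, h2, h3, h4⟩, h5⟩ := h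
  exact ⟨M, h1, ⟨h2, h3, h4⟩, h5⟩

theorem IsConditionedChowLiuOutput.posDef {Sh S : Matrix V V ℝ} (hSh : Sh.PosDef)
    {E : SimpleGraph {i // i ∉ F}} (h : IsConditionedChowLiuOutput F Sh E S) : S.PosDef := by
  obtain ⟨M, h1, h2, rfl⟩ := h.exists_treeCov
  obtain ⟨rank, par, ho⟩ := h1.1.exists_treeOrder
  have hC := conditionalCov_posDef (F := F) hSh
  exact assemble_posDef (blockF_posDef F hSh) ((h2.treeCov hC h1.1 ho).posDef ho hC)

theorem IsConditionedChowLiuOutput.graph_le {Sh S : Matrix V V ℝ} (hSh : Sh.PosDef)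
    {E : SimpleGraph {i // i ∉ F}} (h : IsConditionedChowLiuOutput F Sh E S) :
    nonFeedbackGraph F (sparsityGraph S⁻¹) ≤ E := by
  obtain ⟨M, h1, h2, rfl⟩ := h.exists_treeCov
  exact nonFeedbackGraph_assemble_le (blockF_posDef F hSh) (conditionalCov_posDef hSh) h1.1 h2

/-- The conditioned Chow-Liu algorithm minimizes the negative log-likelihood. -/
theorem IsConditionedChowLiuOutput.log_det_add_trace_le {Sh S S' : Matrix V V ℝ} (hSh : Sh.PosDef)
    {E : SimpleGraph {i // i ∉ F}} (h : IsConditionedChowLiuOutput F Sh E S)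
    (hS' : S' ∈ covFamily F) :
    Real.log S.det + (S⁻¹ * Sh).trace ≤ Real.log S'.det + (S'⁻¹ * Sh).trace := by
  have hS := h.posDef hSh
  have hgraph := h.graph_le hSh
  obtain ⟨M, h1, h2, h3⟩ := h.exists_treeCov
  have hF := blockF_posDef F hSh
  have hC := conditionalCov_posDef (F := F) hSh
  -- The intermediate model keeps the moments of `Sh` that `S'` can see, arranged along a spanning
  -- tree containing the forest of `S'`.
  obtain ⟨H, hle, hH⟩ := exists_isSpanningTree_ge hS'.2
  obtain ⟨M', hM'⟩ := exists_pathCov hH (conditionalCov F Sh)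
  obtain ⟨rank, par, ho⟩ := h1.1.exists_treeOrder
  obtain ⟨rank', par', ho'⟩ := hH.exists_treeOrder
  have ht := h2.treeCov hC h1.1 ho
  have ht' := hM'.treeCov hC hH ho'
  have htr := trace_mul_assemble hSh h2 hgraph
  have htr' := trace_mul_assemble hSh hM' hle
  set Q := assemble F (blockF F Sh) (blockM F Sh)
        (M' + blockM F Sh * (blockF F Sh)⁻¹ * (blockM F Sh)ᵀ) with hQdef
  have hQ : Q.PosDef := assemble_posDef hF (ht'.posDef ho' hC)
  -- Since the trace of `S'⁻¹ * Q` equals that of `S'⁻¹ * Sh`, Gibbs' inequality bounds the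
  -- objective at `S'` by the determinant of `Q`.
  have hgibbs := log_det_add_card_le hS'.1 hQ
  rw [htr'] at hgibbs
  -- For `S` itself the trace identity says that the trace term equals the number of vertices, so
  -- only determinants are left.
  rw [← h3, PosDef.inv_mul' hS, Matrix.trace_one] at htr
  rw [← htr]
  refine le_trans ?_ hgibbs
  have hw : totalWeight (fun i j => - Real.log (1 - correlation (conditionalCov F Sh) i j ^ 2)) H ≤
      totalWeight (fun i j => - Real.log (1 - correlation (conditionalCov F Sh) i j ^ 2)) E :=
    h1.totalWeight_le_of_monotone (fun i j => by rw [correlation_comm hC])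
      (fun i j => by rw [correlation_comm hC])
      (fun a b c d _ hcd hle => neg_log_one_sub_sq_correlation_mono hC hcd hle) hH
  have hd : Real.log S.det = Real.log (blockF F Sh).det + Real.log M.det := by
    rw [h3, det_assemble hF, Real.log_mul hF.det_pos.ne' (ht.posDef ho hC).det_pos.ne']
  have hd' : Real.log Q.det = Real.log (blockF F Sh).det + Real.log M'.det := by
    rw [hQdef, det_assemble hF, Real.log_mul hF.det_pos.ne' (ht'.posDef ho' hC).det_pos.ne']
  rw [hd, hd', ht.log_det_eq ho hC, ht'.log_det_eq ho' hC]
  linarith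

end Information

/-! ### Gaussian measures, their second moments, divergence and likelihood -/

section GaussianMeasures

open MeasureTheory ProbabilityTheory

variable {V : Type*} [Fintype V] [DecidableEq V]

/-- A product measure is determined by boxes, and on a box the integral of the product density
factors. -/
theorem pi_gaussianReal_eq_withDensity :
    Measure.pi (fun _ : V => gaussianReal 0 1) =
      volume.withDensity fun z => ENNReal.ofReal (∏ i, gaussianPDFReal 0 1 (z i)) := by
  symm
  refine Measure.pi_eq ?_ |>.symm
  intro s hs
  have hms : MeasurableSet (Set.univ.pi s) := MeasurableSet.univ_pi hs
  rw [withDensity_apply _ hms, ← lintegral_indicator hms]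
  have h1 : ∀ z : V → ℝ, (Set.univ.pi s).indicator
      (fun z => ENNReal.ofReal (∏ i, gaussianPDFReal 0 1 (z i))) z =
      ENNReal.ofReal (∏ i, (s i).indicator (gaussianPDFReal 0 1) (z i)) := by
    intro z
    by_cases hz : z ∈ Set.univ.pi s
    · rw [Set.indicator_of_mem hz]
      congr 1
      exact Finset.prod_congr rfl fun i _ =>
        (Set.indicator_of_mem (hz i (Set.mem_univ i)) _).symm
    · rw [Set.indicator_of_notMem hz]
      have : ∃ i, z i ∉ s i := by
        by_contra hcon
        push Not at hcon
        exact hz fun i _ => hcon i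
      obtain ⟨i, hi⟩ := this
      rw [Finset.prod_eq_zero (Finset.mem_univ i) (Set.indicator_of_notMem hi _),
        ENNReal.ofReal_zero]
  simp only [h1]
  have hint : ∀ i, Integrable ((s i).indicator (gaussianPDFReal 0 1)) volume := fun i =>
    (integrable_gaussianPDFReal 0 1).indicator (hs i)
  have hnn : ∀ i x, 0 ≤ (s i).indicator (gaussianPDFReal 0 1) x := fun i x =>
    Set.indicator_nonneg (fun x _ => gaussianPDFReal_nonneg 0 1 x) x
  rw [← ofReal_integral_eq_lintegral_ofReal]
  · rw [integral_fintype_prod_volume_eq_prod (fun i => (s i).indicator (gaussianPDFReal 0 1)),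
      ENNReal.ofReal_prod_of_nonneg fun i _ => integral_nonneg (hnn i)]
    refine Finset.prod_congr rfl fun i _ => ?_
    rw [gaussianReal_apply_eq_integral 0 one_ne_zero, integral_indicator (hs i)]
  · exact Integrable.fintype_prod_dep hint
  · exact Filter.Eventually.of_forall fun z => Finset.prod_nonneg fun i _ => hnn i _

theorem prod_gaussianPDFReal (z : V → ℝ) :
    ∏ i, gaussianPDFReal 0 1 (z i) =
      (Real.sqrt ((2 * Real.pi) ^ Fintype.card V))⁻¹ * Real.exp (-(1 / 2) * (z ⬝ᵥ z)) := by
  simp only [gaussianPDFReal_def, Finset.prod_mul_distrib, Finset.prod_const, ← Real.exp_sum]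
  congr 1
  · rw [Finset.card_univ, inv_pow, NNReal.coe_one, mul_one, inv_inj, eq_comm,
      Real.sqrt_eq_iff_mul_self_eq (by positivity) (by positivity), ← mul_pow,
      Real.mul_self_sqrt (by positivity)]
  · congr 1
    rw [dotProduct, Finset.mul_sum]
    refine Finset.sum_congr rfl fun i _ => ?_
    simp
    ring

/-- In the coordinates in which S = R Rᵀ becomes the identity, the quadratic form of S⁻¹ is the
squared Euclidean norm. -/
theorem dotProduct_mulVec_factor {S R : Matrix V V ℝ} (hR : IsUnit R) (hS : S = R * Rᵀ)
    (z : V → ℝ) : (R *ᵥ z) ⬝ᵥ (S⁻¹ *ᵥ (R *ᵥ z)) = z ⬝ᵥ z := by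
  have hd : IsUnit R.det := (Matrix.isUnit_iff_isUnit_det _).1 hR
  have hd' : IsUnit Rᵀ.det := by rwa [Matrix.det_transpose]
  have h : Rᵀ * (S⁻¹ * R) = 1 := by
    rw [hS, Matrix.mul_inv_rev, Matrix.mul_assoc, Matrix.nonsing_inv_mul _ hd, Matrix.mul_one,
      Matrix.mul_nonsing_inv _ hd']
  rw [Matrix.mulVec_mulVec, Matrix.dotProduct_mulVec, Matrix.vecMul_mulVec,
    ← Matrix.dotProduct_mulVec, h, Matrix.one_mulVec]

theorem gaussianDensity_factor {S R : Matrix V V ℝ} (hR : IsUnit R) (hS : S = R * Rᵀ)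
    (m z : V → ℝ) :
    ∏ i, gaussianPDFReal 0 1 (z i) = |R.det| * gaussianDensity m S (m + R *ᵥ z) := by
  have hd : R.det ≠ 0 := ((Matrix.isUnit_iff_isUnit_det _).1 hR).ne_zero
  have h1 : Real.sqrt S.det = |R.det| := by
    rw [hS, Matrix.det_mul, Matrix.det_transpose, Real.sqrt_mul_self_eq_abs]
  rw [prod_gaussianPDFReal, gaussianDensity, add_sub_cancel_left,
    dotProduct_mulVec_factor hR hS, Real.sqrt_mul (by positivity), h1, mul_inv]
  have h2 : |R.det| ≠ 0 := abs_ne_zero.2 hd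
  field_simp

theorem measurable_gaussianDensity (m : V → ℝ) (S : Matrix V V ℝ) :
    Measurable (gaussianDensity m S) := by
  unfold gaussianDensity
  have : Continuous fun x : V → ℝ => (x - m) ⬝ᵥ (S⁻¹ *ᵥ (x - m)) := by
    fun_prop
  exact ((this.measurable.const_mul _).exp).const_mul _

/-- A Gaussian distribution is an affine image of the standard one. -/
theorem gaussian_eq_map {S R : Matrix V V ℝ} (hR : IsUnit R) (hS : S = R * Rᵀ) (m : V → ℝ) :
    gaussian m S =
      (Measure.pi fun _ : V => gaussianReal 0 1).map fun z => m + R *ᵥ z := by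
  have hd : R.det ≠ 0 := ((Matrix.isUnit_iff_isUnit_det _).1 hR).ne_zero
  have hmeas : Measurable fun z : V → ℝ => m + R *ᵥ z := by fun_prop
  -- The Jacobian: this factor cancels the one in `gaussianDensity_factor`.
  have hmap : (volume : Measure (V → ℝ)).map (fun z => m + R *ᵥ z) =
      ENNReal.ofReal |(R.det)⁻¹| • volume := by
    have h1 : (fun z : V → ℝ => m + R *ᵥ z) = (fun x => m + x) ∘ (Matrix.toLin' R) := by
      ext z; simp
    rw [h1, ← Measure.map_map (by fun_prop) (by fun_prop),
      Real.map_matrix_volume_pi_eq_smul_volume_pi hd, Measure.map_smul, map_add_left_eq_self]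
  ext s hs
  rw [Measure.map_apply hmeas hs, pi_gaussianReal_eq_withDensity, gaussian,
    withDensity_apply _ hs, withDensity_apply _ (hmeas hs)]
  have h2 : ∀ z : V → ℝ, ENNReal.ofReal (∏ i, gaussianPDFReal 0 1 (z i)) =
      ENNReal.ofReal |R.det| * ENNReal.ofReal (gaussianDensity m S (m + R *ᵥ z)) := fun z => by
    rw [gaussianDensity_factor hR hS m z, ENNReal.ofReal_mul (abs_nonneg _)]
  simp only [h2]
  have hgm : Measurable fun x => ENNReal.ofReal (gaussianDensity m S x) :=
    (measurable_gaussianDensity m S).ennreal_ofReal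
  have hgm' : Measurable fun z => ENNReal.ofReal (gaussianDensity m S (m + R *ᵥ z)) :=
    hgm.comp hmeas
  rw [lintegral_const_mul _ hgm', ← setLIntegral_map hs hgm hmeas, hmap,
    Measure.restrict_smul, lintegral_smul_measure, smul_eq_mul, ← mul_assoc,
    ← ENNReal.ofReal_mul (abs_nonneg _), ← abs_mul, mul_inv_cancel₀ hd, abs_one,
    ENNReal.ofReal_one, one_mul]

theorem isProbabilityMeasure_gaussian {S : Matrix V V ℝ} (hS : S.PosDef) (m : V → ℝ) :
    IsProbabilityMeasure (gaussian m S) := by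
  obtain ⟨R, hR, hSR⟩ := PosDef.exists_factor hS
  rw [gaussian_eq_map hR hSR m]
  exact Measure.isProbabilityMeasure_map (by fun_prop)

section Moments

theorem integrable_id_gaussianReal' : Integrable (fun x : ℝ => x) (gaussianReal 0 1) :=
  (memLp_id_gaussianReal (μ := 0) (v := 1) 1).integrable (by simp)

theorem integrable_sq_gaussianReal : Integrable (fun x : ℝ => x * x) (gaussianReal 0 1) := by
  have := (memLp_id_gaussianReal (μ := 0) (v := 1) 2).integrable_sq
  simpa [pow_two] using this

theorem integral_sq_gaussianReal : ∫ x : ℝ, x * x ∂(gaussianReal 0 1) = 1 := by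
  have h := variance_id_gaussianReal (μ := 0) (v := 1)
  rw [variance_eq_integral (by fun_prop)] at h
  simpa [pow_two] using h

theorem integrable_coord (i : V) :
    Integrable (fun z : V → ℝ => z i) (Measure.pi fun _ : V => gaussianReal 0 1) :=
  integrable_comp_eval (μ := fun _ : V => gaussianReal 0 1) (f := fun x => x)
    integrable_id_gaussianReal'

theorem integral_coord (i : V) :
    ∫ z : V → ℝ, z i ∂(Measure.pi fun _ : V => gaussianReal 0 1) = 0 := by
  rw [integral_comp_eval (μ := fun _ : V => gaussianReal 0 1) (f := fun x : ℝ => x) (by fun_prop)]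
  exact integral_id_gaussianReal

/-- Writing the monomial as a product of one-coordinate functions lets Fubini treat equal and
distinct indices together. -/
theorem coord_mul_eq_prod (i j : V) (z : V → ℝ) :
    z i * z j = ∏ k, ((if k = i then z k else 1) * (if k = j then z k else 1)) := by
  rw [Finset.prod_mul_distrib, Finset.prod_ite_eq' , Finset.prod_ite_eq']
  simp

theorem integrable_coord_factor (i j k : V) :
    Integrable (fun x : ℝ => (if k = i then x else 1) * (if k = j then x else 1))
      (gaussianReal 0 1) := by
  by_cases hi : k = i <;> by_cases hj : k = j
  · simpa only [if_pos hi, if_pos hj] using integrable_sq_gaussianReal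
  · simpa only [if_pos hi, if_neg hj, mul_one] using integrable_id_gaussianReal'
  · simpa only [if_neg hi, if_pos hj, one_mul] using integrable_id_gaussianReal'
  · simp [hi, hj]

theorem integrable_coord_mul (i j : V) :
    Integrable (fun z : V → ℝ => z i * z j) (Measure.pi fun _ : V => gaussianReal 0 1) := by
  simp only [coord_mul_eq_prod i j]
  exact Integrable.fintype_prod_dep (f := fun k (x : ℝ) =>
    (if k = i then x else 1) * (if k = j then x else 1)) (integrable_coord_factor i j)

theorem integral_coord_mul (i j : V) :
    ∫ z : V → ℝ, z i * z j ∂(Measure.pi fun _ : V => gaussianReal 0 1) =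
      if i = j then 1 else 0 := by
  simp only [coord_mul_eq_prod i j]
  rw [integral_fintype_prod_eq_prod (fun k (x : ℝ) =>
    (if k = i then x else 1) * (if k = j then x else 1))]
  by_cases hij : i = j
  · subst hij
    rw [if_pos rfl]
    refine Finset.prod_eq_one fun k _ => ?_
    by_cases hk : k = i
    · simpa [hk] using integral_sq_gaussianReal
    · simp [hk]
  · rw [if_neg hij]
    refine Finset.prod_eq_zero (Finset.mem_univ i) ?_
    simp [hij]

theorem quadratic_expand (K R : Matrix V V ℝ) (d z : V → ℝ) :
    (d + R *ᵥ z) ⬝ᵥ (K *ᵥ (d + R *ᵥ z)) = d ⬝ᵥ (K *ᵥ d) +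
      ((∑ i, ((d ᵥ* (K * R)) i + (Rᵀ *ᵥ (K *ᵥ d)) i) * z i) +
        ∑ i, ∑ j, (Rᵀ * (K * R)) i j * (z i * z j)) := by
  have h1 : d ⬝ᵥ (K *ᵥ (R *ᵥ z)) = ∑ i, (d ᵥ* (K * R)) i * z i := by
    rw [Matrix.mulVec_mulVec, Matrix.dotProduct_mulVec]; rfl
  have h2 : (R *ᵥ z) ⬝ᵥ (K *ᵥ d) = ∑ i, (Rᵀ *ᵥ (K *ᵥ d)) i * z i := by
    rw [dotProduct_comm, Matrix.dotProduct_mulVec, ← Matrix.mulVec_transpose]; rfl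
  have h3 : (R *ᵥ z) ⬝ᵥ (K *ᵥ (R *ᵥ z)) =
      ∑ i, ∑ j, (Rᵀ * (K * R)) i j * (z i * z j) := by
    rw [Matrix.mulVec_mulVec, Matrix.dotProduct_mulVec, Matrix.vecMul_mulVec,
      ← Matrix.dotProduct_mulVec, dotProduct]
    refine Finset.sum_congr rfl fun i _ => ?_
    rw [Matrix.mulVec, dotProduct, Finset.mul_sum]
    exact Finset.sum_congr rfl fun j _ => by ring
  rw [Matrix.mulVec_add, add_dotProduct, dotProduct_add, dotProduct_add, h1, h2, h3]
  simp only [add_mul, Finset.sum_add_distrib]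
  ring

/-- Substitute x = m + R z with z standard normal. The linear terms have mean zero and the
coordinates of z are orthonormal, so the trace of Rᵀ K R remains, which is the trace of K S. -/
theorem quadratic_gaussian {S : Matrix V V ℝ} (hS : S.PosDef) (m m' : V → ℝ)
    (K : Matrix V V ℝ) :
    Integrable (fun x => (x - m') ⬝ᵥ (K *ᵥ (x - m'))) (gaussian m S) ∧
    ∫ x, (x - m') ⬝ᵥ (K *ᵥ (x - m')) ∂(gaussian m S) =
      (m - m') ⬝ᵥ (K *ᵥ (m - m')) + (K * S).trace := by
  obtain ⟨R, hR, hSR⟩ := PosDef.exists_factor hS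
  have hmeas : Measurable fun z : V → ℝ => m + R *ᵥ z := by fun_prop
  have hcont : Continuous fun x : V → ℝ => (x - m') ⬝ᵥ (K *ᵥ (x - m')) := by fun_prop
  have hexp : ∀ z : V → ℝ, (m + R *ᵥ z - m') ⬝ᵥ (K *ᵥ (m + R *ᵥ z - m')) =
      (m - m') ⬝ᵥ (K *ᵥ (m - m')) +
      ((∑ i, (((m - m') ᵥ* (K * R)) i + (Rᵀ *ᵥ (K *ᵥ (m - m'))) i) * z i) +
        ∑ i, ∑ j, (Rᵀ * (K * R)) i j * (z i * z j)) := by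
    intro z
    rw [← quadratic_expand, add_sub_right_comm]
  have hi1 : Integrable (fun z : V → ℝ =>
      ∑ i, (((m - m') ᵥ* (K * R)) i + (Rᵀ *ᵥ (K *ᵥ (m - m'))) i) * z i)
      (Measure.pi fun _ : V => gaussianReal 0 1) :=
    integrable_finsetSum _ fun i _ => (integrable_coord i).const_mul _
  have hi2' : ∀ i, Integrable (fun z : V → ℝ => ∑ j, (Rᵀ * (K * R)) i j * (z i * z j))
      (Measure.pi fun _ : V => gaussianReal 0 1) := fun i =>
    integrable_finsetSum _ fun j _ => (integrable_coord_mul i j).const_mul _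
  have hi2 : Integrable (fun z : V → ℝ => ∑ i, ∑ j, (Rᵀ * (K * R)) i j * (z i * z j))
      (Measure.pi fun _ : V => gaussianReal 0 1) :=
    integrable_finsetSum _ fun i _ => hi2' i
  rw [gaussian_eq_map hR hSR m]
  constructor
  · rw [integrable_map_measure hcont.aestronglyMeasurable hmeas.aemeasurable]
    refine ((integrable_const ((m - m') ⬝ᵥ (K *ᵥ (m - m')))).add (hi1.add hi2)).congr ?_
    exact Filter.Eventually.of_forall fun z => (hexp z).symm
  · rw [integral_map hmeas.aemeasurable hcont.aestronglyMeasurable]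
    simp only [hexp]
    have hi12 : Integrable (fun z : V → ℝ =>
        (∑ i, (((m - m') ᵥ* (K * R)) i + (Rᵀ *ᵥ (K *ᵥ (m - m'))) i) * z i) +
        ∑ i, ∑ j, (Rᵀ * (K * R)) i j * (z i * z j))
        (Measure.pi fun _ : V => gaussianReal 0 1) := hi1.add hi2
    rw [integral_add (integrable_const _) hi12, integral_add hi1 hi2,
      integral_finsetSum _ (fun i _ => (integrable_coord i).const_mul _),
      integral_finsetSum _ (fun i _ => hi2' i)]
    simp only [integral_const_mul, integral_coord, mul_zero, Finset.sum_const_zero, zero_add]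
    have hsum : ∀ i, ∫ z : V → ℝ, ∑ j, (Rᵀ * (K * R)) i j * (z i * z j)
        ∂(Measure.pi fun _ : V => gaussianReal 0 1) = (Rᵀ * (K * R)) i i := by
      intro i
      rw [integral_finsetSum _ (fun j _ => (integrable_coord_mul i j).const_mul _)]
      simp only [integral_const_mul, integral_coord_mul]
      simp
    simp only [hsum]
    have htr : ∑ i, (Rᵀ * (K * R)) i i = (K * S).trace := by
      rw [hSR, ← Matrix.mul_assoc K, Matrix.trace_mul_comm (K * R)]
      rfl
    rw [htr]
    simp

end Moments

theorem gaussianDensity_pos {S : Matrix V V ℝ} (hS : S.PosDef) (m x : V → ℝ) :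
    0 < gaussianDensity m S x := by
  have := hS.det_pos
  unfold gaussianDensity
  positivity

theorem log_gaussianDensity {S : Matrix V V ℝ} (hS : S.PosDef) (m x : V → ℝ) :
    Real.log (gaussianDensity m S x) = -(1 / 2) * (Fintype.card V * Real.log (2 * Real.pi) +
      Real.log S.det + (x - m) ⬝ᵥ (S⁻¹ *ᵥ (x - m))) := by
  have hd := hS.det_pos
  have hpi : (0 : ℝ) < 2 * Real.pi := by positivity
  rw [gaussianDensity, Real.log_mul (by positivity) (Real.exp_ne_zero _), Real.log_exp,
    Real.log_inv, Real.log_sqrt (by positivity), Real.log_mul (by positivity) hd.ne',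
    Real.log_pow]
  ring

/-- Both densities are positive, so their ratio is the Radon-Nikodym derivative. Its logarithm is a
difference of quadratic polynomials, integrated by `quadratic_gaussian`. -/
theorem klDiv_gaussian {A B : Matrix V V ℝ} (hA : A.PosDef) (hB : B.PosDef) (m m' : V → ℝ) :
    InformationTheory.klDiv (gaussian m A) (gaussian m' B) = ENNReal.ofReal ((1 / 2) *
      (Real.log B.det + (B⁻¹ * A).trace + (m - m') ⬝ᵥ (B⁻¹ *ᵥ (m - m')) -
        (Real.log A.det + Fintype.card V))) := by
  have hpA := isProbabilityMeasure_gaussian hA m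
  have hpB := isProbabilityMeasure_gaussian hB m'
  set h : (V → ℝ) → ENNReal := fun x =>
    ENNReal.ofReal (gaussianDensity m A x / gaussianDensity m' B x) with hdef
  have hmA := measurable_gaussianDensity m A
  have hmB := measurable_gaussianDensity m' B
  have hm : Measurable h := (hmA.div hmB).ennreal_ofReal
  have hwd : gaussian m A = (gaussian m' B).withDensity h := by
    rw [gaussian, gaussian, ← withDensity_mul _ hmB.ennreal_ofReal hm]
    congr 1
    ext x
    have hb := gaussianDensity_pos hB m' x
    rw [Pi.mul_apply, hdef, ← ENNReal.ofReal_mul hb.le, mul_div_cancel₀ _ hb.ne']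
  have hac : gaussian m A ≪ gaussian m' B := by
    rw [hwd]; exact withDensity_absolutelyContinuous _ _
  have hrn : (gaussian m A).rnDeriv (gaussian m' B) =ᵐ[gaussian m' B] h := by
    conv_lhs => rw [hwd]
    exact Measure.rnDeriv_withDensity _ hm
  have hllr : llr (gaussian m A) (gaussian m' B) =ᵐ[gaussian m A] fun x =>
      (1 / 2) * (Real.log B.det - Real.log A.det) +
        ((1 / 2) * ((x - m') ⬝ᵥ (B⁻¹ *ᵥ (x - m'))) -
          (1 / 2) * ((x - m) ⬝ᵥ (A⁻¹ *ᵥ (x - m)))) := by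
    filter_upwards [hac.ae_le hrn] with x hx
    have ha := gaussianDensity_pos hA m x
    have hb := gaussianDensity_pos hB m' x
    rw [llr, hx, hdef, ENNReal.toReal_ofReal (div_pos ha hb).le, Real.log_div ha.ne' hb.ne',
      log_gaussianDensity hA, log_gaussianDensity hB]
    ring
  obtain ⟨i1, e1⟩ := quadratic_gaussian hA m m' B⁻¹
  obtain ⟨i2, e2⟩ := quadratic_gaussian hA m m A⁻¹
  have i1' := i1.const_mul (1 / 2)
  have i2' := i2.const_mul (1 / 2)
  have hint : Integrable (llr (gaussian m A) (gaussian m' B)) (gaussian m A) :=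
    ((integrable_const _).add (i1'.sub i2')).congr hllr.symm
  have i12 : Integrable (fun x => (1 / 2) * ((x - m') ⬝ᵥ (B⁻¹ *ᵥ (x - m'))) -
          (1 / 2) * ((x - m) ⬝ᵥ (A⁻¹ *ᵥ (x - m)))) (gaussian m A) := i1'.sub i2'
  rw [InformationTheory.klDiv_of_ac_of_integrable hac hint, integral_congr_ae hllr,
    integral_add (integrable_const _) i12, integral_sub i1' i2',
    integral_const_mul (1 / 2 : ℝ) (fun x => (x - m') ⬝ᵥ (B⁻¹ *ᵥ (x - m'))),
    integral_const_mul (1 / 2 : ℝ) (fun x => (x - m) ⬝ᵥ (A⁻¹ *ᵥ (x - m))), e1, e2, PosDef.inv_mul' hA]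
  -- The total masses that enter the divergence of general finite measures cancel, both being 1.
  simp only [integral_const, probReal_univ, smul_eq_mul, one_mul, sub_self, Matrix.mulVec_zero,
    dotProduct_zero, Matrix.trace_one, zero_add, add_sub_cancel_right]
  congr 1
  ring

/-- Bias-variance decomposition: the scatter about `m` is the scatter about the empirical mean plus
the displacement of the mean. -/
theorem sum_quadratic_samples {s : ℕ} (x : Fin s → V → ℝ) (m : V → ℝ) (K : Matrix V V ℝ) :
    ∑ a, (x a - m) ⬝ᵥ (K *ᵥ (x a - m)) =
      s * ((K * empiricalCov x).trace +
        (empiricalMean x - m) ⬝ᵥ (K *ᵥ (empiricalMean x - m))) := by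
  -- The empirical moments divide by `s`; without samples both sides are zero.
  rcases Nat.eq_zero_or_pos s with rfl | hs
  · simp
  have hs' : (s : ℝ) ≠ 0 := by positivity
  have htr : ∀ u v : V → ℝ, (K * Matrix.vecMulVec u v).trace = v ⬝ᵥ (K *ᵥ u) := by
    intro u v
    rw [Matrix.mul_vecMulVec, Matrix.trace_vecMulVec, dotProduct_comm]
  have hsum : ∑ a, x a = (s : ℝ) • empiricalMean x := by
    rw [empiricalMean, smul_smul, mul_one_div_cancel hs', one_smul]
  have h1 : ∑ a, (x a) ⬝ᵥ (K *ᵥ m) = s * (empiricalMean x ⬝ᵥ (K *ᵥ m)) := by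
    rw [← sum_dotProduct, hsum, smul_dotProduct, smul_eq_mul]
  have h2 : ∑ a, m ⬝ᵥ (K *ᵥ (x a)) = s * (m ⬝ᵥ (K *ᵥ empiricalMean x)) := by
    rw [← dotProduct_sum, ← Matrix.mulVec_sum, hsum, Matrix.mulVec_smul, dotProduct_smul,
      smul_eq_mul]
  have h3 : s * (K * empiricalCov x).trace = ∑ a, x a ⬝ᵥ (K *ᵥ x a) -
      s * (empiricalMean x ⬝ᵥ (K *ᵥ empiricalMean x)) := by
    rw [empiricalCov, Matrix.mul_sub, Matrix.trace_sub, Matrix.mul_smul, Matrix.trace_smul,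
      Matrix.mul_sum, Matrix.trace_sum, htr, smul_eq_mul, mul_sub, ← mul_assoc,
      mul_one_div_cancel hs', one_mul]
    simp only [htr]
  rw [mul_add, h3]
  simp only [Matrix.mulVec_sub, sub_dotProduct, dotProduct_sub, Finset.sum_sub_distrib, h1, h2]
  simp
  ring

theorem sum_log_gaussianDensity {s : ℕ} (x : Fin s → V → ℝ) (m : V → ℝ) {S : Matrix V V ℝ}
    (hS : S.PosDef) :
    ∑ a, Real.log (gaussianDensity m S (x a)) =
      -(s / 2 : ℝ) * (Fintype.card V * Real.log (2 * Real.pi) +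
        (Real.log S.det + (S⁻¹ * empiricalCov x).trace) +
        (empiricalMean x - m) ⬝ᵥ (S⁻¹ *ᵥ (empiricalMean x - m))) := by
  simp only [log_gaussianDensity hS]
  rw [← Finset.mul_sum, Finset.sum_add_distrib, sum_quadratic_samples]
  simp
  ring

theorem PosDef.quadratic_nonneg {K : Matrix V V ℝ} (hK : K.PosDef) (d : V → ℝ) :
    0 ≤ d ⬝ᵥ (K *ᵥ d) := by
  simpa using hK.posSemidef.dotProduct_mulVec_nonneg d

variable {F : Finset V} {Sh S : Matrix V V ℝ} {E : SimpleGraph {i // i ∉ F}}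

/-- Both divergences subtract the same entropy term, so `log_det_add_trace_le` suffices. A different
mean can only add a nonnegative quadratic term. -/
theorem IsConditionedChowLiuOutput.klDiv_le (hSh : Sh.PosDef)
    (h : IsConditionedChowLiuOutput F Sh E S) (m : V → ℝ) {q : Measure (V → ℝ)}
    (hq : q ∈ modelFamily F) :
    InformationTheory.klDiv (gaussian m Sh) (gaussian m S) ≤
      InformationTheory.klDiv (gaussian m Sh) q := by
  obtain ⟨m', S', hS', rfl⟩ := hq
  rw [klDiv_gaussian hSh (h.posDef hSh), klDiv_gaussian hSh hS'.1]
  refine ENNReal.ofReal_le_ofReal ?_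
  have h1 := h.log_det_add_trace_le hSh hS'
  have h2 := PosDef.quadratic_nonneg hS'.1.inv (m - m')
  simp only [sub_self, Matrix.mulVec_zero, dotProduct_zero]
  linarith

theorem IsConditionedChowLiuOutput.sum_log_le (hSh : Sh.PosDef)
    (h : IsConditionedChowLiuOutput F Sh E S) {s : ℕ} (x : Fin s → V → ℝ)
    (hx : empiricalCov x = Sh) (m : V → ℝ) {S' : Matrix V V ℝ} (hS' : S' ∈ covFamily F) :
    ∑ a, Real.log (gaussianDensity m S' (x a)) ≤
      ∑ a, Real.log (gaussianDensity (empiricalMean x) S (x a)) := by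
  rw [sum_log_gaussianDensity x m hS'.1, sum_log_gaussianDensity x _ (h.posDef hSh), hx]
  have h1 := h.log_det_add_trace_le hSh hS'
  have h2 := PosDef.quadratic_nonneg hS'.1.inv (empiricalMean x - m)
  have h3 : (0 : ℝ) ≤ s / 2 := by positivity
  simp only [sub_self, Matrix.mulVec_zero, dotProduct_zero]
  rw [neg_mul, neg_mul]
  refine neg_le_neg (mul_le_mul_of_nonneg_left ?_ h3)
  linarith

theorem IsConditionedChowLiuOutput.mem_covFamily (hSh : Sh.PosDef)
    (h : IsConditionedChowLiuOutput F Sh E S) : S ∈ covFamily F :=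
  ⟨h.posDef hSh, h.exists_treeCov.elim fun _ h1 => h1.1.1.1.anti (h.graph_le hSh)⟩

end GaussianMeasures

/-! ### Reasoning about programs -/

/-- The memory locations that a program may write: natural number variables `(0, x)`, real
variables `(1, x)`, natural number arrays `(2, a)` and real arrays `(3, a)`. -/
def Cmd.writes : Cmd → List (ℕ × ℕ)
  | .skip => []
  | .iset x _ => [(0, x)]
  | .rset x _ => [(1, x)]
  | .iput a _ _ _ => [(2, a)]
  | .rput a _ _ _ => [(3, a)]
  | .seq c d => c.writes ++ d.writes
  | .branch _ c d => c.writes ++ d.writes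
  | .loop _ c => c.writes

/-- `σ'` agrees with `σ` outside the locations in `w`. -/
structure Frame (w : List (ℕ × ℕ)) (σ σ' : Mem) : Prop where
  iv : ∀ x, (0, x) ∉ w → σ'.iv x = σ.iv x
  rv : ∀ x, (1, x) ∉ w → σ'.rv x = σ.rv x
  ia : ∀ a, (2, a) ∉ w → σ'.ia a = σ.ia a
  ra : ∀ a, (3, a) ∉ w → σ'.ra a = σ.ra a

theorem Frame.refl (w : List (ℕ × ℕ)) (σ : Mem) : Frame w σ σ :=
  ⟨fun _ _ => rfl, fun _ _ => rfl, fun _ _ => rfl, fun _ _ => rfl⟩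

theorem Frame.trans {w : List (ℕ × ℕ)} {σ σ' σ'' : Mem} (h : Frame w σ σ') (h' : Frame w σ' σ'') :
    Frame w σ σ'' :=
  ⟨fun x hx => (h'.iv x hx).trans (h.iv x hx), fun x hx => (h'.rv x hx).trans (h.rv x hx),
    fun x hx => (h'.ia x hx).trans (h.ia x hx), fun x hx => (h'.ra x hx).trans (h.ra x hx)⟩

theorem Frame.mono {w w' : List (ℕ × ℕ)} {σ σ' : Mem} (h : Frame w σ σ') (hw : w ⊆ w') :
    Frame w' σ σ' :=
  ⟨fun x hx => h.iv x fun hm => hx (hw hm), fun x hx => h.rv x fun hm => hx (hw hm),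
    fun x hx => h.ia x fun hm => hx (hw hm), fun x hx => h.ra x fun hm => hx (hw hm)⟩

theorem updateCell_of_ne {α : Type} (f : ℕ → ℕ → ℕ → α) {a b : ℕ} (h : b ≠ a) (i j : ℕ) (v : α) :
    updateCell f a i j v b = f b := by
  funext i' j'
  simp [updateCell, h]

theorem updateCell_same {α : Type} (f : ℕ → ℕ → ℕ → α) (a i j : ℕ) (v : α) (i' j' : ℕ) :
    updateCell f a i j v a i' j' = if i' = i ∧ j' = j then v else f a i' j' := by
  simp [updateCell]

/-- Specifications of programs mention only what changes; everything else is recovered from the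
syntactic list of written locations, so that `decide` settles most noninterference goals. -/
theorem Exec.frame {c : Cmd} {σ σ' : Mem} {t : ℕ} (h : Exec c σ t σ') : Frame c.writes σ σ' := by
  induction h with
  | skip σ => exact Frame.refl _ _
  | iset σ x e =>
    refine ⟨fun y hy => ?_, fun _ _ => rfl, fun _ _ => rfl, fun _ _ => rfl⟩
    have : y ≠ x := by rintro rfl; exact hy (by simp [Cmd.writes])
    exact Function.update_of_ne this _ _
  | rset σ x e =>
    refine ⟨fun _ _ => rfl, fun y hy => ?_, fun _ _ => rfl, fun _ _ => rfl⟩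
    have : y ≠ x := by rintro rfl; exact hy (by simp [Cmd.writes])
    exact Function.update_of_ne this _ _
  | iput σ a i j e =>
    refine ⟨fun _ _ => rfl, fun _ _ => rfl, fun b hb => ?_, fun _ _ => rfl⟩
    exact updateCell_of_ne _ (by rintro rfl; exact hb (by simp [Cmd.writes])) _ _ _
  | rput σ a i j e =>
    refine ⟨fun _ _ => rfl, fun _ _ => rfl, fun _ _ => rfl, fun b hb => ?_⟩
    exact updateCell_of_ne _ (by rintro rfl; exact hb (by simp [Cmd.writes])) _ _ _
  | seq _ _ ihc ihd =>
    exact (ihc.mono (List.subset_append_left _ _)).trans (ihd.mono (List.subset_append_right _ _))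
  | branchTrue _ _ ih => exact ih.mono (List.subset_append_left _ _)
  | branchFalse _ _ ih => exact ih.mono (List.subset_append_right _ _)
  | loopTrue _ _ _ ihc ihl => exact ihc.trans ihl
  | loopFalse _ => exact Frame.refl _ _

/-- Started in `σ`, the program `c` halts after at most `T` steps in a memory that satisfies `Q`. -/
def Run (c : Cmd) (σ : Mem) (T : ℕ) (Q : Mem → Prop) : Prop :=
  ∃ t σ', Exec c σ t σ' ∧ t ≤ T ∧ Q σ'

/-- The frame is handed to the postcondition, so facts about untouched memory can be added
afterwards. -/
theorem Run.mono {c : Cmd} {σ : Mem} {T T' : ℕ} {Q Q' : Mem → Prop} (h : Run c σ T Q)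
    (hT : T ≤ T') (hQ : ∀ σ', Frame c.writes σ σ' → Q σ' → Q' σ') : Run c σ T' Q' := by
  obtain ⟨t, σ', he, ht, hq⟩ := h
  exact ⟨t, σ', he, ht.trans hT, hQ σ' he.frame hq⟩

theorem Run.seq {c d : Cmd} {σ : Mem} {T₁ T₂ T : ℕ} {P Q : Mem → Prop} (hc : Run c σ T₁ P)
    (hd : ∀ σ', Frame c.writes σ σ' → P σ' → Run d σ' T₂ Q) (hT : T₁ + T₂ ≤ T) :
    Run (.seq c d) σ T Q := by
  obtain ⟨t, σ', he, ht, hp⟩ := hc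
  obtain ⟨u, σ'', he', hu, hq⟩ := hd σ' he.frame hp
  exact ⟨t + u, σ'', .seq he he', by omega, hq⟩

/-- The program `body` for the values `0, 1, …` of the variable `x` that are less than `e`. -/
def forLoop (x : ℕ) (e : IExp) (body : Cmd) : Cmd :=
  .seq (.iset x (.lit 0)) (.loop (.ilt (.var x) e) (.seq body (.iset x (.add (.var x) (.lit 1)))))

/-- The usual invariant rule. `hI` makes the invariant insensitive to the loop counter. A round
costs the body, `e.cost + 2` for the test, 4 for the increment and 1 for the loop. The extra round
in `hT` pays for the initialization and the final test. -/
theorem Run.forLoop {x : ℕ} {e : IExp} {body : Cmd} {σ : Mem} {N B T : ℕ} (I : ℕ → Mem → Prop)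
    (hx : (0, x) ∉ body.writes)
    (he : ∀ σ', Frame (FVSLearning.forLoop x e body).writes σ σ' → e.eval σ' = N)
    (h0 : I 0 σ)
    (hI : ∀ i σ' v, I i σ' → I i { σ' with iv := Function.update σ'.iv x v })
    (hs : ∀ i < N, ∀ σ', Frame (FVSLearning.forLoop x e body).writes σ σ' → σ'.iv x = i →
      I i σ' → Run body σ' B (I (i + 1)))
    (hT : (N + 1) * (B + e.cost + 7) ≤ T) :
    Run (FVSLearning.forLoop x e body) σ T (I N) := by
  have hw : (FVSLearning.forLoop x e body).writes = (0, x) :: (body.writes ++ [(0, x)]) := rfl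
  have key : ∀ r i, i + r = N → ∀ σ', Frame (FVSLearning.forLoop x e body).writes σ σ' →
      σ'.iv x = i → I i σ' →
      Run (.loop (.ilt (.var x) e) (.seq body (.iset x (.add (.var x) (.lit 1))))) σ'
        (r * (B + e.cost + 7) + (e.cost + 3)) (I N) := by
    intro r
    induction r with
    | zero =>
      intro i hi σ' hf hxi hIi
      refine ⟨_, σ', Exec.loopFalse ?_, ?_, ?_⟩
      · simp only [BExp.Holds, IExp.eval, he σ' hf, hxi]; omega
      · simp only [BExp.cost, IExp.cost]; omega
      · rw [← hi]; exact hIi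
    | succ r ih =>
      intro i hi σ' hf hxi hIi
      obtain ⟨t, σ₁, h1, ht, hI1⟩ := hs i (by omega) σ' hf hxi hIi
      have hf1 := h1.frame
      have hx1 : σ₁.iv x = i := (hf1.iv x hx).trans hxi
      have hb : (BExp.ilt (.var x) e).Holds σ' := by
        simp only [BExp.Holds, IExp.eval, he σ' hf, hxi]; omega
      have h2 := Exec.iset σ₁ x (.add (.var x) (.lit 1))
      have h12 := Exec.seq h1 h2
      have hev : (IExp.add (.var x) (.lit 1)).eval σ₁ = i + 1 := by
        simp only [IExp.eval, hx1]
      rw [hev] at h12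
      have hf2 : Frame (FVSLearning.forLoop x e body).writes σ
          { σ₁ with iv := Function.update σ₁.iv x (i + 1) } := by
        refine (hf.trans (h12.frame.mono ?_))
        rw [hw]
        exact List.subset_cons_of_subset _ (List.Subset.refl _)
      obtain ⟨u, σ₂, h3, hu, hI2⟩ := ih (i + 1) (by omega) _ hf2 (by simp) (hI _ _ _ hI1)
      refine ⟨_, σ₂, Exec.loopTrue hb h12 h3, ?_, hI2⟩
      simp only [BExp.cost, IExp.cost]
      rw [Nat.add_mul]
      omega
  have h0' := Exec.iset σ x (.lit 0)
  have hf0 : Frame (FVSLearning.forLoop x e body).writes σ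
      { σ with iv := Function.update σ.iv x 0 } := by
    refine h0'.frame.mono ?_
    rw [hw]
    intro y hy
    simp only [Cmd.writes, List.mem_singleton] at hy
    simp [hy]
  obtain ⟨t, σ', h1, ht, h2⟩ := key N 0 (by omega) _ hf0 (by simp) (hI _ _ _ h0)
  refine ⟨_, σ', Exec.seq h0' h1, ?_, h2⟩
  simp only [IExp.cost]
  rw [Nat.add_mul] at hT
  omega

/-- Programs without loops. -/
def Cmd.straight : Cmd → Bool
  | .seq c d => c.straight && d.straight
  | .branch _ c d => c.straight && d.straight
  | .loop _ _ => false
  | _ => true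

/-- A bound for the running time of a program without loops. -/
def Cmd.maxCost : Cmd → ℕ
  | .skip => 1
  | .iset _ e => e.cost + 1
  | .rset _ e => e.cost + 1
  | .iput _ i j e => i.cost + j.cost + e.cost + 1
  | .rput _ i j e => i.cost + j.cost + e.cost + 1
  | .seq c d => c.maxCost + d.maxCost
  | .branch b c d => b.cost + (c.maxCost + d.maxCost) + 1
  | .loop _ _ => 0

open Classical in
/-- The effect of a program without loops. -/
def Cmd.step : Cmd → Mem → Mem
  | .skip, σ => σ
  | .iset x e, σ => { σ with iv := Function.update σ.iv x (e.eval σ) }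
  | .rset x e, σ => { σ with rv := Function.update σ.rv x (e.eval σ) }
  | .iput a i j e, σ => { σ with ia := updateCell σ.ia a (i.eval σ) (j.eval σ) (e.eval σ) }
  | .rput a i j e, σ => { σ with ra := updateCell σ.ra a (i.eval σ) (j.eval σ) (e.eval σ) }
  | .seq c d, σ => d.step (c.step σ)
  | .branch b c d, σ => if b.Holds σ then c.step σ else d.step σ
  | .loop _ _, σ => σ

theorem exec_straight {c : Cmd} (hc : c.straight = true) (σ : Mem) :
    ∃ t ≤ c.maxCost, Exec c σ t (c.step σ) := by
  induction c generalizing σ with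
  | skip => exact ⟨_, le_rfl, .skip σ⟩
  | iset x e => exact ⟨_, le_rfl, .iset σ x e⟩
  | rset x e => exact ⟨_, le_rfl, .rset σ x e⟩
  | iput a i j e => exact ⟨_, le_rfl, .iput σ a i j e⟩
  | rput a i j e => exact ⟨_, le_rfl, .rput σ a i j e⟩
  | seq c d ihc ihd =>
    simp only [Cmd.straight, Bool.and_eq_true] at hc
    obtain ⟨t, ht, h1⟩ := ihc hc.1 σ
    obtain ⟨u, hu, h2⟩ := ihd hc.2 (c.step σ)
    exact ⟨t + u, by simp only [Cmd.maxCost]; omega, .seq h1 h2⟩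
  | branch b c d ihc ihd =>
    simp only [Cmd.straight, Bool.and_eq_true] at hc
    by_cases hb : b.Holds σ
    · obtain ⟨t, ht, h1⟩ := ihc hc.1 σ
      refine ⟨b.cost + t + 1, by simp only [Cmd.maxCost]; omega, ?_⟩
      rw [Cmd.step, if_pos hb]
      exact .branchTrue hb h1
    · obtain ⟨t, ht, h1⟩ := ihd hc.2 σ
      refine ⟨b.cost + t + 1, by simp only [Cmd.maxCost]; omega, ?_⟩
      rw [Cmd.step, if_neg hb]
      exact .branchFalse hb h1
  | loop b c => simp [Cmd.straight] at hc

/-- Reduces loop-free code to evaluating the function `Cmd.step`, which `simp` can do. -/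
theorem Run.straight {c : Cmd} {σ : Mem} {T : ℕ} {Q : Mem → Prop} (hc : c.straight = true)
    (hT : c.maxCost ≤ T) (hQ : Q (c.step σ)) : Run c σ T Q := by
  obtain ⟨t, ht, h⟩ := exec_straight hc σ
  exact ⟨t, _, h, ht.trans hT, hQ⟩

/-- A loop that fills a row of a real array. -/
theorem Run.fillRow {x : ℕ} {e : IExp} {body : Cmd} {σ : Mem} {N B T A r : ℕ} (g : ℕ → ℝ)
    (hx : (0, x) ∉ body.writes)
    (he : ∀ σ', Frame (FVSLearning.forLoop x e body).writes σ σ' → e.eval σ' = N)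
    (hs : ∀ i < N, ∀ σ', Frame (FVSLearning.forLoop x e body).writes σ σ' → σ'.iv x = i →
      (∀ a j, σ'.ra A a j = if a = r ∧ j < i then g j else σ.ra A a j) →
      Run body σ' B fun σ'' =>
        ∀ a j, σ''.ra A a j = if a = r ∧ j = i then g i else σ'.ra A a j)
    (hT : (N + 1) * (B + e.cost + 7) ≤ T) :
    Run (FVSLearning.forLoop x e body) σ T fun σ' =>
      ∀ a j, σ'.ra A a j = if a = r ∧ j < N then g j else σ.ra A a j := by
  refine Run.forLoop (fun i σ' => ∀ a j, σ'.ra A a j = if a = r ∧ j < i then g j else σ.ra A a j)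
    hx he ?_ (fun _ _ _ h => h) ?_ hT
  · intro a j; simp
  · intro i hi σ' hf hxi hI
    refine (hs i hi σ' hf hxi hI).mono le_rfl fun σ'' _ h a j => ?_
    rw [h, hI]
    by_cases h1 : a = r <;> by_cases h2 : j = i
    · subst h2; simp [h1]
    · have : j < i + 1 ↔ j < i := by omega
      simp [h1, h2, this]
    · simp [h1]
    · simp [h1]

/-- A double loop that fills a rectangle of a real array. -/
theorem Run.fillRect {x y : ℕ} {e f : IExp} {body : Cmd} {σ : Mem} {N M B T A : ℕ}
    (g : ℕ → ℕ → ℝ)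
    (hx : (0, x) ∉ (FVSLearning.forLoop y f body).writes) (hy : (0, y) ∉ body.writes)
    (he : ∀ σ', Frame (FVSLearning.forLoop x e (FVSLearning.forLoop y f body)).writes σ σ' →
      e.eval σ' = N)
    (hf : ∀ σ', Frame (FVSLearning.forLoop x e (FVSLearning.forLoop y f body)).writes σ σ' →
      f.eval σ' = M)
    (hs : ∀ i < N, ∀ j < M, ∀ σ',
      Frame (FVSLearning.forLoop x e (FVSLearning.forLoop y f body)).writes σ σ' →
      σ'.iv x = i → σ'.iv y = j →
      (∀ a b, σ'.ra A a b =
        if (a < i ∧ b < M) ∨ (a = i ∧ b < j) then g a b else σ.ra A a b) →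
      Run body σ' B fun σ'' =>
        ∀ a b, σ''.ra A a b = if a = i ∧ b = j then g i j else σ'.ra A a b)
    (hT : (N + 1) * ((M + 1) * (B + f.cost + 7) + e.cost + 7) ≤ T) :
    Run (FVSLearning.forLoop x e (FVSLearning.forLoop y f body)) σ T fun σ' =>
      ∀ a b, σ'.ra A a b = if a < N ∧ b < M then g a b else σ.ra A a b := by
  have hsub : (FVSLearning.forLoop y f body).writes ⊆
      (FVSLearning.forLoop x e (FVSLearning.forLoop y f body)).writes := by
    intro z hz
    simp only [FVSLearning.forLoop, Cmd.writes, List.mem_append, List.mem_cons] at hz ⊢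
    tauto
  refine Run.forLoop
    (fun i σ' => ∀ a b, σ'.ra A a b = if a < i ∧ b < M then g a b else σ.ra A a b)
    hx he ?_ (fun _ _ _ h => h) ?_ hT
  · intro a b; simp
  · intro i hi σ' hf' hxi hI
    refine (Run.fillRow (A := A) (r := i) (fun b => g i b) hy
      (fun σ'' h => hf σ'' (hf'.trans (h.mono hsub))) ?_ le_rfl).mono le_rfl ?_
    · intro j hj σ'' hf'' hyj hrow
      refine hs i hi j hj σ'' (hf'.trans (hf''.mono hsub)) ?_ hyj ?_
      · rw [hf''.iv x hx, hxi]
      · intro a b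
        rw [hrow, hI]
        by_cases h1 : a = i
        · subst h1; simp
        · simp [h1]
    · intro σ'' _ h a b
      rw [h, hI]
      by_cases h1 : a = i
      · subst h1; simp
      · have : a < i + 1 ↔ a < i := by omega
        simp [h1, this]

/-! ### Listing the feedback vertices -/

/-- Lists the elements of `F` in natural number array 3. -/
def listFVS : Cmd :=
  .seq (.iset 4 (.lit 0)) (forLoop 5 (.var 0)
    (.branch (.ieq (.get 0 (.var 5) (.lit 0)) (.lit 1))
      (.seq (.iput 3 (.var 4) (.lit 0) (.var 5)) (.iset 4 (.add (.var 4) (.lit 1)))) .skip))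

/-- Natural number array 3 holds the list of feedback vertices given by `e`. -/
def Mem.HoldsList (σ : Mem) {n : ℕ} {F : Finset (Fin n)} (e : Fin F.card ≃ {i // i ∈ F}) : Prop :=
  ∀ a : Fin F.card, σ.ia 3 a 0 = ((e a : Fin n) : ℕ)

theorem card_filter_lt_succ {n : ℕ} (F : Finset (Fin n)) (i : Fin n) :
    (F.filter fun v : Fin n => (v : ℕ) < i + 1).card =
      (F.filter fun v : Fin n => (v : ℕ) < i).card + if i ∈ F then 1 else 0 := by
  split_ifs with hi
  · have : (F.filter fun v : Fin n => (v : ℕ) < i + 1) =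
        insert i (F.filter fun v : Fin n => (v : ℕ) < i) := by
      ext v
      simp only [Finset.mem_filter, Finset.mem_insert]
      constructor
      · rintro ⟨h1, h2⟩
        by_cases hv : v = i
        · exact Or.inl hv
        · exact Or.inr ⟨h1, by have : (v : ℕ) ≠ i := fun h => hv (Fin.ext h); omega⟩
      · rintro (rfl | ⟨h1, h2⟩)
        · exact ⟨hi, by omega⟩
        · exact ⟨h1, by omega⟩
    rw [this, Finset.card_insert_of_notMem (by simp)]
  · congr 1
    ext v
    simp only [Finset.mem_filter]
    refine and_congr_right fun hv => ?_
    have : (v : ℕ) ≠ i := fun h => hi ((Fin.ext h : v = i) ▸ hv)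
    omega

/-- After `i` rounds the list contains exactly the elements of `F` below `i`, and its length is
their number. -/
theorem run_listFVS {n : ℕ} {F : Finset (Fin n)} {σ : Mem} (h : σ.HoldsFVS F) :
    Run listFVS σ (30 * (n + 1)) fun σ' => ∃ e : Fin F.card ≃ {i // i ∈ F}, σ'.HoldsList e := by
  let I : ℕ → Mem → Prop := fun i σ' =>
    σ'.iv 4 = (F.filter fun v : Fin n => (v : ℕ) < i).card ∧
    (∀ a < σ'.iv 4, ∃ v ∈ F, (v : ℕ) < i ∧ σ'.ia 3 a 0 = v) ∧
    ∀ v ∈ F, (v : ℕ) < i → ∃ a < σ'.iv 4, σ'.ia 3 a 0 = v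
  refine Run.seq (T₁ := 2) (T₂ := 28 * (n + 1)) (P := fun σ' => σ'.iv 4 = 0)
    (Run.straight rfl (by decide) (by simp [Cmd.step, IExp.eval])) ?_ (by omega)
  intro σ₁ hf₁ h4
  refine (Run.forLoop (N := n) (B := 18) I (by decide) ?_ ?_ ?_ ?_ ?_).mono le_rfl ?_
  · intro σ' hf
    exact (hf.iv 0 (by decide)).trans ((hf₁.iv 0 (by decide)).trans h.1)
  · refine ⟨by simp [h4], ?_, ?_⟩
    · intro a ha; rw [h4] at ha; omega
    · intro v _ hv; omega
  · intro i σ' v hI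
    simpa [I] using hI
  · intro i hi σ' hf hx hI
    have h0 : σ'.ia 0 i 0 = if (⟨i, hi⟩ : Fin n) ∈ F then 1 else 0 := by
      rw [hf.ia 0 (by decide), hf₁.ia 0 (by decide)]
      exact h.2.2 ⟨i, hi⟩
    have hcard := card_filter_lt_succ F ⟨i, hi⟩
    refine Run.straight rfl (by decide) ?_
    obtain ⟨hI1, hI2, hI3⟩ := hI
    by_cases hF : (⟨i, hi⟩ : Fin n) ∈ F
    · rw [if_pos hF] at h0 hcard
      simp only [Cmd.step, BExp.Holds, IExp.eval, hx, h0, if_true]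
      refine ⟨?_, ?_, ?_⟩
      · simp only [Function.update_self, hI1]; exact hcard.symm
      · intro a ha
        simp only [Function.update_self] at ha
        by_cases ha' : a = σ'.iv 4
        · exact ⟨⟨i, hi⟩, hF, by simp, by simp [updateCell_same, ha']⟩
        · obtain ⟨v, hv, hvi, hva⟩ := hI2 a (by omega)
          exact ⟨v, hv, by omega, by simp [updateCell_same, ha', hva]⟩
      · intro v hv hvi
        simp only [Function.update_self]
        by_cases hvi' : (v : ℕ) = i
        · exact ⟨σ'.iv 4, by omega, by simp [updateCell_same, hvi']⟩
        · obtain ⟨a, ha, hva⟩ := hI3 v hv (by omega)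
          exact ⟨a, by omega, by simp [updateCell_same, ha.ne, hva]⟩
    · rw [if_neg hF] at h0 hcard
      have : ¬ (0 : ℕ) = 1 := by omega
      simp only [Cmd.step, BExp.Holds, IExp.eval, hx, h0, if_neg this]
      refine ⟨?_, ?_, ?_⟩
      · rw [hI1]; exact hcard.symm
      · intro a ha
        obtain ⟨v, hv, hvi, hva⟩ := hI2 a ha
        exact ⟨v, hv, by omega, hva⟩
      · intro v hv hvi
        refine hI3 v hv ?_
        have : (v : ℕ) ≠ i := by
          rintro rfl
          exact hF hv
        omega
  · simp only [IExp.cost]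
    omega
  · rintro σ' - ⟨h1, h2, h3⟩
    have hcard : σ'.iv 4 = F.card := by
      rw [h1]
      congr 1
      exact Finset.filter_true_of_mem fun v _ => v.2
    rw [hcard] at h2 h3
    choose f hf1 hf2 hf3 using h2
    let g : Fin F.card → {i // i ∈ F} := fun a => ⟨f a a.2, hf1 a a.2⟩
    have hg : ∀ a : Fin F.card, σ'.ia 3 a 0 = ((g a : Fin n) : ℕ) := fun a => hf3 a a.2
    -- Counting spares a proof that the list has no repetitions: a surjection between sets of equal
    -- size is a bijection.
    have hsurj : Function.Surjective g := by
      intro v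
      obtain ⟨a, ha, hva⟩ := h3 v v.2 v.1.2
      refine ⟨⟨a, ha⟩, Subtype.ext (Fin.ext ?_)⟩
      rw [← hg]; exact hva
    have hbij := (Fintype.bijective_iff_surjective_and_card g).2 ⟨hsurj, by simp⟩
    exact ⟨Equiv.ofBijective g hbij, hg⟩

/-! ### Gauss-Jordan elimination -/

section Sweep

variable {k : ℕ}

/-- `Y` transforms the first `p` columns of `B` into unit vectors and is the identity matrix in
the other columns. -/
structure IsSweep (B Y : Matrix (Fin k) (Fin k) ℝ) (p : ℕ) : Prop where
  left : ∀ a g : Fin k, (g : ℕ) < p → (Y * B) a g = if a = g then 1 else 0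
  right : ∀ a b : Fin k, p ≤ (b : ℕ) → Y a b = if a = b then 1 else 0

theorem IsSweep.one (B : Matrix (Fin k) (Fin k) ℝ) : IsSweep B 1 0 :=
  ⟨fun _ _ h => absurd h (Nat.not_lt_zero _), fun _ _ _ => Matrix.one_apply⟩

theorem IsSweep.eq_inv {B Y : Matrix (Fin k) (Fin k) ℝ} (h : IsSweep B Y k) : Y = B⁻¹ := by
  refine (Matrix.inv_eq_left_inv ?_).symm
  ext a g
  rw [h.left a g g.2, Matrix.one_apply]

/-- No row exchanges are needed. The quadratic form of `B` at row `p` of `Y` is positive and equals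
the pivot: row `p` of `Y * B` vanishes before column `p`, and row `p` of `Y` is zero after column
`p` and one in it. -/
theorem IsSweep.pivot_pos {B Y : Matrix (Fin k) (Fin k) ℝ} {p : Fin k} (h : IsSweep B Y p)
    (hB : B.PosDef) : 0 < (Y * B) p p := by
  have hy : Y p ≠ 0 := by
    intro h0
    have := h.right p p le_rfl
    rw [h0] at this
    simp at this
  have hpos := hB.dotProduct_mulVec_pos hy
  rw [star_trivial, Matrix.dotProduct_mulVec] at hpos
  have hrow : Y p ᵥ* B = (Y * B) p := rfl
  rw [hrow, dotProduct] at hpos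
  rw [Finset.sum_eq_single p] at hpos
  · rwa [h.right p p le_rfl, if_pos rfl, mul_one] at hpos
  · intro g _ hg
    rcases lt_or_ge (g : ℕ) p with hlt | hge
    · rw [h.left p g hlt, if_neg hg.symm, zero_mul]
    · rw [h.right p g hge, if_neg hg.symm, mul_zero]
  · intro hp; exact absurd (Finset.mem_univ p) hp

/-- The row operations of one elimination step. -/
def pivotMatrix (Y B : Matrix (Fin k) (Fin k) ℝ) (p : Fin k) : Matrix (Fin k) (Fin k) ℝ :=
  Matrix.of fun a b => if a = p then Y p b / (Y * B) p p
    else Y a b - (Y * B) a p * (Y p b / (Y * B) p p)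

/-- The step acts by the same row operations on every product `Y * C`, so the program can transform
`C` and the identity side by side. -/
theorem pivotMatrix_mul {m : Type*} (Y B : Matrix (Fin k) (Fin k) ℝ) (p : Fin k)
    (C : Matrix (Fin k) m ℝ) (a : Fin k) (j : m) :
    (pivotMatrix Y B p * C) a j = if a = p then (Y * C) p j / (Y * B) p p
      else (Y * C) a j - (Y * B) a p * ((Y * C) p j / (Y * B) p p) := by
  rw [Matrix.mul_apply]
  simp only [pivotMatrix, Matrix.of_apply]
  by_cases ha : a = p
  · simp only [if_pos ha, div_mul_eq_mul_div, ← Finset.sum_div]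
    rfl
  · simp only [if_neg ha, sub_mul, Finset.sum_sub_distrib, mul_assoc, ← Finset.mul_sum,
      div_mul_eq_mul_div, ← Finset.sum_div]
    rfl

theorem IsSweep.pivot {B Y : Matrix (Fin k) (Fin k) ℝ} {p : Fin k} (h : IsSweep B Y p)
    (hB : B.PosDef) : IsSweep B (pivotMatrix Y B p) (p + 1) := by
  have hp := (h.pivot_pos hB).ne'
  constructor
  · intro a g hg
    rw [pivotMatrix_mul]
    by_cases hgp : g = p
    · subst hgp
      by_cases ha : a = g
      · simp [ha, div_self hp]
      · simp [ha, div_self hp]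
    · have hlt : (g : ℕ) < p := by
        have : (g : ℕ) ≠ p := fun h => hgp (Fin.ext h)
        omega
      have hpg : p ≠ g := fun h => hgp h.symm
      rw [h.left p g hlt, h.left a g hlt, if_neg hpg]
      by_cases ha : a = p
      · subst ha; simp [hpg]
      · simp [ha]
  · intro a b hb
    have hpb : p ≠ b := by rintro rfl; omega
    rw [pivotMatrix, Matrix.of_apply, h.right p b (by omega), h.right a b (by omega), if_neg hpb]
    by_cases ha : a = p
    · subst ha; simp [hpb]
    · simp [ha]

end Sweep

/-- Fills real array 3 with the rows of `S` for the feedback vertices, followed by an identity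
matrix. The matrix `S` is read from real array `src`. -/
def initSweep (src : ℕ) : Cmd :=
  forLoop 7 (.var 1) (forLoop 6 (.add (.var 0) (.var 1))
    (.branch (.ilt (.var 6) (.var 0))
      (.rput 3 (.var 7) (.var 6) (.get src (.get 3 (.var 7) (.lit 0)) (.var 6)))
      (.branch (.ieq (.var 6) (.add (.var 0) (.var 7)))
        (.rput 3 (.var 7) (.var 6) (.lit 1)) (.rput 3 (.var 7) (.var 6) (.lit 0)))))

/-- The elimination of one row. -/
def eliminateRow : Cmd :=
  .seq (.branch (.ieq (.var 7) (.var 5)) (.rset 2 (.lit 0))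
      (.rset 2 (.get 3 (.var 7) (.get 3 (.var 5) (.lit 0))))) <|
    forLoop 6 (.add (.var 0) (.var 1))
      (.rput 3 (.var 7) (.var 6)
        (.sub (.get 3 (.var 7) (.var 6)) (.mul (.var 2) (.get 3 (.var 5) (.var 6)))))

/-- One step of Gauss-Jordan elimination on real array 3. -/
def pivotStep : Cmd :=
  .seq (.rset 1 (.get 3 (.var 5) (.get 3 (.var 5) (.lit 0)))) <|
  .seq (forLoop 6 (.add (.var 0) (.var 1))
    (.rput 3 (.var 5) (.var 6) (.div (.get 3 (.var 5) (.var 6)) (.var 1)))) <|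
  forLoop 7 (.var 1) eliminateRow

/-- Gauss-Jordan elimination. -/
def sweep (src : ℕ) : Cmd :=
  .seq (initSweep src) (forLoop 5 (.var 1) pivotStep)

/-- Real array 3 holds `Y * C` and `Y`. -/
def Mem.HoldsRows (σ : Mem) {n k : ℕ} (C : Matrix (Fin k) (Fin n) ℝ)
    (Y : Matrix (Fin k) (Fin k) ℝ) : Prop :=
  ∀ a : Fin k, (∀ j : Fin n, σ.ra 3 a j = (Y * C) a j) ∧ ∀ b : Fin k, σ.ra 3 a (n + b) = Y a b

theorem run_initSweep {src n : ℕ} (hsrc : src ≠ 3) {F : Finset (Fin n)} {σ : Mem}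
    {S : Matrix (Fin n) (Fin n) ℝ} {e : Fin F.card ≃ {i // i ∈ F}} (h : σ.HoldsFVS F)
    (hS : σ.HoldsMatrix src S) (he : σ.HoldsList e) :
    Run (initSweep src) σ (100 * (F.card + 1) * (n + 1)) fun σ' =>
      σ'.HoldsRows (S.submatrix (fun a => ((e a : Fin n))) id) 1 := by
  have hk : F.card ≤ n := by simpa using Finset.card_le_univ F
  refine (Run.fillRect (A := 3) (N := F.card) (M := n + F.card) (B := 26)
      (fun a j => if j < n then σ.ra src (σ.ia 3 a 0) j else if j = n + a then 1 else 0)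
      (of_decide_eq_true rfl) (of_decide_eq_true rfl)
      (fun σ' hf => ?_) (fun σ' hf => ?_) ?_ ?_).mono le_rfl ?_
  · exact (hf.iv 1 (of_decide_eq_true rfl)).trans h.2.1
  · have h0 := (hf.iv 0 (of_decide_eq_true rfl)).trans h.1
    have h1 := (hf.iv 1 (of_decide_eq_true rfl)).trans h.2.1
    simp only [IExp.eval, h0, h1]
  · intro i hi j hj σ' hf hxi hyj hI
    refine Run.straight rfl (by simp [Cmd.maxCost, IExp.cost, RExp.cost, BExp.cost]) ?_
    intro a b
    have h1 : σ'.ra src = σ.ra src := hf.ra src (by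
      simp only [forLoop, Cmd.writes]; simp [hsrc])
    have h2 : σ'.ia 3 = σ.ia 3 := hf.ia 3 (of_decide_eq_true rfl)
    have h0 := (hf.iv 0 (of_decide_eq_true rfl)).trans h.1
    by_cases hjn : j < n
    · simp [Cmd.step, BExp.Holds, IExp.eval, RExp.eval, updateCell_same, hxi, hyj, h1, h2, h0, hjn]
    · by_cases hji : j = n + i
      · simp [Cmd.step, BExp.Holds, IExp.eval, RExp.eval, updateCell_same, hxi, hyj, h0, hji]
      · simp [Cmd.step, BExp.Holds, IExp.eval, RExp.eval, updateCell_same, hxi, hyj, h0, hjn, hji]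
  · simp only [IExp.cost]; nlinarith
  · intro σ' _ hg a
    refine ⟨fun j => ?_, fun b => ?_⟩
    · rw [hg, if_pos ⟨a.2, by omega⟩, if_pos j.2, he a, hS, Matrix.one_mul]
      rfl
    · rw [hg, if_pos ⟨a.2, by omega⟩, if_neg (by omega), Matrix.one_apply]
      by_cases hab : a = b
      · simp [hab]
      · have : ¬ (n + (b : ℕ) = n + a) := fun h => hab (Fin.ext (by omega))
        rw [if_neg this, if_neg hab]

/-- The pivot row receives the factor zero and is thereby left alone. The factor is saved first
because the loop overwrites the entry it comes from. -/
theorem run_eliminateRow {σ : Mem} {n k p f a : ℕ} (h0 : σ.iv 0 = n) (h1 : σ.iv 1 = k)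
    (h5 : σ.iv 5 = p) (h7 : σ.iv 7 = a) (hf : σ.ia 3 p 0 = f) :
    Run eliminateRow σ (19 + (n + k + 1) * 25) fun σ' => ∀ a' t, σ'.ra 3 a' t =
      if a' = a ∧ t < n + k ∧ a ≠ p then σ.ra 3 a t - σ.ra 3 a f * σ.ra 3 p t
        else σ.ra 3 a' t := by
  refine Run.seq (T₁ := 19) (T₂ := (n + k + 1) * 25)
    (P := fun σ' => σ'.rv 2 = if a = p then 0 else σ.ra 3 a f)
    (Run.straight rfl (by decide) ?_) ?_ le_rfl
  · by_cases hap : a = p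
    · simp [Cmd.step, BExp.Holds, IExp.eval, RExp.eval, h5, h7, hap]
    · simp [Cmd.step, BExp.Holds, IExp.eval, RExp.eval, h5, h7, hap, hf]
  · intro σ₁ hf₁ h2
    have e0 : σ₁.iv 0 = n := (hf₁.iv 0 (by decide)).trans h0
    have e1 : σ₁.iv 1 = k := (hf₁.iv 1 (by decide)).trans h1
    have e5 : σ₁.iv 5 = p := (hf₁.iv 5 (by decide)).trans h5
    have e7 : σ₁.iv 7 = a := (hf₁.iv 7 (by decide)).trans h7
    have er : σ₁.ra 3 = σ.ra 3 := hf₁.ra 3 (by decide)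
    refine (Run.fillRow (A := 3) (r := a) (N := n + k) (B := 15)
      (fun t => σ.ra 3 a t - (if a = p then 0 else σ.ra 3 a f) * σ.ra 3 p t)
      (by decide) ?_ ?_ (by simp only [IExp.cost]; omega)).mono le_rfl ?_
    · intro σ' hf'
      simp only [IExp.eval, (hf'.iv 0 (by decide)).trans e0, (hf'.iv 1 (by decide)).trans e1]
    · intro t ht σ' hf' h6 hI
      refine Run.straight rfl (by decide) ?_
      intro a' t'
      have e5' : σ'.iv 5 = p := (hf'.iv 5 (by decide)).trans e5
      have e7' : σ'.iv 7 = a := (hf'.iv 7 (by decide)).trans e7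
      have e2' : σ'.rv 2 = _ := (hf'.rv 2 (by decide)).trans h2
      have r1 : σ'.ra 3 a t = σ.ra 3 a t := by rw [hI]; simp [er]
      have r2 : σ'.ra 3 p t = σ.ra 3 p t := by rw [hI]; simp [er]
      simp only [Cmd.step, IExp.eval, RExp.eval, updateCell_same, e5', e7', e2', h6, r1, r2]
    · intro σ' _ h a' t
      rw [h, er]
      by_cases ha : a' = a
      · subst ha
        by_cases hap : a' = p
        · simp [hap]
        · simp [hap]
      · simp [ha]

/-- The pivot is saved before its row is divided by it. All other rows are then reduced with the
normalized row. -/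
theorem run_pivotStep {σ : Mem} {n k p f : ℕ} (h0 : σ.iv 0 = n) (h1 : σ.iv 1 = k)
    (h5 : σ.iv 5 = p) (hf : σ.ia 3 p 0 = f) :
    Run pivotStep σ (100 * (k + 1) * (n + k + 1)) fun σ' => ∀ a < k, ∀ t < n + k,
      σ'.ra 3 a t = if a = p then σ.ra 3 p t / σ.ra 3 p f
        else σ.ra 3 a t - σ.ra 3 a f * (σ.ra 3 p t / σ.ra 3 p f) := by
  refine Run.seq (T₁ := 6) (T₂ := (n + k + 1) * 21 + (k + 1) * ((n + k + 1) * 25 + 27))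
    (P := fun σ' => σ'.rv 1 = σ.ra 3 p f)
    (Run.straight rfl (by decide) ?_) ?_ ?_
  · simp [Cmd.step, IExp.eval, RExp.eval, h5, hf]
  · intro σ₁ hf₁ h2
    have e0 : σ₁.iv 0 = n := (hf₁.iv 0 (by decide)).trans h0
    have e1 : σ₁.iv 1 = k := (hf₁.iv 1 (by decide)).trans h1
    have e5 : σ₁.iv 5 = p := (hf₁.iv 5 (by decide)).trans h5
    have er : σ₁.ra 3 = σ.ra 3 := hf₁.ra 3 (by decide)
    have ei : σ₁.ia 3 = σ.ia 3 := hf₁.ia 3 (by decide)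
    refine Run.seq (Run.fillRow (A := 3) (r := p) (N := n + k) (B := 11)
      (fun t => σ.ra 3 p t / σ.ra 3 p f) (by decide) ?_ ?_ le_rfl)
      (T₂ := (k + 1) * ((n + k + 1) * 25 + 27)) ?_ (by simp only [IExp.cost]; omega)
    · intro σ' hf'
      simp only [IExp.eval, (hf'.iv 0 (by decide)).trans e0, (hf'.iv 1 (by decide)).trans e1]
    · intro t ht σ' hf' h6 hI
      refine Run.straight rfl (by decide) ?_
      intro a' t'
      have e5' : σ'.iv 5 = p := (hf'.iv 5 (by decide)).trans e5
      have e1' : σ'.rv 1 = _ := (hf'.rv 1 (by decide)).trans h2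
      have r1 : σ'.ra 3 p t = σ.ra 3 p t := by rw [hI]; simp [er]
      simp only [Cmd.step, IExp.eval, RExp.eval, updateCell_same, e5', e1', h6, r1]
    · intro σ₂ hf₂ hr₂
      have e0' : σ₂.iv 0 = n := (hf₂.iv 0 (by decide)).trans e0
      have e1' : σ₂.iv 1 = k := (hf₂.iv 1 (by decide)).trans e1
      have e5' : σ₂.iv 5 = p := (hf₂.iv 5 (by decide)).trans e5
      have ei' : σ₂.ia 3 = σ.ia 3 := (hf₂.ia 3 (by decide)).trans ei
      rw [er] at hr₂
      refine (Run.forLoop (N := k) (B := 19 + (n + k + 1) * 25) (fun i σ' => ∀ a t, σ'.ra 3 a t =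
        if a < i ∧ t < n + k ∧ a ≠ p then
          σ.ra 3 a t - σ.ra 3 a f * (σ.ra 3 p t / σ.ra 3 p f) else σ₂.ra 3 a t)
        (by decide) ?_ ?_ (fun _ _ _ h => h) ?_ ?_).mono le_rfl ?_
      · intro σ' hf'
        exact (hf'.iv 1 (by decide)).trans e1'
      · intro a t; simp
      · intro i hi σ' hf' h7 hI
        refine (run_eliminateRow ((hf'.iv 0 (by decide)).trans e0')
          ((hf'.iv 1 (by decide)).trans e1') ((hf'.iv 5 (by decide)).trans e5') h7
          (f := f) ?_).mono le_rfl ?_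
        · rw [hf'.ia 3 (by decide), ei', hf]
        · intro σ'' _ h a t
          rw [h]
          have hpt : ∀ t, t < n + k → σ'.ra 3 p t = σ.ra 3 p t / σ.ra 3 p f := fun t ht => by
            rw [hI, hr₂]; simp [ht]
          have hit : i ≠ p → ∀ t, σ'.ra 3 i t = σ.ra 3 i t := fun hip t => by
            rw [hI, hr₂]; simp [hip]
          by_cases hc : a = i ∧ t < n + k ∧ i ≠ p
          · obtain ⟨rfl, ht, hip⟩ := hc
            rw [if_pos ⟨rfl, ht, hip⟩, if_pos ⟨by omega, ht, hip⟩, hit hip, hit hip, hpt t ht]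
          · rw [if_neg hc, hI]
            by_cases ha : a = i
            · subst ha
              have hc' : ¬ (t < n + k ∧ a ≠ p) := fun h => hc ⟨rfl, h⟩
              simp [hc']
            · have : a < i + 1 ↔ a < i := by omega
              simp [this]
      · simp only [IExp.cost]; ring_nf; omega
      · intro σ' _ h a ha t ht
        rw [h, hr₂]
        by_cases hap : a = p
        · simp [hap, ht]
        · simp [hap, ht, ha]
  · have : (k + 1) * ((n + k + 1) * 25 + 27) = 25 * ((k + 1) * (n + k + 1)) + 27 * (k + 1) := by
      ring
    rw [this]
    nlinarith [Nat.zero_le (k * (n + k + 1)), Nat.zero_le n, Nat.zero_le k]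

/-- The invariant is that the array holds `Y * C` and `Y` for some `Y` with `IsSweep B Y p`; after
all pivots `Y` is the inverse of `B`. Each of the k pivots updates k rows of length n + k, and k ≤
n. -/
theorem run_sweep {src n : ℕ} (hsrc : src ≠ 3) {F : Finset (Fin n)} {σ : Mem}
    {S : Matrix (Fin n) (Fin n) ℝ} (hpos : S.PosDef) {e : Fin F.card ≃ {i // i ∈ F}}
    (h : σ.HoldsFVS F) (hS : σ.HoldsMatrix src S) (he : σ.HoldsList e) :
    Run (sweep src) σ (600 * (F.card + 1) ^ 2 * (n + 1)) fun σ' =>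
      σ'.HoldsRows (S.submatrix (fun a => ((e a : Fin n))) id)
        (S.submatrix (fun a => ((e a : Fin n))) fun a => ((e a : Fin n)))⁻¹ := by
  have hk : F.card ≤ n := by simpa using Finset.card_le_univ F
  set φ : Fin F.card → Fin n := fun a => (e a : Fin n) with hφ
  have hφinj : Function.Injective φ := fun a b hab => e.injective (Subtype.ext hab)
  set C := S.submatrix φ id with hC
  set B := S.submatrix φ φ with hBdef
  have hB : B.PosDef := hpos.submatrix hφinj
  -- The columns of `B` occur among those of `C`, so the entries of `Y * B` used for pivoting are
  -- already in the array.
  have hBC : ∀ (Y : Matrix (Fin F.card) (Fin F.card) ℝ) a b, (Y * B) a b = (Y * C) a (φ b) :=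
    fun Y a b => rfl
  refine Run.seq (T₂ := (F.card + 1) * (100 * (F.card + 1) * (n + F.card + 1) + 8))
    (run_initSweep hsrc h hS he) ?_ ?_
  · intro σ₁ hf₁ h₁
    have e0 : σ₁.iv 0 = n := (hf₁.iv 0 (of_decide_eq_true rfl)).trans h.1
    have e1 : σ₁.iv 1 = F.card := (hf₁.iv 1 (of_decide_eq_true rfl)).trans h.2.1
    have ei : σ₁.ia 3 = σ.ia 3 := hf₁.ia 3 (of_decide_eq_true rfl)
    refine (Run.forLoop (N := F.card) (B := 100 * (F.card + 1) * (n + F.card + 1))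
      (fun p σ' => ∃ Y, IsSweep B Y p ∧ σ'.HoldsRows C Y)
      (by decide) ?_ ?_ (fun _ _ _ h => h) ?_ ?_).mono le_rfl ?_
    · intro σ' hf'
      exact (hf'.iv 1 (by decide)).trans e1
    · exact ⟨1, IsSweep.one B, h₁⟩
    · rintro p hp σ' hf' h5 ⟨Y, hY, hr⟩
      have hfl : σ'.ia 3 p 0 = (φ ⟨p, hp⟩ : ℕ) := by
        rw [hf'.ia 3 (by decide), ei]
        exact he ⟨p, hp⟩
      refine (run_pivotStep ((hf'.iv 0 (by decide)).trans e0)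
        ((hf'.iv 1 (by decide)).trans e1) h5 hfl).mono le_rfl ?_
      intro σ'' _ hg
      have hap : ∀ a : Fin F.card, (a : ℕ) = p ↔ a = ⟨p, hp⟩ := fun a => by rw [Fin.ext_iff]
      have hpf := (hr ⟨p, hp⟩).1 (φ ⟨p, hp⟩)
      refine ⟨pivotMatrix Y B ⟨p, hp⟩, IsSweep.pivot (p := ⟨p, hp⟩) hY hB,
        fun a => ⟨fun j => ?_, fun b => ?_⟩⟩
      · have hpj := (hr ⟨p, hp⟩).1 j
        rw [hg a a.2 j (by omega), pivotMatrix_mul, (hr a).1 j, (hr a).1 (φ ⟨p, hp⟩)]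
        simp only at hpj hpf
        rw [hpj, hpf]
        simp only [hap, hBC]
      · have hpj := (hr ⟨p, hp⟩).2 b
        rw [hg a a.2 (n + b) (by omega), (hr a).2 b, (hr a).1 (φ ⟨p, hp⟩)]
        simp only at hpj hpf
        rw [hpj, hpf]
        simp only [hap, pivotMatrix, Matrix.of_apply, hBC]
    · simp only [IExp.cost]; exact le_of_eq (by ring)
    · rintro σ' - ⟨Y, hY, hr⟩
      rw [← hY.eq_inv]
      exact hr
  · have h1 : n + F.card + 1 ≤ 2 * (n + 1) := by omega
    calc 100 * (F.card + 1) * (n + 1)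
          + (F.card + 1) * (100 * (F.card + 1) * (n + F.card + 1) + 8)
        ≤ 100 * (F.card + 1) * (n + 1)
          + (F.card + 1) * (100 * (F.card + 1) * (2 * (n + 1)) + 8) := by gcongr
      _ ≤ 600 * (F.card + 1) ^ 2 * (n + 1) := by
          have h2 : F.card + 1 ≤ (F.card + 1) ^ 2 := Nat.le_self_pow two_ne_zero _
          have h3 := Nat.mul_le_mul_right (n + 1) h2
          have h4 : F.card + 1 ≤ (F.card + 1) * (n + 1) := Nat.le_mul_of_pos_right _ (by omega)
          have h5 : (F.card + 1) * (100 * (F.card + 1) * (2 * (n + 1)) + 8) =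
              200 * ((F.card + 1) ^ 2 * (n + 1)) + 8 * (F.card + 1) := by ring
          rw [h5, mul_assoc, mul_assoc]
          generalize (F.card + 1) ^ 2 * (n + 1) = X at *
          generalize (F.card + 1) * (n + 1) = Y at *
          omega

/-! ### Conditional covariances -/

/-- The conditional covariance matrix, extended to all vertices. -/
def residualMatrix {V : Type*} [Fintype V] [DecidableEq V] (F : Finset V) (S : Matrix V V ℝ) :
    Matrix V V ℝ :=
  S - S.submatrix id (Subtype.val : {i // i ∈ F} → V) * (blockF F S)⁻¹ *
    (S.submatrix id (Subtype.val : {i // i ∈ F} → V))ᵀ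

theorem residualMatrix_apply {V : Type*} [Fintype V] [DecidableEq V] (F : Finset V)
    (S : Matrix V V ℝ) (i j : {i // i ∉ F}) :
    residualMatrix F S i j = conditionalCov F S i j :=
  rfl

/-- Computes an entry of the residual matrix from real arrays `src` and 3. -/
def residual (src x y : ℕ) : Cmd :=
  .seq (.rset 0 (.get src (.var x) (.var y))) (forLoop 7 (.var 1)
    (.rset 0 (.sub (.var 0) (.mul (.get src (.var x) (.get 3 (.var 7) (.lit 0)))
      (.get 3 (.var 7) (.var y))))))

theorem inv_submatrix_mul {n : ℕ} {F : Finset (Fin n)} (S : Matrix (Fin n) (Fin n) ℝ)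
    (e : Fin F.card ≃ {i // i ∈ F}) (a : Fin F.card) (j : Fin n) :
    ((S.submatrix (fun a => ((e a : Fin n))) fun a => ((e a : Fin n)))⁻¹ *
      S.submatrix (fun a => ((e a : Fin n))) id) a j =
    ((blockF F S)⁻¹ * S.submatrix (Subtype.val : {i // i ∈ F} → Fin n) id) (e a) j := by
  have hB : (S.submatrix (fun a => ((e a : Fin n))) fun a => ((e a : Fin n)))⁻¹ =
      ((blockF F S)⁻¹).submatrix e e := by
    rw [← Matrix.inv_submatrix_equiv]
    rfl
  rw [hB, Matrix.mul_apply, Matrix.mul_apply, ← e.sum_comp]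
  rfl

/-- With the regression coefficients in array 3, an entry of the conditional covariance is one entry
of `S` minus an inner product of length k. Variable 7 is the loop counter and cannot carry an index.
-/
theorem run_residual {src x y n : ℕ} (hx : x ≠ 7) (hy : y ≠ 7) {F : Finset (Fin n)} {σ : Mem}
    {S : Matrix (Fin n) (Fin n) ℝ} (hpos : S.PosDef) {e : Fin F.card ≃ {i // i ∈ F}}
    (hS : σ.HoldsMatrix src S) (he : σ.HoldsList e) (h1 : σ.iv 1 = F.card)
    (hr : σ.HoldsRows (S.submatrix (fun a => ((e a : Fin n))) id)
        (S.submatrix (fun a => ((e a : Fin n))) fun a => ((e a : Fin n)))⁻¹)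
    {i j : Fin n} (hi : σ.iv x = i) (hj : σ.iv y = j) :
    Run (residual src x y) σ (30 * (F.card + 1)) fun σ' =>
      σ'.rv 0 = residualMatrix F S i j := by
  set g : ℕ → ℝ := fun a => σ.ra src i (σ.ia 3 a 0) * σ.ra 3 a j with hg
  have hval : residualMatrix F S i j = S i j - ∑ a ∈ Finset.range F.card, g a := by
    rw [residualMatrix, Matrix.sub_apply, Matrix.mul_assoc, Matrix.mul_apply, ← e.sum_comp,
      Finset.sum_range]
    congr 1
    refine Finset.sum_congr rfl fun a _ => ?_
    rw [hg]
    simp only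
    rw [(hr a).1 j, inv_submatrix_mul, he a, hS]
    have hT : (S.submatrix id (Subtype.val : {i // i ∈ F} → Fin n))ᵀ =
        S.submatrix Subtype.val id := by
      ext b c
      exact PosDef.apply_comm hpos _ _
    rw [hT]
    rfl
  rw [hval]
  refine Run.seq (T₁ := 4) (T₂ := (F.card + 1) * 20) (P := fun σ' => σ'.rv 0 = S i j)
    (Run.straight rfl (by simp [Cmd.maxCost, RExp.cost, IExp.cost]) ?_) ?_ (by omega)
  · simp [Cmd.step, RExp.eval, IExp.eval, hi, hj, hS i j]
  · intro σ₁ hf₁ h₁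
    have hw : ∀ z, (0, z) ∉ (Cmd.rset 0 (.get src (.var x) (.var y))).writes := by
      simp [Cmd.writes]
    refine (Run.forLoop (N := F.card) (B := 12)
      (fun m σ' => σ'.rv 0 = S i j - ∑ a ∈ Finset.range m, g a)
      (of_decide_eq_true rfl) ?_ ?_ (fun _ _ _ h => h) ?_ ?_).mono le_rfl (fun _ _ h => h)
    · intro σ' hf'
      exact ((hf'.iv 1 (of_decide_eq_true rfl)).trans (hf₁.iv 1 (hw 1))).trans h1
    · simpa using h₁
    · intro m hm σ' hf' h7 hI
      refine Run.straight rfl (by simp [Cmd.maxCost, RExp.cost, IExp.cost]) ?_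
      have ex : σ'.iv x = i := by
        rw [hf'.iv x (by simp [forLoop, Cmd.writes, hx]), hf₁.iv x (hw x), hi]
      have ey : σ'.iv y = j := by
        rw [hf'.iv y (by simp [forLoop, Cmd.writes, hy]), hf₁.iv y (hw y), hj]
      have er : ∀ z, σ'.ra z = σ.ra z := fun z => by
        rw [hf'.ra z (by simp [forLoop, Cmd.writes]), hf₁.ra z (by simp [Cmd.writes])]
      have ei : σ'.ia 3 = σ.ia 3 := by
        rw [hf'.ia 3 (of_decide_eq_true rfl), hf₁.ia 3 (of_decide_eq_true rfl)]
      simp only [Cmd.step, RExp.eval, IExp.eval, Function.update_self, hI, ex, ey, er, ei, h7,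
        Finset.sum_range_succ, hg]
      ring
    · simp [IExp.cost]

/-! ### Prim's algorithm -/

/-- The state of Prim's algorithm with `c` vertices in the tree: `D v` is the position of `v` in
the order of insertion (zero for the vertices that are not yet in the tree), `B v` is the best
neighbour of `v` in the tree. -/
structure IsPrimState {V : Type*} (w : V → V → ℝ) (c : ℕ) (D : V → ℕ) (B : V → V) : Prop where
  le : ∀ v, D v ≤ c
  inj : ∀ u v, 0 < D u → D u = D v → u = v
  surj : ∀ r, 1 ≤ r → r ≤ c → ∃ v, D v = r
  par_pos : ∀ v, D v ≠ 1 → 1 ≤ D (B v)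
  par_lt : ∀ v, 2 ≤ D v → D (B v) < D v
  best : ∀ v, D v = 0 → ∀ u, 1 ≤ D u → w v u ≤ w v (B v)
  cut : ∀ v, 2 ≤ D v → ∀ u x, 1 ≤ D u → D u < D v → (D x = 0 ∨ D v ≤ D x) → w x u ≤ w v (B v)

open Classical in
theorem IsPrimState.init {V : Type*} (w : V → V → ℝ) (r : V) :
    IsPrimState w 1 (fun v => if v = r then 1 else 0) fun _ => r := by
  refine ⟨fun v => ?_, fun u v hu huv => ?_, fun i hi hi' => ⟨r, ?_⟩, fun v _ => ?_, fun v hv => ?_,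
    fun v _ u hu => ?_, fun v hv => ?_⟩
  · split_ifs <;> omega
  · by_cases h : u = r
    · by_cases h' : v = r
      · rw [h, h']
      · simp [h, h'] at huv
    · simp [h] at hu
  · rw [if_pos rfl]; omega
  · simp
  · split_ifs at hv <;> omega
  · have : u = r := by
      by_contra h
      simp [h] at hu
    rw [this]
  · split_ifs at hv <;> omega

open Classical in
/-- The insertion of a vertex. -/
def primRank {V : Type*} (c : ℕ) (D : V → ℕ) (s : V) (v : V) : ℕ :=
  if v = s then c + 1 else D v

open Classical in
/-- The best neighbours after the insertion of a vertex. -/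
def primBest {V : Type*} (w : V → V → ℝ) (c : ℕ) (D : V → ℕ) (B : V → V) (s : V) (v : V) : V :=
  if primRank c D s v = 0 ∧ w v (B v) < w v s then s else B v

/-- For the new vertex `s`, an edge from the tree to a vertex outside weighs at most the best edge
of that outside vertex, hence at most the best edge of `s`. This gives the new cut condition. Best
neighbours change only for vertices still outside, so recorded parents stay fixed. -/
theorem IsPrimState.insert {V : Type*} {w : V → V → ℝ} {c : ℕ} {D : V → ℕ} {B : V → V}
    (h : IsPrimState w c D B) {s : V} (hs : D s = 0)
    (hmax : ∀ x, D x = 0 → w x (B x) ≤ w s (B s)) :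
    IsPrimState w (c + 1) (primRank c D s) (primBest w c D B s) := by
  have hself : primRank c D s s = c + 1 := if_pos rfl
  have hne : ∀ v, v ≠ s → primRank c D s v = D v := fun v hv => if_neg hv
  have hBdone : ∀ v, primRank c D s v ≠ 0 → primBest w c D B s v = B v :=
    fun v hv => if_neg fun h => hv h.1
  have hdone : ∀ v, 1 ≤ D v → primRank c D s v = D v :=
    fun v hv => hne v (by rintro rfl; omega)
  refine ⟨fun v => ?_, fun u v hu huv => ?_, fun r hr hr' => ?_, fun v hv => ?_, fun v hv => ?_,
    fun v hv u hu => ?_, fun v hv u x hu huv hx => ?_⟩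
  · by_cases hv : v = s
    · rw [hv, hself]
    · rw [hne v hv]; exact (h.le v).trans (Nat.le_succ c)
  · by_cases hus : u = s
    · by_cases hvs : v = s
      · rw [hus, hvs]
      · rw [hus, hself, hne v hvs] at huv
        have := h.le v
        omega
    · by_cases hvs : v = s
      · rw [hvs, hself, hne u hus] at huv
        have := h.le u
        omega
      · rw [hne u hus] at hu huv
        rw [hne v hvs] at huv
        exact h.inj u v hu huv
  · rcases Nat.lt_or_ge c r with hc | hc
    · exact ⟨s, by rw [hself]; omega⟩
    · obtain ⟨v, hv⟩ := h.surj r hr hc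
      exact ⟨v, by rw [hdone v (by omega), hv]⟩
  · by_cases hc : primRank c D s v = 0 ∧ w v (B v) < w v s
    · rw [primBest, if_pos hc, hself]; omega
    · rw [primBest, if_neg hc]
      have : 1 ≤ D (B v) := by
        by_cases hvs : v = s
        · subst hvs; exact h.par_pos v (by omega)
        · rw [hne v hvs] at hv; exact h.par_pos v hv
      rwa [hdone _ this]
  · rw [hBdone v (by omega)]
    by_cases hvs : v = s
    · rw [hvs, hself]
      have := h.par_pos s (by omega)
      rw [hdone _ this]
      have := h.le (B s)
      omega
    · rw [hne v hvs] at hv ⊢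
      rw [hdone _ (h.par_pos v (by omega))]
      exact h.par_lt v hv
  · have hvs : v ≠ s := by rintro rfl; omega
    have hv0 : D v = 0 := by rwa [hne v hvs] at hv
    by_cases hc : w v (B v) < w v s
    · rw [primBest, if_pos ⟨hv, hc⟩]
      by_cases hus : u = s
      · rw [hus]
      · rw [hne u hus] at hu
        exact (h.best v hv0 u hu).trans hc.le
    · rw [primBest, if_neg fun h => hc h.2]
      by_cases hus : u = s
      · rw [hus]; exact not_lt.1 hc
      · rw [hne u hus] at hu
        exact h.best v hv0 u hu
  · rw [hBdone v (by omega)]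
    by_cases hvs : v = s
    · subst hvs
      have hus : u ≠ v := by rintro rfl; omega
      rw [hne u hus] at hu
      have hx0 : D x = 0 := by
        by_cases hxs : x = v
        · rw [hxs, hs]
        · rw [hne x hxs, hself] at hx
          have := h.le x
          omega
      exact (h.best x hx0 u hu).trans (hmax x hx0)
    · rw [hne v hvs] at hv huv hx
      have hus : u ≠ s := by
        rintro rfl
        have := h.le v
        omega
      rw [hne u hus] at hu huv
      refine h.cut v hv u x hu huv ?_
      by_cases hxs : x = s
      · rw [hxs]; exact Or.inl hs
      · rwa [hne x hxs] at hx

/-- Pigeonhole: otherwise all vertices would have distinct positions between 1 and `c`. -/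
theorem IsPrimState.exists_rank_eq_zero {V : Type*} [Fintype V] {w : V → V → ℝ} {c : ℕ}
    {D : V → ℕ} {B : V → V} (h : IsPrimState w c D B) (hc : c < Fintype.card V) :
    ∃ v, D v = 0 := by
  by_contra! hne
  have : Fintype.card V ≤ (Finset.Icc 1 c).card := by
    refine Finset.card_le_card_of_injOn D (s := Finset.univ) (fun v _ => ?_) fun u _ v _ huv => ?_
    · exact Finset.mem_coe.2 (Finset.mem_Icc.2 ⟨Nat.pos_of_ne_zero (hne v), h.le v⟩)
    · exact h.inj u v (Nat.pos_of_ne_zero (hne u)) huv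
  simp at this
  omega

theorem IsPrimState.rank_pos {V : Type*} [Fintype V] {w : V → V → ℝ} {D : V → ℕ} {B : V → V}
    (h : IsPrimState w (Fintype.card V) D B) (v : V) : 1 ≤ D v := by
  choose f hf using fun r : Fin (Fintype.card V) => h.surj (r + 1) (by omega) (by omega)
  have hinj : Function.Injective f := fun r s hrs => by
    have := hf r
    rw [hrs, hf s] at this
    exact Fin.ext (by omega)
  have hsurj := ((Fintype.bijective_iff_injective_and_card f).2 ⟨hinj, by simp⟩).2
  obtain ⟨r, rfl⟩ := hsurj v
  rw [hf]; omega

/-- The parents in the final tree. -/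
def primParent {V : Type*} (D : V → ℕ) (B : V → V) (v : V) : Option V :=
  if D v = 1 then none else some (B v)

/-- The final tree. -/
def primTree {V : Type*} (par : V → Option V) : SimpleGraph V where
  Adj u v := u ≠ v ∧ (par u = some v ∨ par v = some u)
  symm := ⟨fun _ _ h => ⟨h.1.symm, h.2.symm⟩⟩
  loopless := ⟨fun _ h => h.1 rfl⟩

theorem primParent_eq_some {V : Type*} {D : V → ℕ} {B : V → V} {v p : V} :
    primParent D B v = some p ↔ D v ≠ 1 ∧ B v = p := by
  rw [primParent]
  split_ifs with h <;> simp [h]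

/-- When all vertices are inserted, the insertion order is a tree order, since the recorded
neighbour was inserted earlier. -/
theorem IsPrimState.treeOrder {V : Type*} [Fintype V] {w : V → V → ℝ} {D : V → ℕ} {B : V → V}
    (h : IsPrimState w (Fintype.card V) D B) :
    TreeOrder (primTree (primParent D B)) D (primParent D B) := by
  have hpos := h.rank_pos
  have hlt : ∀ v p, primParent D B v = some p → D p < D v := by
    intro v p hvp
    obtain ⟨h1, rfl⟩ := primParent_eq_some.1 hvp
    have := hpos v
    exact h.par_lt v (by omega)
  refine ⟨fun u v huv => h.inj u v (hpos u) huv, fun {v p} => hlt v p, ?_, fun {u v} => ?_⟩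
  · intro u v huv
    have := hpos u
    exact ⟨B v, primParent_eq_some.2 ⟨by omega, rfl⟩⟩
  · refine ⟨fun h => h.2, fun h => ⟨?_, h⟩⟩
    rintro rfl
    rcases h with h | h <;> exact lt_irrefl _ (hlt _ _ h)

theorem IsPrimState.isMaxSpanningTree {V : Type*} [Fintype V] {w : V → V → ℝ} {D : V → ℕ}
    {B : V → V} (h : IsPrimState w (Fintype.card V) D B) (hw : ∀ i j, w i j = w j i) :
    IsMaxSpanningTree w (primTree (primParent D B)) := by
  refine h.treeOrder.isMaxSpanningTree hw fun v p hvp u x huv hvx => ?_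
  obtain ⟨h1, rfl⟩ := primParent_eq_some.1 hvp
  have hpos := h.rank_pos
  exact h.cut v (by have := hpos v; omega) u x (hpos u) huv (Or.inr hvx)

/-- The first vertex of the tree is the last vertex outside `F`. -/
def initPrim : Cmd :=
  .seq (.iset 2 (.sub (.sub (.var 0) (.var 1)) (.lit 1))) <|
  .seq (.iset 10 (.lit 0)) <|
  .seq (forLoop 6 (.var 0)
    (.branch (.ieq (.get 0 (.var 6) (.lit 0)) (.lit 1)) .skip (.iset 10 (.var 6)))) <|
  .seq (forLoop 6 (.var 0)
    (.seq (.iput 4 (.var 6) (.lit 0) (.lit 0)) (.iput 5 (.var 6) (.lit 0) (.var 10))))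
  (.iput 4 (.var 10) (.lit 0) (.lit 1))

/-- The weight of the best edge from the vertex in variable `x` to the tree. -/
def bestWeight (x : ℕ) : RExp :=
  .get 6 (.var x) (.get 5 (.var x) (.lit 0))

/-- Selects the vertex that is inserted next. -/
def selectVertex : Cmd :=
  .seq (.iset 9 (.var 0)) (forLoop 6 (.var 0)
    (.branch (.and (.ieq (.get 4 (.var 6) (.lit 0)) (.lit 0))
        (.ieq (.get 0 (.var 6) (.lit 0)) (.lit 0)))
      (.branch (.ilt (.var 9) (.var 0))
        (.branch (.rlt (bestWeight 9) (bestWeight 6)) (.iset 9 (.var 6)) .skip)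
        (.iset 9 (.var 6))) .skip))

/-- Inserts the selected vertex. -/
def insertVertex : Cmd :=
  .seq (.iput 4 (.var 9) (.lit 0) (.add (.var 5) (.lit 2))) <|
  .seq (.iput 1 (.var 5) (.lit 0) (.var 9)) <|
  .seq (.iput 1 (.var 5) (.lit 1) (.get 5 (.var 9) (.lit 0))) <|
  forLoop 6 (.var 0)
    (.branch (.and (.ieq (.get 4 (.var 6) (.lit 0)) (.lit 0))
        (.rlt (bestWeight 6) (.get 6 (.var 6) (.var 9))))
      (.iput 5 (.var 6) (.lit 0) (.var 9)) .skip)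

/-- Prim's algorithm. -/
def prim : Cmd :=
  .seq initPrim (forLoop 5 (.var 2) (.seq selectVertex insertVertex))

section

variable {n : ℕ} {F : Finset (Fin n)}

/-- Natural number arrays 4 and 5 hold `D` and `B`. -/
def Mem.HoldsPrim (σ : Mem) (D : {i // i ∉ F} → ℕ) (B : {i // i ∉ F} → {i // i ∉ F}) : Prop :=
  ∀ v : {i // i ∉ F}, σ.ia 4 (v : Fin n) 0 = D v ∧ σ.ia 5 (v : Fin n) 0 = ((B v : Fin n) : ℕ)

/-- Real array `a` holds a matrix of weights for the vertices outside `F`. -/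
def Mem.HoldsBlock (σ : Mem) (a : ℕ) (w : {i // i ∉ F} → {i // i ∉ F} → ℝ) : Prop :=
  ∀ u v : {i // i ∉ F}, σ.ra a (u : Fin n) (v : Fin n) = w u v

/-- The first `m` rows of natural number array 1 hold the edges to the vertices of rank
`2, …, m + 1`. -/
def Mem.HoldsParents (σ : Mem) (m : ℕ) (D : {i // i ∉ F} → ℕ)
    (B : {i // i ∉ F} → {i // i ∉ F}) : Prop :=
  ∀ r < m, ∃ v : {i // i ∉ F}, D v = r + 2 ∧ σ.ia 1 r 0 = (v : Fin n) ∧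
    σ.ia 1 r 1 = ((B v : Fin n) : ℕ)

theorem card_notMem (F : Finset (Fin n)) : Fintype.card {i // i ∉ F} = n - F.card := by
  rw [Fintype.card_subtype_compl]
  simp

/-- The edge count uses truncated subtraction and is therefore right also when `F` contains every
vertex. Only in that case is there no root, hence the nonemptiness condition. -/
theorem run_initPrim {σ : Mem} (h : σ.HoldsFVS F) (w : {i // i ∉ F} → {i // i ∉ F} → ℝ) :
    Run initPrim σ (60 * (n + 1)) fun σ' => σ'.iv 2 = n - F.card - 1 ∧
      (Nonempty {i // i ∉ F} → ∃ D B, IsPrimState w 1 D B ∧ σ'.HoldsPrim D B) := by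
  classical
  obtain ⟨h0, h1, hF⟩ := h
  refine Run.seq (T₁ := 6) (P := fun σ' => σ'.iv 2 = n - F.card - 1)
    (Run.straight rfl (by decide) ?_) (T₂ := 53 * (n + 1)) ?_ (by omega)
  · simp [Cmd.step, IExp.eval, h0, h1]
  intro σ₁ hf₁ h2
  refine Run.seq (T₁ := 2) (P := fun _ => True)
    (Run.straight rfl (by decide) trivial) (T₂ := 51 * (n + 1)) ?_ (by omega)
  intro σ₂ hf₂ _
  refine Run.seq (T₁ := (n + 1) * 18) (P := fun σ' => Nonempty {i // i ∉ F} →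
    ∃ r : {i // i ∉ F}, σ'.iv 10 = (r : Fin n)) ?_ (T₂ := 33 * (n + 1)) ?_ (by omega)
  · refine (Run.forLoop (N := n) (B := 10) (fun i σ' => (∃ v : {i // i ∉ F}, (v : Fin n) < i) →
      ∃ r : {i // i ∉ F}, σ'.iv 10 = (r : Fin n)) (by decide) ?_ ?_ ?_ ?_
      (by simp only [IExp.cost]; omega)).mono le_rfl ?_
    · intro σ' hf'
      exact (hf'.iv 0 (by decide)).trans ((hf₂.iv 0 (by decide)).trans
        ((hf₁.iv 0 (by decide)).trans h0))
    · rintro ⟨v, hv⟩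
      omega
    · intro i σ' v hI
      simpa using hI
    · intro i hi σ' hf' h6 hI
      refine Run.straight rfl (by decide) ?_
      have hFi : σ'.ia 0 i 0 = if (⟨i, hi⟩ : Fin n) ∈ F then 1 else 0 := by
        rw [hf'.ia 0 (by decide), hf₂.ia 0 (by decide), hf₁.ia 0 (by decide)]
        exact hF ⟨i, hi⟩
      by_cases hiF : (⟨i, hi⟩ : Fin n) ∈ F
      · rintro ⟨v, hv⟩
        have : ((v : Fin n) : ℕ) < i := by
          have : ((v : Fin n) : ℕ) ≠ i := fun h => v.2 (by convert hiF)
          omega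
        obtain ⟨r, hr⟩ := hI ⟨v, this⟩
        exact ⟨r, by simpa [Cmd.step, BExp.Holds, IExp.eval, h6, hFi, hiF] using hr⟩
      · rintro -
        exact ⟨⟨⟨i, hi⟩, hiF⟩, by simp [Cmd.step, BExp.Holds, IExp.eval, h6, hFi, hiF]⟩
    · rintro σ' - hI ⟨v⟩
      exact hI ⟨v, (v : Fin n).2⟩
  intro σ₃ hf₃ h3
  refine Run.seq (T₁ := (n + 1) * 16) (P := fun σ' => ∀ v < n, σ'.ia 4 v 0 = 0 ∧
    σ'.ia 5 v 0 = σ₃.iv 10) ?_ (T₂ := 4) ?_ (by omega)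
  · refine (Run.forLoop (N := n) (B := 8) (fun i σ' => ∀ v < i, σ'.ia 4 v 0 = 0 ∧
      σ'.ia 5 v 0 = σ₃.iv 10) (by decide) ?_ ?_ (fun _ _ _ h => h) ?_
      (by simp only [IExp.cost]; omega)).mono le_rfl (fun _ _ h => h)
    · intro σ' hf'
      exact (hf'.iv 0 (by decide)).trans ((hf₃.iv 0 (by decide)).trans
        ((hf₂.iv 0 (by decide)).trans ((hf₁.iv 0 (by decide)).trans h0)))
    · intro v hv; omega
    · intro i hi σ' hf' h6 hI
      refine Run.straight rfl (by decide) ?_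
      intro v hv
      have e10 : σ'.iv 10 = σ₃.iv 10 := hf'.iv 10 (by decide)
      simp only [Cmd.step, IExp.eval, updateCell_same, h6, e10, and_true,
        updateCell_of_ne _ (show (4 : ℕ) ≠ 5 by decide),
        updateCell_of_ne _ (show (5 : ℕ) ≠ 4 by decide)]
      by_cases hvi : v = i
      · simp [hvi]
      · simpa [hvi] using hI v (by omega)
  intro σ₄ hf₄ h4
  refine Run.straight rfl (by decide) ⟨?_, fun hne => ?_⟩
  · exact ((hf₄.iv 2 (by decide)).trans ((hf₃.iv 2 (by decide)).trans
      (hf₂.iv 2 (by decide)))).trans h2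
  · obtain ⟨r, hr⟩ := h3 hne
    refine ⟨_, _, IsPrimState.init w r, fun v => ?_⟩
    obtain ⟨h5, h6⟩ := h4 (v : Fin n) (v : Fin n).2
    have e10 : σ₄.iv 10 = σ₃.iv 10 := hf₄.iv 10 (by decide)
    simp only [Cmd.step, IExp.eval, updateCell_same, and_true, e10, hr,
        updateCell_of_ne _ (show (5 : ℕ) ≠ 4 by decide), h5, h6]
    simp [Subtype.ext_iff, Fin.ext_iff]

/-- The value `n`, which is no vertex, marks that no candidate has been found yet; by `hex` it does
not survive the loop. -/
theorem run_selectVertex {σ : Mem} (h : σ.HoldsFVS F) {w : {i // i ∉ F} → {i // i ∉ F} → ℝ}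
    (hw : σ.HoldsBlock 6 w) {D : {i // i ∉ F} → ℕ} {B : {i // i ∉ F} → {i // i ∉ F}}
    (hp : σ.HoldsPrim D B) (hex : ∃ v, D v = 0) :
    Run selectVertex σ (70 * (n + 1)) fun σ' => ∃ s : {i // i ∉ F}, σ'.iv 9 = (s : Fin n) ∧
      D s = 0 ∧ ∀ x, D x = 0 → w x (B x) ≤ w s (B s) := by
  obtain ⟨h0, h1, hF⟩ := h
  refine Run.seq (T₁ := 2) (P := fun σ' => σ'.iv 9 = n)
    (Run.straight rfl (by decide) ?_) (T₂ := (n + 1) * 68) ?_ (by omega)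
  · simp [Cmd.step, IExp.eval, h0]
  intro σ₁ hf₁ h9
  refine (Run.forLoop (N := n) (B := 60) (fun i σ' =>
      (σ'.iv 9 = n ∧ ∀ x : {i // i ∉ F}, (x : Fin n) < i → D x ≠ 0) ∨
      ∃ s : {i // i ∉ F}, σ'.iv 9 = (s : Fin n) ∧ D s = 0 ∧
        ∀ x : {i // i ∉ F}, (x : Fin n) < i → D x = 0 → w x (B x) ≤ w s (B s))
      (by decide) ?_ ?_ ?_ ?_ (by simp only [IExp.cost]; omega)).mono le_rfl ?_
  · intro σ' hf'
    exact (hf'.iv 0 (by decide)).trans ((hf₁.iv 0 (by decide)).trans h0)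
  · exact Or.inl ⟨h9, fun x hx => by omega⟩
  · intro i σ' v hI
    simpa using hI
  · intro i hi σ' hf' h6 hI
    refine Run.straight rfl (by decide) ?_
    have ea : ∀ a, σ'.ia a = σ.ia a := fun a => by
      rw [hf'.ia a (by simp [forLoop, Cmd.writes]), hf₁.ia a (by simp [Cmd.writes])]
    have er : ∀ a, σ'.ra a = σ.ra a := fun a => by
      rw [hf'.ra a (by simp [forLoop, Cmd.writes]), hf₁.ra a (by simp [Cmd.writes])]
    have e0 : σ'.iv 0 = n := (hf'.iv 0 (by decide)).trans ((hf₁.iv 0 (by decide)).trans h0)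
    have hFi := hF ⟨i, hi⟩
    simp only at hFi
    by_cases hiF : (⟨i, hi⟩ : Fin n) ∈ F
    · have hlt : ∀ x : {i // i ∉ F}, ((x : Fin n) : ℕ) < i + 1 → ((x : Fin n) : ℕ) < i :=
        fun x hx => by
          have : ((x : Fin n) : ℕ) ≠ i := fun h => x.2 (by convert hiF)
          omega
      have hstep : ∀ c : Cmd, (Cmd.branch (.and (.ieq (.get 4 (.var 6) (.lit 0)) (.lit 0))
        (.ieq (.get 0 (.var 6) (.lit 0)) (.lit 0))) c .skip).step σ' = σ' := by
        intro c
        simp [Cmd.step, BExp.Holds, IExp.eval, h6, ea, hFi, hiF]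
      rw [hstep]
      rcases hI with ⟨h1, h2⟩ | ⟨s, h1, h2, h3⟩
      · exact Or.inl ⟨h1, fun x hx => h2 x (hlt x hx)⟩
      · exact Or.inr ⟨s, h1, h2, fun x hx => h3 x (hlt x hx)⟩
    · obtain ⟨v, hv⟩ : ∃ v : {i // i ∉ F}, v = ⟨⟨i, hi⟩, hiF⟩ := ⟨_, rfl⟩
      have hlt : ∀ x : {i // i ∉ F}, ((x : Fin n) : ℕ) < i + 1 → ((x : Fin n) : ℕ) < i ∨ x = v :=
        fun x hx => by
          by_cases h : ((x : Fin n) : ℕ) = i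
          · exact Or.inr (by rw [hv]; exact Subtype.ext (Fin.ext h))
          · exact Or.inl (by omega)
      have hvi : ((v : Fin n) : ℕ) = i := by rw [hv]
      have hDi : σ.ia 4 i 0 = D v := by rw [← hvi]; exact (hp v).1
      have hBi : σ.ia 5 i 0 = ((B v : Fin n) : ℕ) := by rw [← hvi]; exact (hp v).2
      have hwi : σ.ra 6 i ((B v : Fin n) : ℕ) = w v (B v) := by rw [← hvi]; exact hw v (B v)
      by_cases hD : D v = 0
      · rcases hI with ⟨h1, h2⟩ | ⟨s, h1, h2, h3⟩
        · refine Or.inr ⟨v, ?_, hD, fun x hx hx0 => ?_⟩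
          · simp [Cmd.step, BExp.Holds, IExp.eval, h6, ea, hFi, hiF, hDi, hD, h1, e0, hvi]
          · rcases hlt x hx with hx | rfl
            · exact absurd hx0 (h2 x hx)
            · exact le_rfl
        · have hs := (s : Fin n).2
          have hBs := (hp s).2
          have hws := hw s (B s)
          by_cases hc : w s (B s) < w v (B v)
          · refine Or.inr ⟨v, ?_, hD, fun x hx hx0 => ?_⟩
            · simp [Cmd.step, BExp.Holds, IExp.eval, RExp.eval, bestWeight, h6, ea, er, hFi, hiF,
                hDi, hD, h1, e0, hBs, hBi, hwi, hws, hc, hvi]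
            · rcases hlt x hx with hx | rfl
              · exact (h3 x hx hx0).trans hc.le
              · exact le_rfl
          · refine Or.inr ⟨s, ?_, h2, fun x hx hx0 => ?_⟩
            · simp [Cmd.step, BExp.Holds, IExp.eval, RExp.eval, bestWeight, h6, ea, er, hFi, hiF,
                hDi, hD, h1, e0, hBs, hBi, hwi, hws, hc]
            · rcases hlt x hx with hx | rfl
              · exact h3 x hx hx0
              · exact not_lt.1 hc
      · have hstep : ∀ c : Cmd, (Cmd.branch (.and (.ieq (.get 4 (.var 6) (.lit 0)) (.lit 0))
          (.ieq (.get 0 (.var 6) (.lit 0)) (.lit 0))) c .skip).step σ' = σ' := by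
          intro c
          simp [Cmd.step, BExp.Holds, IExp.eval, h6, ea, hDi, hD]
        rw [hstep]
        rcases hI with ⟨h1, h2⟩ | ⟨s, h1, h2, h3⟩
        · refine Or.inl ⟨h1, fun x hx => ?_⟩
          rcases hlt x hx with hx | rfl
          · exact h2 x hx
          · exact hD
        · refine Or.inr ⟨s, h1, h2, fun x hx hx0 => ?_⟩
          rcases hlt x hx with hx | rfl
          · exact h3 x hx hx0
          · exact absurd hx0 hD
  · rintro σ' - (⟨-, h2⟩ | ⟨s, h1, h2, h3⟩)
    · obtain ⟨v, hv⟩ := hex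
      exact absurd hv (h2 v (v : Fin n).2)
    · exact ⟨s, h1, h2, fun x => h3 x (x : Fin n).2⟩

/-- The root has position 1 and the counter starts at 0, so the vertex inserted in round `r` has
position `r + 2`. The loop may also alter cells for vertices of `F`, about which `Mem.HoldsPrim`
says nothing. -/
theorem run_insertVertex {σ : Mem} (h0 : σ.iv 0 = n) {w : {i // i ∉ F} → {i // i ∉ F} → ℝ}
    (hw : σ.HoldsBlock 6 w) {D : {i // i ∉ F} → ℕ} {B : {i // i ∉ F} → {i // i ∉ F}}
    (hp : σ.HoldsPrim D B) {r : ℕ} (h5 : σ.iv 5 = r) (hr : σ.HoldsParents r D B)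
    {s : {i // i ∉ F}} (h9 : σ.iv 9 = (s : Fin n)) (hs : D s = 0) :
    Run insertVertex σ (60 * (n + 1)) fun σ' =>
      σ'.HoldsPrim (primRank (r + 1) D s) (primBest w (r + 1) D B s) ∧
      σ'.HoldsParents (r + 1) (primRank (r + 1) D s) (primBest w (r + 1) D B s) := by
  have hself : primRank (r + 1) D s s = r + 2 := if_pos rfl
  have hne : ∀ v, v ≠ s → primRank (r + 1) D s v = D v := fun v hv => if_neg hv
  have hBdone : ∀ v, primRank (r + 1) D s v ≠ 0 → primBest w (r + 1) D B s v = B v :=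
    fun v hv => if_neg fun h => hv h.1
  have hval : ∀ u v : {i // i ∉ F}, ((u : Fin n) : ℕ) = (v : Fin n) ↔ u = v := fun u v => by
    rw [Subtype.ext_iff, Fin.ext_iff]
  refine Run.seq (T₁ := 6) (P := fun σ' => ∀ v : {i // i ∉ F},
    σ'.ia 4 (v : Fin n) 0 = primRank (r + 1) D s v) (Run.straight rfl (by decide) ?_)
    (T₂ := 12 + (n + 1) * 41) ?_ (by omega)
  · intro v
    simp only [Cmd.step, IExp.eval, updateCell_same, h9, h5, and_true, (hp v).1, hval, primRank]
    split_ifs <;> rfl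
  intro σ₁ hf₁ h4
  refine Run.seq (T₁ := 4) (P := fun σ' => σ'.ia 1 = updateCell σ.ia 1 r 0 (s : Fin n) 1)
    (Run.straight rfl (by decide) ?_) (T₂ := 7 + (n + 1) * 41) ?_ (by omega)
  · simp only [Cmd.step, IExp.eval, (hf₁.iv 5 (by decide)).trans h5,
      (hf₁.iv 9 (by decide)).trans h9]
    funext a b
    simp only [updateCell_same, hf₁.ia 1 (by decide)]
  intro σ₂ hf₂ h1
  refine Run.seq (T₁ := 7) (P := fun σ' => σ'.HoldsParents (r + 1) (primRank (r + 1) D s)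
    (primBest w (r + 1) D B s))
    (Run.straight rfl (by decide) ?_) (T₂ := (n + 1) * 41) ?_ (by omega)
  · intro i hi
    have e5 : σ₂.iv 5 = r := (hf₂.iv 5 (by decide)).trans ((hf₁.iv 5 (by decide)).trans h5)
    have e9 : σ₂.iv 9 = (s : Fin n) :=
      (hf₂.iv 9 (by decide)).trans ((hf₁.iv 9 (by decide)).trans h9)
    have eB : σ₂.ia 5 (s : Fin n) 0 = ((B s : Fin n) : ℕ) := by
      rw [hf₂.ia 5 (by decide), hf₁.ia 5 (by decide), (hp s).2]
    simp only [Cmd.step, IExp.eval, updateCell_same, e5, e9, eB, h1]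
    by_cases hir : i = r
    · subst hir
      exact ⟨s, by rw [hself], by simp, by rw [hBdone s (by omega)]; simp⟩
    · obtain ⟨v, hv1, hv2, hv3⟩ := hr i (by omega)
      have hvs : v ≠ s := by rintro rfl; omega
      refine ⟨v, by rw [hne v hvs, hv1], by simp [hir, hv2], ?_⟩
      rw [hBdone v (by rw [hne v hvs]; omega)]
      simp [hir, hv3]
  intro σ₃ hf₃ h3
  have e4 : σ₃.ia 4 = σ₁.ia 4 := (hf₃.ia 4 (by decide)).trans (hf₂.ia 4 (by decide))
  have e5 : σ₃.ia 5 = σ.ia 5 := (hf₃.ia 5 (by decide)).trans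
    ((hf₂.ia 5 (by decide)).trans (hf₁.ia 5 (by decide)))
  have e9 : σ₃.iv 9 = (s : Fin n) := (hf₃.iv 9 (by decide)).trans
      ((hf₂.iv 9 (by decide)).trans ((hf₁.iv 9 (by decide)).trans h9))
  refine (Run.forLoop (N := n) (B := 33) (fun i σ' => ∀ v : {i // i ∉ F},
    σ'.ia 5 (v : Fin n) 0 = if ((v : Fin n) : ℕ) < i then
      (((primBest w (r + 1) D B s v : {i // i ∉ F}) : Fin n) : ℕ) else ((B v : Fin n) : ℕ))
    (by decide) ?_ ?_ (fun _ _ _ h => h) ?_ (by simp only [IExp.cost]; omega)).mono le_rfl ?_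
  · intro σ' hf'
    exact (hf'.iv 0 (by decide)).trans ((hf₃.iv 0 (by decide)).trans
      ((hf₂.iv 0 (by decide)).trans ((hf₁.iv 0 (by decide)).trans h0)))
  · intro v
    rw [if_neg (by omega), e5, (hp v).2]
  · intro i hi σ' hf' h6 hI
    refine Run.straight rfl (by decide) ?_
    intro v
    by_cases hvi : ((v : Fin n) : ℕ) = i
    · have d4 : σ'.ia 4 i 0 = primRank (r + 1) D s v := by
        rw [hf'.ia 4 (by decide), e4, ← hvi, h4]
      have d5 : σ'.ia 5 i 0 = ((B v : Fin n) : ℕ) := by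
        rw [← hvi, hI v, if_neg (by omega)]
      have d6 : σ'.ra 6 = σ.ra 6 := by
        rw [hf'.ra 6 (by decide), hf₃.ra 6 (by decide), hf₂.ra 6 (by decide),
          hf₁.ra 6 (by decide)]
      have d9 : σ'.iv 9 = (s : Fin n) := (hf'.iv 9 (by decide)).trans e9
      have w1 : σ.ra 6 i ((B v : Fin n) : ℕ) = w v (B v) := by rw [← hvi]; exact hw _ _
      have w2 : σ.ra 6 i ((s : Fin n) : ℕ) = w v s := by rw [← hvi]; exact hw _ _
      rw [if_pos (by omega), primBest]
      by_cases hc : primRank (r + 1) D s v = 0 ∧ w v (B v) < w v s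
      · rw [if_pos hc]
        simp [Cmd.step, BExp.Holds, IExp.eval, RExp.eval, bestWeight, updateCell_same, h6, d4, d5,
          d6, d9, w1, w2, hc, hvi]
      · rw [if_neg hc]
        simp only [Cmd.step, BExp.Holds, IExp.eval, RExp.eval, bestWeight, h6, d4, d5,
          d6, d9, w1, w2, hc, if_false, hvi]
    · have : ((v : Fin n) : ℕ) < i + 1 ↔ ((v : Fin n) : ℕ) < i := by omega
      simp only [this, ← hI v, Cmd.step]
      split_ifs
      · simp [updateCell_same, IExp.eval, h6, hvi]
      · rfl
  · intro σ' hf' hI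
    refine ⟨fun v => ⟨?_, ?_⟩, fun i hi => ?_⟩
    · rw [hf'.ia 4 (by decide), e4, h4]
    · rw [hI, if_pos (v : Fin n).2]
    · rw [hf'.ia 1 (by decide)]
      exact h3 i hi

/-- Every round scans the vertices a constant number of times. For a complete graph this quadratic
version needs no priority queue. -/
theorem run_prim {σ : Mem} (h : σ.HoldsFVS F) {w : {i // i ∉ F} → {i // i ∉ F} → ℝ}
    (hw : σ.HoldsBlock 6 w) :
    Run prim σ (300 * (n + 1) ^ 2) fun σ' => σ'.iv 2 = n - F.card - 1 ∧
      ∃ D B, IsPrimState w (Fintype.card {i // i ∉ F}) D B ∧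
        σ'.HoldsParents (n - F.card - 1) D B := by
  have hF : ∀ {σ' : Mem}, Frame prim.writes σ σ' → σ'.HoldsFVS F := fun hf =>
    ⟨(hf.iv 0 (by decide)).trans h.1, (hf.iv 1 (by decide)).trans h.2.1, fun i => by
      rw [hf.ia 0 (by decide)]; exact h.2.2 i⟩
  have hw' : ∀ {σ' : Mem}, Frame prim.writes σ σ' → σ'.HoldsBlock 6 w := fun hf u v => by
    rw [hf.ra 6 (by decide)]; exact hw u v
  have hk : F.card ≤ n := by simpa using Finset.card_le_univ F
  refine Run.seq (run_initPrim h w) (T₂ := (n + 1) * (140 * (n + 1))) ?_ ?_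
  · rintro σ₁ hf₁ ⟨h2, h3⟩
    have hf₁' : Frame prim.writes σ σ₁ := hf₁.mono (List.subset_append_left _ _)
    refine (Run.forLoop (N := n - F.card - 1) (B := 130 * (n + 1))
      (fun r σ' => Nonempty {i // i ∉ F} → ∃ D B, IsPrimState w (r + 1) D B ∧
        σ'.HoldsPrim D B ∧ σ'.HoldsParents r D B)
      (by decide) ?_ ?_ (fun _ _ _ h => h) ?_ ?_).mono le_rfl ?_
    · intro σ' hf'
      exact (hf'.iv 2 (by decide)).trans h2
    · intro hne
      obtain ⟨D, B, hD, hp⟩ := h3 hne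
      exact ⟨D, B, hD, hp, fun r hr => by omega⟩
    · intro r hr σ' hf' h5 hI
      have hne : Nonempty {i // i ∉ F} := by
        rw [← Fintype.card_pos_iff, card_notMem]; omega
      obtain ⟨D, B, hD, hp, hpar⟩ := hI hne
      have hfa : Frame prim.writes σ σ' :=
        hf₁'.trans (hf'.mono (List.subset_append_right _ _))
      refine Run.seq (run_selectVertex (hF hfa) (hw' hfa) hp
        (hD.exists_rank_eq_zero (by rw [card_notMem]; omega))) (T₂ := 60 * (n + 1)) ?_ (by omega)
      rintro σ₂ hf₂ ⟨s, h9, hs, hmax⟩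
      refine (run_insertVertex (w := w) ((hf₂.iv 0 (by decide)).trans (hF hfa).1)
        (fun u v => by rw [hf₂.ra 6 (by decide)]; exact hw' hfa u v) (D := D) (B := B)
        (fun v => by rw [hf₂.ia 4 (by decide), hf₂.ia 5 (by decide)]; exact hp v)
        ((hf₂.iv 5 (by decide)).trans h5)
        (fun i hi => by rw [hf₂.ia 1 (by decide)]; exact hpar i hi) h9 hs).mono le_rfl ?_
      rintro σ₃ - ⟨h4, h5⟩ -
      exact ⟨_, _, hD.insert hs hmax, h4, h5⟩
    · simp only [IExp.cost]
      exact Nat.mul_le_mul (by omega) (by omega)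
    · intro σ' hf' hI
      refine ⟨(hf'.iv 2 (by decide)).trans h2, ?_⟩
      -- If `F` contains every vertex, no edges are listed and any state is vacuously correct.
      rcases isEmpty_or_nonempty {i // i ∉ F} with hemp | hne
      · refine ⟨fun _ => 0, fun v => v, ?_, fun r hr => ?_⟩
        · have h0 : Fintype.card {i // i ∉ F} = 0 := Fintype.card_eq_zero
          refine ⟨fun v => hemp.elim v, fun v => hemp.elim v, fun r hr hr' => by omega,
            fun v => hemp.elim v, fun v => hemp.elim v, fun v => hemp.elim v,
            fun v => hemp.elim v⟩
        · have h0 : Fintype.card {i // i ∉ F} = 0 := Fintype.card_eq_zero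
          rw [card_notMem] at h0
          omega
      · obtain ⟨D, B, hD, -, hpar⟩ := hI hne
        refine ⟨D, B, ?_, hpar⟩
        have hpos : 0 < Fintype.card {i // i ∉ F} := Fintype.card_pos
        rw [card_notMem] at hpos ⊢
        rwa [Nat.sub_add_cancel hpos] at hD
  · nlinarith [Nat.zero_le n]

end

/-! ### The learning algorithm -/

/-- Copies the variances from real array 4 to real array 5. -/
def copyDiagonal : Cmd :=
  forLoop 6 (.var 0) (.rput 5 (.var 6) (.var 6) (.get 4 (.var 6) (.var 6)))

/-- Computes the covariances of the vertex that is joined to the tree by an edge of the list. -/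
def extendCov : Cmd :=
  .seq (.iset 9 (.get 1 (.var 5) (.lit 0))) <|
  .seq (.iset 10 (.get 1 (.var 5) (.lit 1))) <|
  .seq (.rset 1 (.div (.get 4 (.var 9) (.var 10)) (.get 4 (.var 10) (.var 10)))) <|
  forLoop 6 (.var 0) (.branch (.ieq (.var 6) (.var 9)) .skip
    (.seq (.rput 5 (.var 9) (.var 6) (.mul (.var 1) (.get 5 (.var 10) (.var 6))))
      (.rput 5 (.var 6) (.var 9) (.get 5 (.var 9) (.var 6)))))

/-- Computes the tree covariance matrix. -/
def treeCovariance : Cmd :=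
  .seq copyDiagonal (forLoop 5 (.var 2) extendCov)

/-- Fills real array 4 with the conditional covariances. -/
def fillConditional : Cmd :=
  forLoop 5 (.var 0) (forLoop 6 (.var 0)
    (.seq (residual 0 5 6) (.rput 4 (.var 5) (.var 6) (.var 0))))

/-- A correlation coefficient for the covariances in real array 4. -/
def correlationExp : RExp :=
  .div (.get 4 (.var 5) (.var 6))
    (.sqrt (.mul (.get 4 (.var 5) (.var 5)) (.get 4 (.var 6) (.var 6))))

/-- The vertices in variables 5 and 6 are outside `F`. -/
def outsideF : BExp :=
  .and (.ieq (.get 0 (.var 5) (.lit 0)) (.lit 0)) (.ieq (.get 0 (.var 6) (.lit 0)) (.lit 0))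

/-- Fills real array 6 with the absolute values of the correlation coefficients. -/
def fillWeights : Cmd :=
  forLoop 5 (.var 0) (forLoop 6 (.var 0) (.branch outsideF
    (.rput 6 (.var 5) (.var 6) (.sqrt (.mul correlationExp correlationExp)))
    (.rput 6 (.var 5) (.var 6) (.lit 0))))

/-- Fills real array 1 with the learned covariance matrix. -/
def fillLearned : Cmd :=
  forLoop 5 (.var 0) (forLoop 6 (.var 0)
    (.branch outsideF
      (.rput 1 (.var 5) (.var 6) (.add (.get 5 (.var 5) (.var 6))
        (.sub (.get 0 (.var 5) (.var 6)) (.get 4 (.var 5) (.var 6)))))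
      (.rput 1 (.var 5) (.var 6) (.get 0 (.var 5) (.var 6)))))

/-- The conditioned Chow-Liu algorithm. -/
def learn : Cmd :=
  .seq listFVS <| .seq (sweep 0) <| .seq fillConditional <| .seq fillWeights <| .seq prim <|
  .seq treeCovariance fillLearned

section

variable {n : ℕ} {F : Finset (Fin n)}

theorem coe_coe_inj (u v : {i // i ∉ F}) : ((u : Fin n) : ℕ) = (v : Fin n) ↔ u = v := by
  rw [Subtype.ext_iff, Fin.ext_iff]

theorem run_copyDiagonal {σ : Mem} (h0 : σ.iv 0 = n) :
    Run copyDiagonal σ ((n + 1) * 14) fun σ' => ∀ v < n, σ'.ra 5 v v = σ.ra 4 v v := by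
  refine Run.forLoop (N := n) (B := 6) (fun i σ' => ∀ v < i, σ'.ra 5 v v = σ.ra 4 v v)
    (by decide) ?_ ?_ (fun _ _ _ h => h) ?_ (by simp only [IExp.cost]; omega)
  · intro σ' hf'
    exact (hf'.iv 0 (by decide)).trans h0
  · intro v hv; omega
  · intro i hi σ' hf' h6 hI
    refine Run.straight rfl (by decide) ?_
    intro v hv
    simp only [Cmd.step, IExp.eval, RExp.eval, updateCell_same, h6, hf'.ra 4 (by decide)]
    by_cases hvi : v = i
    · simp [hvi]
    · simpa [hvi] using hI v (by omega)

theorem run_extendCov {σ : Mem} {r v p : ℕ} (h0 : σ.iv 0 = n) (h5 : σ.iv 5 = r)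
    (hv : σ.ia 1 r 0 = v) (hp : σ.ia 1 r 1 = p) (hvp : p ≠ v) :
    Run extendCov σ (60 * (n + 1)) fun σ' => ∀ a < n, ∀ b < n, σ'.ra 5 a b =
      if a = b then σ.ra 5 a b
      else if a = v then σ.ra 4 v p / σ.ra 4 p p * σ.ra 5 p b
      else if b = v then σ.ra 4 v p / σ.ra 4 p p * σ.ra 5 p a else σ.ra 5 a b := by
  refine Run.seq (T₁ := 4) (P := fun σ' => σ'.iv 9 = v) (Run.straight rfl (by decide) ?_)
    (T₂ := 14 + (n + 1) * 34) ?_ (by omega)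
  · simp [Cmd.step, IExp.eval, h5, hv]
  intro σ₁ hf₁ h9
  refine Run.seq (T₁ := 4) (P := fun σ' => σ'.iv 10 = p) (Run.straight rfl (by decide) ?_)
    (T₂ := 8 + (n + 1) * 34) ?_ (by omega)
  · simp [Cmd.step, IExp.eval, (hf₁.iv 5 (by decide)).trans h5, hf₁.ia 1 (by decide), hp]
  intro σ₂ hf₂ h10
  have e9 : σ₂.iv 9 = v := (hf₂.iv 9 (by decide)).trans h9
  refine Run.seq (T₁ := 8) (P := fun σ' => σ'.rv 1 = σ.ra 4 v p / σ.ra 4 p p)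
    (Run.straight rfl (by decide) ?_) (T₂ := (n + 1) * 34) ?_ (by omega)
  · simp [Cmd.step, IExp.eval, RExp.eval, h10, e9, hf₂.ra 4 (by decide), hf₁.ra 4 (by decide)]
  intro σ₃ hf₃ h1
  have d9 : σ₃.iv 9 = v := (hf₃.iv 9 (by decide)).trans e9
  have d10 : σ₃.iv 10 = p := (hf₃.iv 10 (by decide)).trans h10
  have d5 : σ₃.ra 5 = σ.ra 5 := (hf₃.ra 5 (by decide)).trans
    ((hf₂.ra 5 (by decide)).trans (hf₁.ra 5 (by decide)))
  refine (Run.forLoop (N := n) (B := 26) (fun i σ' => ∀ a b, σ'.ra 5 a b =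
      if a = b then σ.ra 5 a b
      else if a = v ∧ b < i then σ.ra 4 v p / σ.ra 4 p p * σ.ra 5 p b
      else if b = v ∧ a < i then σ.ra 4 v p / σ.ra 4 p p * σ.ra 5 p a else σ.ra 5 a b)
    (by decide) ?_ ?_ (fun _ _ _ h => h) ?_ (by simp only [IExp.cost]; omega)).mono le_rfl ?_
  · intro σ' hf'
    exact (hf'.iv 0 (by decide)).trans ((hf₃.iv 0 (by decide)).trans
      ((hf₂.iv 0 (by decide)).trans ((hf₁.iv 0 (by decide)).trans h0)))
  · intro a b
    simp [d5]
  · intro i hi σ' hf' h6 hI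
    refine Run.straight rfl (by decide) ?_
    have f9 : σ'.iv 9 = v := (hf'.iv 9 (by decide)).trans d9
    have f10 : σ'.iv 10 = p := (hf'.iv 10 (by decide)).trans d10
    have f1 : σ'.rv 1 = _ := (hf'.rv 1 (by decide)).trans h1
    by_cases hiv : i = v
    · intro a b
      simp only [Cmd.step, BExp.Holds, IExp.eval, h6, f9, hiv, if_true]
      rw [hI]
      subst hiv
      by_cases hab : a = b
      · simp [hab]
      · by_cases hai : a = i
        · have : b ≠ i := fun h => hab (hai.trans h.symm)
          have h1 : b < i + 1 ↔ b < i := by omega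
          simp [hai, this, h1]
        · have h1 : a < i + 1 ↔ a < i := by omega
          simp [hai, h1]
    -- Row `p` is still unchanged where it is read: the loop writes only row and column `v`, and `i`
    -- differs from `v`.
    · have hpi : σ'.ra 5 p i = σ.ra 5 p i := by
        rw [hI]; simp [hvp, hiv]
      intro a b
      simp only [Cmd.step, BExp.Holds, IExp.eval, RExp.eval, h6, f9, f10, f1, hiv, if_false,
        updateCell_same, hpi, and_self, if_true]
      rw [hI]
      by_cases hab : a = b
      · have h1 : ¬ (a = i ∧ b = v) := by omega
        have h2 : ¬ (a = v ∧ b = i) := by omega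
        rw [if_neg h1, if_neg h2, if_pos hab, if_pos hab]
      · by_cases h1 : a = i ∧ b = v
        · obtain ⟨rfl, rfl⟩ := h1
          simp [hab]
        · by_cases h2 : a = v ∧ b = i
          · obtain ⟨rfl, rfl⟩ := h2
            simp [hab]
          · have h3 : a = v ∧ b < i + 1 ↔ a = v ∧ b < i := by omega
            have h4 : b = v ∧ a < i + 1 ↔ b = v ∧ a < i := by omega
            simp only [if_neg h1, if_neg h2, if_neg hab, h3, h4]
  · intro σ' _ hI a ha b hb
    rw [hI]
    simp [ha, hb]

/-- This is the recursion of `TreeCov.step`, run in the order of insertion. Entries for vertices not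
yet inserted may be meaningless in between; they are overwritten when the later vertex joins. The
diagonal is correct from the start and never changes. -/
theorem run_treeCovariance {σ : Mem} (h0 : σ.iv 0 = n) (h2 : σ.iv 2 = n - F.card - 1)
    {A P : Matrix {i // i ∉ F} {i // i ∉ F} ℝ} (hA : σ.HoldsBlock 4 A)
    {w : {i // i ∉ F} → {i // i ∉ F} → ℝ} {D : {i // i ∉ F} → ℕ}
    {B : {i // i ∉ F} → {i // i ∉ F}} (hD : IsPrimState w (Fintype.card {i // i ∉ F}) D B)
    (hpar : σ.HoldsParents (n - F.card - 1) D B) (hP : TreeCov D (primParent D B) A P) :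
    Run treeCovariance σ (100 * (n + 1) ^ 2) fun σ' => σ'.HoldsBlock 5 P := by
  refine Run.seq (run_copyDiagonal h0) (T₂ := (n + 1) * (60 * (n + 1) + 8)) ?_ ?_
  · intro σ₁ hf₁ h₁
    refine (Run.forLoop (N := n - F.card - 1) (B := 60 * (n + 1)) (fun r σ' =>
      (∀ u : {i // i ∉ F}, σ'.ra 5 (u : Fin n) (u : Fin n) = P u u) ∧
      ∀ u v : {i // i ∉ F}, D u ≤ r + 1 → D v ≤ r + 1 → σ'.ra 5 (u : Fin n) (v : Fin n) = P u v)
      (by decide) ?_ ?_ (fun _ _ _ h => h) ?_ ?_).mono le_rfl ?_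
    · intro σ' hf'
      exact (hf'.iv 2 (by decide)).trans ((hf₁.iv 2 (by decide)).trans h2)
    · have hdiag : ∀ u : {i // i ∉ F}, σ₁.ra 5 (u : Fin n) (u : Fin n) = P u u := fun u => by
        rw [h₁ _ (u : Fin n).2, hA u u, hP.diag]
      refine ⟨hdiag, fun u v hu hv => ?_⟩
      have hu' := hD.rank_pos u
      have hv' := hD.rank_pos v
      rw [hD.inj u v hu' (by omega)]
      exact hdiag v
    · rintro r hr σ' hf' h5 ⟨hdiag, hI⟩
      obtain ⟨x, hx, hx0, hx1⟩ := hpar r hr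
      have hxp := hD.par_lt x (by omega)
      have hpx : primParent D B x = some (B x) := primParent_eq_some.2 ⟨by omega, rfl⟩
      have e1 : σ'.ia 1 = σ.ia 1 := (hf'.ia 1 (by decide)).trans (hf₁.ia 1 (by decide))
      have e4 : σ'.ra 4 = σ.ra 4 := (hf'.ra 4 (by decide)).trans (hf₁.ra 4 (by decide))
      refine (run_extendCov ((hf'.iv 0 (by decide)).trans ((hf₁.iv 0 (by decide)).trans h0)) h5
        (by rw [e1, hx0]) (by rw [e1, hx1]) ?_).mono le_rfl ?_
      · rw [Ne, coe_coe_inj]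
        intro h
        rw [h] at hxp
        exact lt_irrefl _ hxp
      · intro σ'' _ hr'
        rw [e4] at hr'
        have hlt : ∀ u, D u ≤ r + 1 + 1 → u ≠ x → D u < D x := fun u hu hux => by
          have : D u ≠ D x := fun h => hux (hD.inj u x (hD.rank_pos u) h)
          omega
        refine ⟨fun u => ?_, fun u v hu hv => ?_⟩
        · rw [hr' _ (u : Fin n).2 _ (u : Fin n).2, if_pos rfl]
          exact hdiag u
        · rw [hr' _ (u : Fin n).2 _ (v : Fin n).2]
          simp only [coe_coe_inj, hA x (B x), hA (B x) (B x)]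
          by_cases huv : u = v
          · rw [if_pos huv, huv]
            exact hdiag v
          rw [if_neg huv]
          by_cases hux : u = x
          · have hvx : v ≠ x := fun h => huv (hux.trans h.symm)
            have hvlt := hlt v hv hvx
            rw [if_pos hux, hI _ _ (by omega) (by omega), hux, hP.step hpx hvlt]
          · have hult := hlt u hu hux
            rw [if_neg hux]
            by_cases hvx : v = x
            · rw [if_pos hvx, hI _ _ (by omega) (by omega), hvx, hP.symm u x, hP.step hpx hult]
            · have hvlt := hlt v hv hvx
              rw [if_neg hvx, hI _ _ (by omega) (by omega)]
    · simp only [IExp.cost]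
      exact Nat.mul_le_mul (by omega) (by omega)
    · rintro σ' - ⟨-, hI⟩ u v
      have hc := card_notMem F
      have h1 := hD.le u
      have h2 := hD.le v
      exact hI u v (by omega) (by omega)
  · nlinarith [Nat.zero_le n]

theorem run_fillConditional {σ : Mem} (h0 : σ.iv 0 = n) {S : Matrix (Fin n) (Fin n) ℝ}
    (hpos : S.PosDef) {e : Fin F.card ≃ {i // i ∈ F}} (hS : σ.HoldsMatrix 0 S)
    (he : σ.HoldsList e) (h1 : σ.iv 1 = F.card)
    (hr : σ.HoldsRows (S.submatrix (fun a => ((e a : Fin n))) id)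
        (S.submatrix (fun a => ((e a : Fin n))) fun a => ((e a : Fin n)))⁻¹) :
    Run fillConditional σ (100 * (F.card + 1) * (n + 1) ^ 2) fun σ' =>
      σ'.HoldsBlock 4 (conditionalCov F S) := by
  refine (Run.fillRect (A := 4) (N := n) (M := n) (B := 30 * (F.card + 1) + 4)
    (fun i j => if h : i < n ∧ j < n then residualMatrix F S ⟨i, h.1⟩ ⟨j, h.2⟩ else 0)
    (by decide) (by decide) (fun σ' hf => ?_) (fun σ' hf => ?_) ?_ ?_).mono le_rfl ?_
  · exact (hf.iv 0 (by decide)).trans h0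
  · exact (hf.iv 0 (by decide)).trans h0
  · intro i hi j hj σ' hf h5 h6 hI
    have e3 : σ'.ra 3 = σ.ra 3 := hf.ra 3 (by decide)
    have e0 : σ'.ra 0 = σ.ra 0 := hf.ra 0 (by decide)
    have ei : σ'.ia 3 = σ.ia 3 := hf.ia 3 (by decide)
    refine Run.seq (run_residual (src := 0) (x := 5) (y := 6) (F := F) (i := ⟨i, hi⟩)
      (j := ⟨j, hj⟩) (by decide) (by decide) hpos
      (fun a b => by rw [e0]; exact hS a b) (fun a => by rw [ei]; exact he a)
      ((hf.iv 1 (by decide)).trans h1) (fun a => by rw [e3]; exact hr a) h5 h6)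
      (T₂ := 4) ?_ le_rfl
    intro σ₂ hf₂ h₂
    refine Run.straight rfl (by decide) ?_
    intro a b
    simp only [Cmd.step, IExp.eval, RExp.eval, updateCell_same, (hf₂.iv 5 (by decide)).trans h5,
      (hf₂.iv 6 (by decide)).trans h6, hf₂.ra 4 (by decide), h₂, dif_pos (And.intro hi hj)]
  · simp only [IExp.cost]
    have h2 : (n + 1) * ((n + 1) * (30 * (F.card + 1) + 4 + 1 + 7) + 1 + 7) =
      30 * ((F.card + 1) * (n + 1) ^ 2) + 12 * (n + 1) ^ 2 + 8 * (n + 1) := by ring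
    have h3 : n + 1 ≤ (n + 1) ^ 2 := Nat.le_self_pow two_ne_zero _
    have h4 : (n + 1) ^ 2 ≤ (F.card + 1) * (n + 1) ^ 2 := Nat.le_mul_of_pos_left _ (by omega)
    rw [h2, mul_assoc]
    omega
  · intro σ' _ hg u v
    rw [hg, if_pos ⟨(u : Fin n).2, (v : Fin n).2⟩,
      dif_pos ⟨(u : Fin n).2, (v : Fin n).2⟩, ← residualMatrix_apply]

/-- The machine has no absolute value; it is computed as the square root of the square. -/
theorem run_fillWeights {σ : Mem} (h : σ.HoldsFVS F) {A : Matrix {i // i ∉ F} {i // i ∉ F} ℝ}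
    (hA : σ.HoldsBlock 4 A) :
    Run fillWeights σ (100 * (n + 1) ^ 2) fun σ' =>
      σ'.HoldsBlock 6 fun i j => |correlation A i j| := by
  obtain ⟨h0, -, hF⟩ := h
  refine (Run.fillRect (A := 6) (N := n) (M := n) (B := 45)
    (fun i j => if σ.ia 0 i 0 = 0 ∧ σ.ia 0 j 0 = 0 then
      |σ.ra 4 i j / Real.sqrt (σ.ra 4 i i * σ.ra 4 j j)| else 0)
    (by decide) (by decide) (fun σ' hf => ?_) (fun σ' hf => ?_) ?_ ?_).mono le_rfl ?_
  · exact (hf.iv 0 (by decide)).trans h0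
  · exact (hf.iv 0 (by decide)).trans h0
  · intro i hi j hj σ' hf h5 h6 hI
    refine Run.straight rfl (by decide) ?_
    intro a b
    by_cases hc : σ.ia 0 i 0 = 0 ∧ σ.ia 0 j 0 = 0
    · simp only [Cmd.step, outsideF, BExp.Holds, IExp.eval, RExp.eval, correlationExp,
        updateCell_same, h5, h6, hf.ia 0 (by decide), hf.ra 4 (by decide),
        Real.sqrt_mul_self_eq_abs, hc, and_self, if_true]
    · simp only [Cmd.step, outsideF, BExp.Holds, IExp.eval, RExp.eval, updateCell_same, h5, h6,
        hf.ia 0 (by decide), if_neg hc, Nat.cast_zero]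
  · simp only [IExp.cost]
    nlinarith [Nat.zero_le n]
  · intro σ' _ hg u v
    have hFT : ∀ i : {i // i ∉ F}, σ.ia 0 (i : Fin n) 0 = 0 := fun i => by
      rw [hF, if_neg i.2]
    rw [hg, if_pos ⟨(u : Fin n).2, (v : Fin n).2⟩, if_pos ⟨hFT u, hFT v⟩, hA, hA, hA]
    rfl

/-- The correction B A⁻¹ Bᵀ is the difference of the empirical and the conditional covariance, both
in memory, so no matrix product is needed. -/
theorem run_fillLearned {σ : Mem} (h : σ.HoldsFVS F) {Sh : Matrix (Fin n) (Fin n) ℝ}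
    (hpos : Sh.PosDef) (hS : σ.HoldsMatrix 0 Sh) {P : Matrix {i // i ∉ F} {i // i ∉ F} ℝ}
    (hA : σ.HoldsBlock 4 (conditionalCov F Sh)) (hP : σ.HoldsBlock 5 P) :
    Run fillLearned σ (100 * (n + 1) ^ 2) fun σ' =>
      σ'.HoldsMatrix 1 (assemble F (blockF F Sh) (blockM F Sh)
        (P + blockM F Sh * (blockF F Sh)⁻¹ * (blockM F Sh)ᵀ)) := by
  obtain ⟨h0, -, hF⟩ := h
  refine (Run.fillRect (A := 1) (N := n) (M := n) (B := 32)
    (fun i j => if σ.ia 0 i 0 = 0 ∧ σ.ia 0 j 0 = 0 then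
      σ.ra 5 i j + (σ.ra 0 i j - σ.ra 4 i j) else σ.ra 0 i j)
    (by decide) (by decide) (fun σ' hf => ?_) (fun σ' hf => ?_) ?_ ?_).mono le_rfl ?_
  · exact (hf.iv 0 (by decide)).trans h0
  · exact (hf.iv 0 (by decide)).trans h0
  · intro i hi j hj σ' hf h5 h6 hI
    refine Run.straight rfl (by decide) ?_
    intro a b
    by_cases hc : σ.ia 0 i 0 = 0 ∧ σ.ia 0 j 0 = 0
    · simp only [Cmd.step, outsideF, BExp.Holds, IExp.eval, RExp.eval, updateCell_same, h5, h6,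
        hf.ia 0 (by decide), hf.ra 4 (by decide), hf.ra 5 (by decide), hf.ra 0 (by decide),
        hc, and_self, if_true]
    · simp only [Cmd.step, outsideF, BExp.Holds, IExp.eval, RExp.eval, h5, h6,
        hf.ia 0 (by decide), hf.ra 0 (by decide), if_neg hc, updateCell_same]
  · simp only [IExp.cost]
    nlinarith [Nat.zero_le n]
  · intro σ' _ hg
    have hval : (Matrix.of fun i j : Fin n => σ'.ra 1 i j) =
        assemble F (blockF F Sh) (blockM F Sh)
          (P + blockM F Sh * (blockF F Sh)⁻¹ * (blockM F Sh)ᵀ) := by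
      have hFF : ∀ i : {i // i ∈ F}, σ.ia 0 (i : Fin n) 0 = 1 := fun i => by
        rw [hF, if_pos i.2]
      have hFT : ∀ i : {i // i ∉ F}, σ.ia 0 (i : Fin n) 0 = 0 := fun i => by
        rw [hF, if_neg i.2]
      refine eq_assemble F (fun i j => ?_) (fun i j => ?_) (fun i j => ?_) fun i j => ?_ <;>
        rw [Matrix.of_apply, hg, if_pos ⟨Fin.is_lt _, Fin.is_lt _⟩]
      · rw [if_neg (by simp [hFF]), hS]
        rfl
      · rw [if_neg (by simp [hFF]), hS]
        rfl
      · rw [if_neg (by simp [hFF]), hS, PosDef.apply_comm hpos]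
        rfl
      · rw [if_pos ⟨hFT i, hFT j⟩, hP, hS, hA, conditionalCov, Matrix.sub_apply, Matrix.add_apply]
        rw [show blockT F Sh i j = Sh i j from rfl]
        ring
    intro i j
    rw [← hval, Matrix.of_apply]

/-- Row `r` belongs to the vertex inserted at position `r + 2`, so the rows correspond to the
vertices other than the root. -/
theorem Mem.HoldsParents.holdsEdges {σ : Mem} (h2 : σ.iv 2 = n - F.card - 1)
    {w : {i // i ∉ F} → {i // i ∉ F} → ℝ} {D : {i // i ∉ F} → ℕ}
    {B : {i // i ∉ F} → {i // i ∉ F}} (hD : IsPrimState w (Fintype.card {i // i ∉ F}) D B)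
    (hpar : σ.HoldsParents (n - F.card - 1) D B) :
    σ.HoldsEdges (primTree (primParent D B)) := by
  have hpos := hD.rank_pos
  refine ⟨?_, fun u v => ?_⟩
  · rw [h2, hD.treeOrder.ncard_edgeSet, card_notMem]
  · have key : ∀ u v : {i // i ∉ F}, primParent D B u = some v ↔ ∃ r < σ.iv 2,
        σ.ia 1 r 0 = (u : Fin n) ∧ σ.ia 1 r 1 = (v : Fin n) := by
      intro u v
      rw [h2, primParent_eq_some]
      constructor
      · rintro ⟨h1, rfl⟩
        have h3 := hpos u
        have h4 := hD.le u
        rw [card_notMem] at h4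
        obtain ⟨x, hx, hx0, hx1⟩ := hpar (D u - 2) (by omega)
        have hxu : x = u := hD.inj x u (hpos x) (by omega)
        subst hxu
        exact ⟨D x - 2, by omega, hx0, hx1⟩
      · rintro ⟨r, hr, hr0, hr1⟩
        obtain ⟨x, hx, hx0, hx1⟩ := hpar r hr
        rw [hx0, coe_coe_inj] at hr0
        rw [hx1, coe_coe_inj] at hr1
        subst hr0
        exact ⟨by omega, hr1⟩
    rw [hD.treeOrder.adj_iff, key, key]
    constructor
    · rintro (⟨r, hr, h⟩ | ⟨r, hr, h⟩)
      · exact ⟨r, hr, Or.inl h⟩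
      · exact ⟨r, hr, Or.inr h⟩
    · rintro ⟨r, hr, h | h⟩
      · exact Or.inl ⟨r, hr, h⟩
      · exact Or.inr ⟨r, hr, h⟩

theorem run_learn {σ : Mem} (h : σ.HoldsFVS F) {Sh : Matrix (Fin n) (Fin n) ℝ} (hpos : Sh.PosDef)
    (hS : σ.HoldsMatrix 0 Sh) :
    Run learn σ (1500 * ((F.card + 1) * (n + 1) ^ 2)) fun σ' => ∃ E S,
      IsConditionedChowLiuOutput F Sh E S ∧ σ'.HoldsLearned F E S := by
  have hk : F.card ≤ n := by simpa using Finset.card_le_univ F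
  have hF : ∀ {σ' : Mem}, Frame learn.writes σ σ' → σ'.HoldsFVS F := fun hf =>
    ⟨(hf.iv 0 (by decide)).trans h.1, (hf.iv 1 (by decide)).trans h.2.1, fun i => by
      rw [hf.ia 0 (by decide)]; exact h.2.2 i⟩
  have hM : ∀ {σ' : Mem}, Frame learn.writes σ σ' → σ'.HoldsMatrix 0 Sh := fun hf u v => by
    rw [hf.ra 0 (by decide)]; exact hS u v
  have hA := conditionalCov_posDef (F := F) hpos
  refine Run.seq (run_listFVS h) (T₂ := 600 * (F.card + 1) ^ 2 * (n + 1) +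
    (100 * (F.card + 1) * (n + 1) ^ 2 + (100 * (n + 1) ^ 2 + (300 * (n + 1) ^ 2 +
      (100 * (n + 1) ^ 2 + 100 * (n + 1) ^ 2))))) ?_ ?_
  rintro σ₁ hf₁ ⟨e, he⟩
  have g₁ : Frame learn.writes σ σ₁ := hf₁.mono (by decide)
  refine Run.seq (run_sweep (src := 0) (by decide) hpos (hF g₁) (hM g₁) he) ?_ le_rfl
  intro σ₂ hf₂ hr
  have g₂ : Frame learn.writes σ σ₂ := g₁.trans (hf₂.mono (by decide))
  refine Run.seq (run_fillConditional (hF g₂).1 hpos (hM g₂)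
    (fun a => by rw [hf₂.ia 3 (by decide)]; exact he a) (hF g₂).2.1 hr) ?_ le_rfl
  intro σ₃ hf₃ h₃
  have g₃ : Frame learn.writes σ σ₃ := g₂.trans (hf₃.mono (by decide))
  refine Run.seq (run_fillWeights (hF g₃) h₃) ?_ le_rfl
  intro σ₄ hf₄ h₄
  have g₄ : Frame learn.writes σ σ₄ := g₃.trans (hf₄.mono (by decide))
  refine Run.seq (run_prim (hF g₄) h₄) ?_ le_rfl
  rintro σ₅ hf₅ ⟨h2, D, B, hD, hpar⟩
  have g₅ : Frame learn.writes σ σ₅ := g₄.trans (hf₅.mono (by decide))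
  have hmax := hD.isMaxSpanningTree fun i j => by rw [correlation_comm hA]
  -- The output is specified through paths, but computed by recursion along the insertion order;
  -- `PathCov.treeCov` connects the two.
  obtain ⟨P, hP⟩ := exists_pathCov hmax.1 (conditionalCov F Sh)
  have h4₅ : σ₅.HoldsBlock 4 (conditionalCov F Sh) := fun u v => by
    rw [hf₅.ra 4 (by decide), hf₄.ra 4 (by decide)]; exact h₃ u v
  refine Run.seq (run_treeCovariance (hF g₅).1 h2 h4₅ hD hpar
    (hP.treeCov hA hmax.1 hD.treeOrder)) ?_ le_rfl
  intro σ₆ hf₆ h₆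
  have g₆ : Frame learn.writes σ σ₆ := g₅.trans (hf₆.mono (by decide))
  have h4₆ : σ₆.HoldsBlock 4 (conditionalCov F Sh) := fun u v => by
    rw [hf₆.ra 4 (by decide)]; exact h4₅ u v
  refine (run_fillLearned (hF g₆) hpos (hM g₆) h4₆ h₆).mono le_rfl ?_
  intro σ₇ hf₇ h₇
  have g₇ : Frame learn.writes σ σ₇ := g₆.trans (hf₇.mono (by decide))
  refine ⟨_, _, ⟨P, ⟨hmax, hP.diag, hP.edge, hP.path⟩, rfl⟩, hF g₇, ?_, h₇⟩
  · refine Mem.HoldsParents.holdsEdges ((hf₇.iv 2 (by decide)).trans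
      ((hf₆.iv 2 (by decide)).trans h2)) hD fun r hr => ?_
    rw [hf₇.ia 1 (by decide), hf₆.ia 1 (by decide)]
    exact hpar r hr
  · have h2 : n + 1 ≤ (n + 1) ^ 2 := Nat.le_self_pow two_ne_zero _
    have h3 : (n + 1) ^ 2 ≤ (F.card + 1) * (n + 1) ^ 2 := Nat.le_mul_of_pos_left _ (by omega)
    -- Since k ≤ n, the cost k²n of the elimination is absorbed by kn².
    have h4 : (F.card + 1) ^ 2 * (n + 1) ≤ (F.card + 1) * (n + 1) ^ 2 := by
      rw [sq, sq, mul_assoc]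
      exact Nat.mul_le_mul le_rfl (Nat.mul_le_mul (by omega) le_rfl)
    rw [mul_assoc 600, mul_assoc 100]
    omega

end

/-! ### The entries of the information matrix -/

section

variable {V : Type*} [Fintype V] [DecidableEq V] {F : Finset V}

open Classical in
/-- The inverse of the conditional covariance matrix of an output. -/
theorem IsConditionedChowLiuOutput.inv_conditionalCov {Sh S : Matrix V V ℝ} (hSh : Sh.PosDef)
    {E : SimpleGraph {i // i ∉ F}} (h : IsConditionedChowLiuOutput F Sh E S)
    (P : Matrix {i // i ∉ F} {i // i ∉ F} ℝ) (hP : P = conditionalCov F S) :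
    (∀ i j, i ≠ j → ¬ E.Adj i j → P⁻¹ i j = 0) ∧
    (∀ i j, E.Adj i j → P⁻¹ i j = -P i j / (P i i * P j j - P i j ^ 2)) ∧
    ∀ i, P⁻¹ i i = 1 / P i i +
      ∑ j, if E.Adj i j then P i j ^ 2 / (P i i * (P i i * P j j - P i j ^ 2)) else 0 := by
  obtain ⟨M, hE, hM, rfl⟩ := h.exists_treeCov
  have hA := conditionalCov_posDef (F := F) hSh
  rw [conditionalCov_assemble] at hP
  subst hP
  obtain ⟨rank, par, ho⟩ := hE.1.exists_treeOrder
  have hT := hM.treeCov hA hE.1 ho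
  refine ⟨fun i j => hT.inv_apply_of_not_adj ho hA, fun i j hij => ?_, fun i => ?_⟩
  · rw [hT.inv_apply_of_adj ho hA hij, hM.diag, hM.diag, hM.edge i j hij]
  · rw [hT.inv_apply_self ho hA, hM.diag]
    congr 1
    refine Finset.sum_congr rfl fun j _ => ?_
    split_ifs with hij
    · rw [hM.diag, hM.edge i j hij]
    · rfl

/-- The blocks of an information matrix. -/
theorem inv_blocks {S : Matrix V V ℝ} (hS : S.PosDef) {X : Matrix {i // i ∉ F} {i // i ∈ F} ℝ}
    (hX : X = blockM F S * (blockF F S)⁻¹) {N : Matrix {i // i ∉ F} {i // i ∈ F} ℝ}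
    (hN : N = (conditionalCov F S)⁻¹ * X) :
    S⁻¹ = assemble F ((blockF F S)⁻¹ + Xᵀ * N) (-N) (conditionalCov F S)⁻¹ := by
  have hA := blockF_posDef F hS
  conv_lhs => rw [← assemble_conditionalCov (F := F) hS]
  rw [inv_assemble hA (conditionalCov_posDef hS), ← hX, ← hN]
  congr 2
  rw [hX, Matrix.transpose_mul, PosDef.transpose_eq hA.inv]

end

/-! ### Lists of edges -/

theorem sum_fin_lt_succ {m : ℕ} (f : Fin m → ℝ) (r : Fin m) :
    (∑ s : Fin m, if (s : ℕ) < r + 1 then f s else 0) =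
      (∑ s : Fin m, if (s : ℕ) < r then f s else 0) + f r := by
  have h : ∀ s : Fin m, (if (s : ℕ) < r + 1 then f s else 0) =
      (if (s : ℕ) < r then f s else 0) + if s = r then f s else 0 := by
    intro s
    by_cases hs : s = r
    · subst hs; simp
    · have : (s : ℕ) ≠ r := fun h => hs (Fin.ext h)
      have h1 : (s : ℕ) < r + 1 ↔ (s : ℕ) < r := by omega
      simp [hs, h1]
  simp only [h, Finset.sum_add_distrib, Finset.sum_ite_eq', Finset.mem_univ, if_true]

/-- An enumeration of the edges of a graph, each with an orientation. -/
structure EdgeEnum {V : Type*} (E : SimpleGraph V) {m : ℕ} (u v : Fin m → V) : Prop where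
  adj : ∀ r, E.Adj (u r) (v r)
  inj : ∀ r s, s(u r, v r) = s(u s, v s) → r = s
  surj : ∀ i j, E.Adj i j → ∃ r, s(u r, v r) = s(i, j)

open Classical in
-- Ordered adjacent pairs are the listed edges together with a choice of orientation.
theorem EdgeEnum.sum_eq {V : Type*} [Fintype V] {E : SimpleGraph V} {m : ℕ} {u v : Fin m → V}
    (h : EdgeEnum E u v) (f : V → V → ℝ) :
    ∑ r, (f (u r) (v r) + f (v r) (u r)) = ∑ i, ∑ j, if E.Adj i j then f i j else 0 := by
  have h1 : ∑ i, ∑ j, (if E.Adj i j then f i j else 0) =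
      ∑ p : V × V with E.Adj p.1 p.2, f p.1 p.2 := by
    rw [Finset.sum_filter, ← Finset.univ_product_univ, Finset.sum_product]
  have h2 : ∑ r, (f (u r) (v r) + f (v r) (u r)) =
      ∑ x : Fin m × Bool, if x.2 then f (u x.1) (v x.1) else f (v x.1) (u x.1) := by
    rw [← Finset.univ_product_univ, Finset.sum_product]
    simp
  rw [h1, h2]
  refine Finset.sum_bij (fun x _ => if x.2 then (u x.1, v x.1) else (v x.1, u x.1)) ?_ ?_ ?_ ?_
  · rintro ⟨r, b⟩ _
    cases b
    · simpa using (h.adj r).symm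
    · simpa using h.adj r
  · rintro ⟨r, b⟩ _ ⟨s, c⟩ _ hrs
    have hne := (h.adj r).ne
    have hr : r = s := h.inj r s (by
      cases b <;> cases c <;> simp_all)
    subst hr
    cases b <;> cases c <;> simp_all
  · rintro ⟨i, j⟩ hij
    obtain ⟨r, hr⟩ := h.surj i j (by simpa using hij)
    rcases Sym2.eq_iff.1 hr with ⟨h1, h2⟩ | ⟨h1, h2⟩
    · exact ⟨(r, true), Finset.mem_univ _, by simp [h1, h2]⟩
    · exact ⟨(r, false), Finset.mem_univ _, by simp [h1, h2]⟩
  · rintro ⟨r, b⟩ _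
    cases b <;> simp

open Classical in
theorem EdgeEnum.sum_ite_eq {V : Type*} [Fintype V] [DecidableEq V] {E : SimpleGraph V} {m : ℕ}
    {u v : Fin m → V} (h : EdgeEnum E u v) (f : V → V → ℝ) (i : V) :
    ∑ r, ((if u r = i then f (u r) (v r) else 0) + if v r = i then f (v r) (u r) else 0) =
      ∑ j, if E.Adj i j then f i j else 0 := by
  rw [h.sum_eq fun a b => if a = i then f a b else 0, Finset.sum_eq_single i]
  · simp
  · intro a _ ha
    simp [ha]
  · simp

/-- Choose a row for every edge. Different edges get different rows, and there are as many rows as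
edges, so every row holds exactly one edge and none is spurious. -/
theorem Mem.HoldsEdges.exists_enum {n : ℕ} {F : Finset (Fin n)} {σ : Mem}
    {E : SimpleGraph {i // i ∉ F}} (h : σ.HoldsEdges E) {m : ℕ} (hm : σ.iv 2 = m) :
    ∃ u v : Fin m → {i // i ∉ F}, EdgeEnum E u v ∧
      ∀ r : Fin m, σ.ia 1 r 0 = (u r : Fin n) ∧ σ.ia 1 r 1 = (v r : Fin n) := by
  classical
  subst hm
  have key : ∀ q : E.edgeSet, ∃ r : Fin (σ.iv 2), ∃ u v : {i // i ∉ F}, s(u, v) = (q : Sym2 _) ∧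
      σ.ia 1 r 0 = (u : Fin n) ∧ σ.ia 1 r 1 = (v : Fin n) := by
    rintro ⟨q, hq⟩
    induction q using Sym2.ind with
    | _ i j =>
      obtain ⟨r, hr, ⟨h1, h2⟩ | ⟨h1, h2⟩⟩ := (h.2 i j).1 hq
      · exact ⟨⟨r, hr⟩, i, j, rfl, h1, h2⟩
      · exact ⟨⟨r, hr⟩, j, i, Sym2.eq_swap, h1, h2⟩
  choose ρ u v hq hu hv using key
  have hinj : Function.Injective ρ := by
    intro q q' hqq
    have h1 := hu q
    have h2 := hv q
    rw [hqq, hu q', coe_coe_inj] at h1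
    rw [hqq, hv q', coe_coe_inj] at h2
    exact Subtype.ext (by rw [← hq q, ← hq q', h1, h2])
  have hcard : Fintype.card E.edgeSet = Fintype.card (Fin (σ.iv 2)) := by
    rw [Fintype.card_fin, h.1, ← Nat.card_coe_set_eq, Nat.card_eq_fintype_card]
  have hbij := (Fintype.bijective_iff_injective_and_card ρ).2 ⟨hinj, hcard⟩
  obtain ⟨g, hg1, hg2⟩ := Function.bijective_iff_has_inverse.1 hbij
  refine ⟨fun r => u (g r), fun r => v (g r), ⟨fun r => ?_, fun r s hrs => ?_, fun i j hij => ?_⟩,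
    fun r => ?_⟩
  · have := (g r).2
    rwa [← hq (g r)] at this
  · rw [hq, hq] at hrs
    rw [← hg2 r, ← hg2 s, Subtype.ext hrs]
  · exact ⟨ρ ⟨s(i, j), hij⟩, by rw [hg1, hq]⟩
  · have h1 := hu (g r)
    have h2 := hv (g r)
    rw [hg2] at h1 h2
    exact ⟨h1, h2⟩

/-! ### The information matrix: programs -/

/-- The conditional variances (real array 4) and their inverses (real array 5). -/
def fillDiagonal : Cmd :=
  forLoop 5 (.var 0) (.branch (.ieq (.get 0 (.var 5) (.lit 0)) (.lit 0))
    (.seq (residual 1 5 5) (.seq (.rput 4 (.var 5) (.lit 0) (.var 0))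
      (.rput 5 (.var 5) (.lit 0) (.div (.lit 1) (.var 0))))) .skip)

/-- Loads the end points of an edge of the list. -/
def loadEdge : Cmd :=
  .seq (.iset 9 (.get 1 (.var 5) (.lit 0))) (.iset 10 (.get 1 (.var 5) (.lit 1)))

/-- The contribution of one edge. -/
def edgeUpdate : Cmd :=
  .seq (.rset 1 (.sub (.mul (.get 4 (.var 9) (.lit 0)) (.get 4 (.var 10) (.lit 0)))
    (.mul (.var 0) (.var 0)))) <|
  .seq (.rput 6 (.var 5) (.lit 0) (.div (.sub (.lit 0) (.var 0)) (.var 1))) <|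
  .seq (.rput 5 (.var 9) (.lit 0) (.add (.get 5 (.var 9) (.lit 0))
    (.div (.mul (.var 0) (.var 0)) (.mul (.get 4 (.var 9) (.lit 0)) (.var 1))))) <|
  .rput 5 (.var 10) (.lit 0) (.add (.get 5 (.var 10) (.lit 0))
    (.div (.mul (.var 0) (.var 0)) (.mul (.get 4 (.var 10) (.lit 0)) (.var 1))))

/-- Computes the information matrix of the tree model: the entries for the edges (real array 6) and
the diagonal (real array 5). -/
def fillEdges : Cmd :=
  forLoop 5 (.var 2) (.seq loadEdge (.seq (residual 1 9 10) edgeUpdate))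

/-- Multiplies the information matrix of the tree model with the regression coefficients. -/
def fillCross : Cmd :=
  .seq (forLoop 5 (.var 0) (forLoop 6 (.var 1)
    (.rput 7 (.var 5) (.var 6) (.mul (.get 5 (.var 5) (.lit 0)) (.get 3 (.var 6) (.var 5)))))) <|
  forLoop 5 (.var 2) (.seq loadEdge (forLoop 6 (.var 1) (.seq
    (.rput 7 (.var 9) (.var 6) (.add (.get 7 (.var 9) (.var 6))
      (.mul (.get 6 (.var 5) (.lit 0)) (.get 3 (.var 6) (.var 10)))))
    (.rput 7 (.var 10) (.var 6) (.add (.get 7 (.var 10) (.var 6))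
      (.mul (.get 6 (.var 5) (.lit 0)) (.get 3 (.var 6) (.var 9))))))))

/-- One entry of the block on `F`. -/
def feedbackEntry : Cmd :=
  .seq (.rset 0 (.get 3 (.var 5) (.add (.var 0) (.var 6)))) <|
  .seq (forLoop 7 (.var 0) (.branch (.ieq (.get 0 (.var 7) (.lit 0)) (.lit 0))
    (.rset 0 (.add (.var 0) (.mul (.get 3 (.var 5) (.var 7)) (.get 7 (.var 7) (.var 6))))) .skip)) <|
  .rput 8 (.var 5) (.var 6) (.var 0)

/-- Computes the block of the information matrix on `F` (real array 8). -/
def fillFeedback : Cmd :=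
  forLoop 5 (.var 1) (forLoop 6 (.var 1) feedbackEntry)

section

variable {n : ℕ} {F : Finset (Fin n)}

/-- The memory after the elimination. -/
structure IsSwept (σ : Mem) (S : Matrix (Fin n) (Fin n) ℝ) (e : Fin F.card ≃ {i // i ∈ F}) :
    Prop where
  fvs : σ.HoldsFVS F
  mat : σ.HoldsMatrix 1 S
  list : σ.HoldsList e
  rows : σ.HoldsRows (S.submatrix (fun a => ((e a : Fin n))) id)
    (S.submatrix (fun a => ((e a : Fin n))) fun a => ((e a : Fin n)))⁻¹

theorem IsSwept.frame {σ σ' : Mem} {S : Matrix (Fin n) (Fin n) ℝ}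
    {e : Fin F.card ≃ {i // i ∈ F}} (h : IsSwept σ S e) {w : List (ℕ × ℕ)} (hf : Frame w σ σ')
    (hw : ∀ z ∈ [(0, 0), (0, 1), (2, 0), (2, 3), (3, 1), (3, 3)], z ∉ w) : IsSwept σ' S e := by
  refine ⟨⟨?_, ?_, fun i => ?_⟩, fun i j => ?_, fun a => ?_, fun a => ?_⟩
  · rw [hf.iv 0 (hw _ (by decide))]; exact h.fvs.1
  · rw [hf.iv 1 (hw _ (by decide))]; exact h.fvs.2.1
  · rw [hf.ia 0 (hw _ (by decide))]; exact h.fvs.2.2 i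
  · rw [hf.ra 1 (hw _ (by decide))]; exact h.mat i j
  · rw [hf.ia 3 (hw _ (by decide))]; exact h.list a
  · rw [hf.ra 3 (hw _ (by decide))]; exact h.rows a

theorem IsSwept.run_residual {σ : Mem} {S : Matrix (Fin n) (Fin n) ℝ}
    {e : Fin F.card ≃ {i // i ∈ F}} (h : IsSwept σ S e) (hS : S.PosDef) {x y : ℕ} (hx : x ≠ 7)
    (hy : y ≠ 7) {i j : {i // i ∉ F}} (hi : σ.iv x = (i : Fin n)) (hj : σ.iv y = (j : Fin n)) :
    Run (residual 1 x y) σ (30 * (F.card + 1)) fun σ' => σ'.rv 0 = conditionalCov F S i j :=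
  FVSLearning.run_residual hx hy hS h.mat h.list h.fvs.2.1 h.rows hi hj

/-- The elimination leaves the transpose of the regression coefficients in array 3, by symmetry of
both factors. -/
theorem IsSwept.apply_notMem {σ : Mem} {S : Matrix (Fin n) (Fin n) ℝ}
    {e : Fin F.card ≃ {i // i ∈ F}} (h : IsSwept σ S e) (hS : S.PosDef) (a : Fin F.card)
    (j : {i // i ∉ F}) : σ.ra 3 a (j : Fin n) = (blockM F S * (blockF F S)⁻¹) j (e a) := by
  rw [(h.rows a).1 j, inv_submatrix_mul, Matrix.mul_apply, Matrix.mul_apply]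
  refine Finset.sum_congr rfl fun b _ => ?_
  rw [mul_comm, PosDef.apply_comm (blockF_posDef F hS).inv, Matrix.submatrix_apply,
    PosDef.apply_comm hS]
  rfl

theorem IsSwept.apply_add {σ : Mem} {S : Matrix (Fin n) (Fin n) ℝ}
    {e : Fin F.card ≃ {i // i ∈ F}} (h : IsSwept σ S e) (a b : Fin F.card) :
    σ.ra 3 a (n + b) = (blockF F S)⁻¹ (e a) (e b) := by
  rw [(h.rows a).2 b]
  have hB : (S.submatrix (fun a => ((e a : Fin n))) fun a => ((e a : Fin n)))⁻¹ =
      ((blockF F S)⁻¹).submatrix e e := by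
    rw [← Matrix.inv_submatrix_equiv]
    rfl
  rw [hB]
  rfl

/-- Array 5 receives the first summand of the formula for the diagonal of P⁻¹; the edges add the
rest later. -/
theorem run_fillDiagonal {σ : Mem} {S : Matrix (Fin n) (Fin n) ℝ}
    {e : Fin F.card ≃ {i // i ∈ F}} (h : IsSwept σ S e) (hS : S.PosDef) :
    Run fillDiagonal σ (60 * ((F.card + 1) * (n + 1))) fun σ' => ∀ i : {i // i ∉ F},
      σ'.ra 4 (i : Fin n) 0 = conditionalCov F S i i ∧
      σ'.ra 5 (i : Fin n) 0 = 1 / conditionalCov F S i i := by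
  refine (Run.forLoop (N := n) (B := 30 * (F.card + 1) + 16) (fun m σ' => ∀ i : {i // i ∉ F},
      ((i : Fin n) : ℕ) < m → σ'.ra 4 (i : Fin n) 0 = conditionalCov F S i i ∧
      σ'.ra 5 (i : Fin n) 0 = 1 / conditionalCov F S i i)
    (by decide) ?_ ?_ (fun _ _ _ h => h) ?_ ?_).mono le_rfl ?_
  · intro σ' hf'
    exact (hf'.iv 0 (by decide)).trans h.fvs.1
  · intro i hi; omega
  · intro m hm σ' hf' h5 hI
    have h' := h.frame hf' (by decide)
    have hFm := h'.fvs.2.2 ⟨m, hm⟩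
    simp only at hFm
    by_cases hmF : (⟨m, hm⟩ : Fin n) ∈ F
    -- The branch contains a loop, so `Run.straight` does not apply and the execution is assembled
    -- by hand.
    · refine ⟨_, σ', Exec.branchFalse ?_ (Exec.skip _), ?_, fun i hi => hI i ?_⟩
      · simp [BExp.Holds, IExp.eval, h5, hFm, hmF]
      · simp only [BExp.cost, IExp.cost]; omega
      · have : ((i : Fin n) : ℕ) ≠ m := fun h => i.2 (by convert hmF)
        omega
    · obtain ⟨v, hv⟩ : ∃ v : {i // i ∉ F}, ((v : Fin n) : ℕ) = m := ⟨⟨⟨m, hm⟩, hmF⟩, rfl⟩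
      have hrun : Run (.seq (residual 1 5 5) (.seq (.rput 4 (.var 5) (.lit 0) (.var 0))
          (.rput 5 (.var 5) (.lit 0) (.div (.lit 1) (.var 0))))) σ' (30 * (F.card + 1) + 10)
          fun σ'' => ∀ i : {i // i ∉ F}, ((i : Fin n) : ℕ) < m + 1 →
            σ''.ra 4 (i : Fin n) 0 = conditionalCov F S i i ∧
            σ''.ra 5 (i : Fin n) 0 = 1 / conditionalCov F S i i := by
        refine Run.seq (h'.run_residual hS (x := 5) (y := 5) (i := v) (j := v) (by decide)
          (by decide) (h5.trans hv.symm) (h5.trans hv.symm)) (T₂ := 10) ?_ le_rfl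
        intro σ₁ hf₁ h₁
        refine Run.straight rfl (by decide) ?_
        intro i hi
        simp only [Cmd.step, IExp.eval, RExp.eval, updateCell_same, (hf₁.iv 5 (by decide)).trans h5,
          h₁, updateCell_of_ne _ (show (4 : ℕ) ≠ 5 by decide),
          updateCell_of_ne _ (show (5 : ℕ) ≠ 4 by decide), hf₁.ra 4 (by decide),
          hf₁.ra 5 (by decide), and_true, ← hv, coe_coe_inj, Nat.cast_one]
        by_cases hiv : i = v
        · simp [hiv]
        · have : ((i : Fin n) : ℕ) ≠ v := fun h => hiv ((coe_coe_inj i v).1 h)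
          simp only [hiv, if_false]
          exact hI i (by omega)
      obtain ⟨t, σ'', hex, ht, hq⟩ := hrun
      refine ⟨_, σ'', Exec.branchTrue ?_ hex, ?_, hq⟩
      · simp [BExp.Holds, IExp.eval, h5, hFm, hmF]
      · simp only [BExp.cost, IExp.cost]; omega
  · simp only [IExp.cost]
    have h3 : n + 1 ≤ (F.card + 1) * (n + 1) := Nat.le_mul_of_pos_left _ (by omega)
    have h2 : (n + 1) * (30 * (F.card + 1) + 16 + 1 + 7) =
      30 * ((F.card + 1) * (n + 1)) + 24 * (n + 1) := by ring
    omega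
  · intro σ' _ hI i
    exact hI i (i : Fin n).2

theorem run_loadEdge {σ : Mem} {r a b : ℕ} (h5 : σ.iv 5 = r) (h0 : σ.ia 1 r 0 = a)
    (h1 : σ.ia 1 r 1 = b) : Run loadEdge σ 10 fun σ' => σ'.iv 9 = a ∧ σ'.iv 10 = b :=
  Run.straight rfl (by decide) (by simp [loadEdge, Cmd.step, IExp.eval, h5, h0, h1])

open Classical in
-- The diagonal formula is a sum over neighbours, so each edge adds one term at either end. The only
-- costly part is its conditional covariance, an inner product of length k.
theorem run_fillEdges {σ : Mem} {S : Matrix (Fin n) (Fin n) ℝ}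
    {e : Fin F.card ≃ {i // i ∈ F}} (h : IsSwept σ S e) (hS : S.PosDef)
    {P : Matrix {i // i ∉ F} {i // i ∉ F} ℝ} (hP : P = conditionalCov F S)
    (h4 : ∀ i : {i // i ∉ F}, σ.ra 4 (i : Fin n) 0 = P i i ∧ σ.ra 5 (i : Fin n) 0 = 1 / P i i)
    {m : ℕ} (hm : σ.iv 2 = m) (hmn : m ≤ n) {E : SimpleGraph {i // i ∉ F}}
    {u v : Fin m → {i // i ∉ F}} (huv : EdgeEnum E u v)
    (h1 : ∀ r : Fin m, σ.ia 1 r 0 = (u r : Fin n) ∧ σ.ia 1 r 1 = (v r : Fin n)) :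
    Run fillEdges σ (120 * ((F.card + 1) * (n + 1))) fun σ' =>
      (∀ i : {i // i ∉ F}, σ'.ra 5 (i : Fin n) 0 = 1 / P i i +
        ∑ j, if E.Adj i j then P i j ^ 2 / (P i i * (P i i * P j j - P i j ^ 2)) else 0) ∧
      ∀ r : Fin m, σ'.ra 6 r 0 = -P (u r) (v r) /
        (P (u r) (u r) * P (v r) (v r) - P (u r) (v r) ^ 2) := by
  have hsymm : ∀ i j, P i j = P j i := by
    rw [hP]; exact PosDef.apply_comm (conditionalCov_posDef hS)
  let g : {i // i ∉ F} → {i // i ∉ F} → ℝ := fun i j =>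
    P i j ^ 2 / (P i i * (P i i * P j j - P i j ^ 2))
  let f : {i // i ∉ F} → Fin m → ℝ := fun i r =>
    (if u r = i then g (u r) (v r) else 0) + if v r = i then g (v r) (u r) else 0
  refine (Run.forLoop (N := m) (B := 10 + (30 * (F.card + 1) + 70)) (fun t σ' =>
      (∀ i : {i // i ∉ F}, σ'.ra 5 (i : Fin n) 0 = 1 / P i i +
        ∑ r : Fin m, if (r : ℕ) < t then f i r else 0) ∧
      ∀ r : Fin m, (r : ℕ) < t → σ'.ra 6 r 0 = -P (u r) (v r) /
        (P (u r) (u r) * P (v r) (v r) - P (u r) (v r) ^ 2))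
    (by decide) ?_ ?_ (fun _ _ _ h => h) ?_ ?_).mono le_rfl ?_
  · intro σ' hf'
    exact (hf'.iv 2 (by decide)).trans hm
  · refine ⟨fun i => ?_, fun r hr => by omega⟩
    rw [(h4 i).2]
    simp
  · rintro t ht σ' hf' h5 ⟨hI, hI'⟩
    have h' := h.frame hf' (by decide)
    have e1 : σ'.ia 1 = σ.ia 1 := hf'.ia 1 (by decide)
    obtain ⟨r, hr⟩ : ∃ r : Fin m, (r : ℕ) = t := ⟨⟨t, ht⟩, rfl⟩
    refine Run.seq (run_loadEdge (a := (u r : Fin n)) (b := (v r : Fin n)) h5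
      (by rw [e1, ← hr]; exact (h1 r).1) (by rw [e1, ← hr]; exact (h1 r).2)) ?_ le_rfl
    rintro σ₁ hf₁ ⟨h9, h10⟩
    refine Run.seq ((h'.frame hf₁ (by decide)).run_residual hS (by decide) (by decide) h9 h10)
      (T₂ := 70) ?_ le_rfl
    intro σ₂ hf₂ h₂
    rw [← hP] at h₂
    refine Run.straight rfl (by decide) ?_
    have d5 : σ₂.iv 5 = r := by rw [hf₂.iv 5 (by decide), hf₁.iv 5 (by decide), h5, hr]
    have d9 := (hf₂.iv 9 (by decide)).trans h9
    have d10 := (hf₂.iv 10 (by decide)).trans h10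
    have d4 : ∀ i : {i // i ∉ F}, σ₂.ra 4 (i : Fin n) 0 = P i i := fun i => by
      rw [hf₂.ra 4 (by decide), hf₁.ra 4 (by decide), hf'.ra 4 (by decide)]
      exact (h4 i).1
    have c5 : σ₂.ra 5 = σ'.ra 5 := (hf₂.ra 5 (by decide)).trans (hf₁.ra 5 (by decide))
    have c6 : σ₂.ra 6 = σ'.ra 6 := (hf₂.ra 6 (by decide)).trans (hf₁.ra 6 (by decide))
    have hne := (huv.adj r).ne
    refine ⟨fun i => ?_, fun s hs => ?_⟩
    · have hsum := sum_fin_lt_succ (f i) r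
      rw [hr] at hsum
      rw [hsum, ← add_assoc, ← hI i]
      simp only [edgeUpdate, Cmd.step, IExp.eval, RExp.eval, updateCell_same, Function.update_self,
        updateCell_of_ne _ (show (4 : ℕ) ≠ 5 by decide),
        updateCell_of_ne _ (show (4 : ℕ) ≠ 6 by decide),
        updateCell_of_ne _ (show (5 : ℕ) ≠ 6 by decide), d9, d10, d4, h₂, c5, coe_coe_inj,
        and_true, if_neg hne.symm, f, g,
        Function.update_of_ne (show (0 : ℕ) ≠ 1 by decide)]
      by_cases hiu : i = u r
      · simp only [hiu, hne, hne.symm, if_true, if_false]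
        ring
      · have hiu' : ¬ u r = i := fun h => hiu h.symm
        by_cases hiv : i = v r
        · simp only [hiv, hne, hne.symm, if_true, if_false, hsymm (v r) (u r)]
          ring
        · have hiv' : ¬ v r = i := fun h => hiv h.symm
          simp only [hiu, hiu', hiv, hiv', if_false]
          ring
    · simp only [edgeUpdate, Cmd.step, IExp.eval, RExp.eval, updateCell_same, Function.update_self,
        updateCell_of_ne _ (show (6 : ℕ) ≠ 5 by decide), d9, d10, d4, d5, h₂, c6,
        and_true, Function.update_of_ne (show (0 : ℕ) ≠ 1 by decide), Nat.cast_zero, zero_sub]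
      by_cases hsr : s = r
      · rw [if_pos (by rw [hsr]), hsr, sq]
      · have : (s : ℕ) ≠ r := fun h => hsr (Fin.ext h)
        rw [if_neg this]
        exact hI' s (by omega)
  · simp only [IExp.cost]
    have h3 : n + 1 ≤ (F.card + 1) * (n + 1) := Nat.le_mul_of_pos_left _ (by omega)
    calc (m + 1) * (10 + (30 * (F.card + 1) + 70) + 1 + 7)
        ≤ (n + 1) * (10 + (30 * (F.card + 1) + 70) + 1 + 7) := by gcongr
      _ = 30 * ((F.card + 1) * (n + 1)) + 88 * (n + 1) := by ring
      _ ≤ _ := by omega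
  · rintro σ' - ⟨hI, hI'⟩
    refine ⟨fun i => ?_, fun r => hI' r r.2⟩
    rw [hI i, ← huv.sum_ite_eq g i]
    congr 1
    exact Finset.sum_congr rfl fun r _ => if_pos r.2

end

section

variable {n : ℕ} {F : Finset (Fin n)}

/-- Sparse product P⁻¹ X: the diagonal contributes first, then every edge adds its entry in both
orientations, at cost k per edge. -/
theorem run_fillCross {σ : Mem} {S : Matrix (Fin n) (Fin n) ℝ}
    {e : Fin F.card ≃ {i // i ∈ F}} (h : IsSwept σ S e) (hS : S.PosDef)
    {X : Matrix {i // i ∉ F} {i // i ∈ F} ℝ} (hX : X = blockM F S * (blockF F S)⁻¹)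
    {Q : Matrix {i // i ∉ F} {i // i ∉ F} ℝ}
    (h5 : ∀ i : {i // i ∉ F}, σ.ra 5 (i : Fin n) 0 = Q i i)
    {m : ℕ} (hm : σ.iv 2 = m) (hmn : m ≤ n) {E : SimpleGraph {i // i ∉ F}}
    {u v : Fin m → {i // i ∉ F}} (huv : EdgeEnum E u v)
    (h1 : ∀ r : Fin m, σ.ia 1 r 0 = (u r : Fin n) ∧ σ.ia 1 r 1 = (v r : Fin n))
    (h6 : ∀ r : Fin m, σ.ra 6 r 0 = Q (u r) (v r)) (hQ : ∀ i j, Q i j = Q j i)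
    (hQ0 : ∀ i j, i ≠ j → ¬ E.Adj i j → Q i j = 0) :
    Run fillCross σ (100 * ((F.card + 1) * (n + 1))) fun σ' =>
      ∀ (i : {i // i ∉ F}) (a : Fin F.card), σ'.ra 7 (i : Fin n) a = ∑ j, Q i j * X j (e a) := by
  classical
  let f : {i // i ∉ F} → Fin F.card → Fin m → ℝ := fun i a r =>
    (if u r = i then Q (u r) (v r) * X (v r) (e a) else 0) +
      if v r = i then Q (v r) (u r) * X (u r) (e a) else 0
  refine Run.seq (Run.fillRect (A := 7) (N := n) (M := F.card) (B := 10)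
    (fun i a => σ.ra 5 i 0 * σ.ra 3 a i) (by decide) (by decide) ?_ ?_ ?_ le_rfl)
    (T₂ := (n + 1) * ((F.card + 1) * 38 + 18)) ?_ ?_
  · intro σ' hf'
    exact (hf'.iv 0 (by decide)).trans h.fvs.1
  · intro σ' hf'
    exact (hf'.iv 1 (by decide)).trans h.fvs.2.1
  · intro i hi a ha σ' hf' hx hy hI
    refine Run.straight rfl (by decide) fun i' a' => ?_
    simp only [Cmd.step, IExp.eval, RExp.eval, updateCell_same, hx, hy, hf'.ra 5 (by decide),
      hf'.ra 3 (by decide)]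
  · intro σ₁ hf₁ h₁
    have g₁ := h.frame hf₁ (by decide)
    refine (Run.forLoop (N := m) (B := 10 + (F.card + 1) * 38) (fun t σ' =>
      ∀ (i : {i // i ∉ F}) (a : Fin F.card), σ'.ra 7 (i : Fin n) a = Q i i * X i (e a) +
        ∑ r : Fin m, if (r : ℕ) < t then f i a r else 0)
      (by decide) ?_ ?_ (fun _ _ _ h => h) ?_ ?_).mono le_rfl ?_
    · intro σ' hf'
      exact (hf'.iv 2 (by decide)).trans ((hf₁.iv 2 (by decide)).trans hm)
    · intro i a
      rw [h₁, if_pos ⟨(i : Fin n).2, a.2⟩, h5, h.apply_notMem hS, hX]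
      simp
    · rintro t ht σ' hf' hx hI
      have e1 : σ'.ia 1 = σ.ia 1 := (hf'.ia 1 (by decide)).trans (hf₁.ia 1 (by decide))
      have e6 : σ'.ra 6 = σ.ra 6 := (hf'.ra 6 (by decide)).trans (hf₁.ra 6 (by decide))
      obtain ⟨r, hr⟩ : ∃ r : Fin m, (r : ℕ) = t := ⟨⟨t, ht⟩, rfl⟩
      refine Run.seq (run_loadEdge (a := (u r : Fin n)) (b := (v r : Fin n)) hx
        (by rw [e1, ← hr]; exact (h1 r).1) (by rw [e1, ← hr]; exact (h1 r).2)) ?_ le_rfl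
      rintro σ₂ hf₂ ⟨h9, h10⟩
      have g₂ := (g₁.frame hf' (by decide)).frame hf₂ (by decide)
      have hne := (huv.adj r).ne
      refine (Run.forLoop (N := F.card) (B := 30) (fun b σ'' =>
        ∀ (i : {i // i ∉ F}) (a : Fin F.card), σ''.ra 7 (i : Fin n) a =
          σ'.ra 7 (i : Fin n) a + if (a : ℕ) < b then f i a r else 0)
        (by decide) ?_ ?_ (fun _ _ _ h => h) ?_ ?_).mono le_rfl ?_
      · intro σ'' hf''
        exact (hf''.iv 1 (by decide)).trans g₂.fvs.2.1
      · intro i a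
        simp [hf₂.ra 7 (by decide)]
      · intro b hb σ'' hf'' hy hI''
        have g₃ := g₂.frame hf'' (by decide)
        refine Run.straight rfl (by decide) fun i a => ?_
        have d9 := (hf''.iv 9 (by decide)).trans h9
        have d10 := (hf''.iv 10 (by decide)).trans h10
        have d5 : σ''.iv 5 = r := by rw [hf''.iv 5 (by decide), hf₂.iv 5 (by decide), hx, hr]
        have d6 : σ''.ra 6 r 0 = Q (u r) (v r) := by
          rw [hf''.ra 6 (by decide), hf₂.ra 6 (by decide), e6, h6]
        obtain ⟨c, rfl⟩ : ∃ c : Fin F.card, (c : ℕ) = b := ⟨⟨b, hb⟩, rfl⟩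
        have z1 : ∀ j : {i // i ∉ F}, σ''.ra 3 c (j : Fin n) = X j (e c) := fun j => by
          rw [g₃.apply_notMem hS, hX]
        have hfin : ((a : ℕ) = c) = (a = c) := propext Fin.ext_iff.symm
        simp only [Cmd.step, IExp.eval, RExp.eval, updateCell_same, d9, d10, d5, d6, hy,
          updateCell_of_ne _ (show (3 : ℕ) ≠ 7 by decide),
          updateCell_of_ne _ (show (6 : ℕ) ≠ 7 by decide), z1, coe_coe_inj, hfin, hI'']
        by_cases hac : a = c
        · subst hac
          have hlt : (a : ℕ) < a + 1 := Nat.lt_succ_self _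
          simp only [and_true, lt_irrefl, if_false, hlt, if_true, add_zero, f]
          by_cases hiu : i = u r
          · simp only [hiu, hne, hne.symm, if_true, if_false, add_zero]
          · have hiu' : ¬ u r = i := fun h => hiu h.symm
            by_cases hiv : i = v r
            · simp only [hiv, hne, hne.symm, if_true, if_false, zero_add, hQ (v r) (u r)]
            · have hiv' : ¬ v r = i := fun h => hiv h.symm
              simp only [hiu, hiu', hiv, hiv', if_false, add_zero]
        · have hne : (a : ℕ) ≠ c := fun h => hac (Fin.ext h)
          have hlt : (a : ℕ) < c + 1 ↔ (a : ℕ) < c := by omega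
          simp only [hac, and_false, if_false, hlt]
      · simp only [IExp.cost]; omega
      · intro σ'' _ hI'' i a
        have hsum := sum_fin_lt_succ (f i a) r
        rw [hr] at hsum
        rw [hI'', if_pos a.2, hI, hsum, add_assoc]
    · simp only [IExp.cost]
      exact Nat.mul_le_mul (by omega) (by omega)
    · intro σ' _ hI i a
      rw [hI]
      have hsum := huv.sum_ite_eq (fun i j => Q i j * X j (e a)) i
      have h2 : ∑ r : Fin m, (if (r : ℕ) < m then f i a r else 0) =
          ∑ j, if E.Adj i j then Q i j * X j (e a) else 0 := by
        rw [← hsum]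
        exact Finset.sum_congr rfl fun r _ => if_pos r.2
      -- Separate the diagonal term; the other entries of `Q` off the tree vanish by `hQ0`.
      rw [h2, ← Finset.add_sum_erase _ _ (Finset.mem_univ i),
        ← Finset.add_sum_erase (Finset.univ) (fun j => Q i j * X j (e a)) (Finset.mem_univ i)]
      simp only [SimpleGraph.irrefl, if_false, zero_add]
      congr 1
      refine Finset.sum_congr rfl fun j hj => ?_
      have hij : i ≠ j := (Finset.ne_of_mem_erase hj).symm
      split_ifs with hadj
      · rfl
      · rw [hQ0 i j hij hadj, zero_mul]
  · simp only [IExp.cost]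
    have h3 : n + 1 ≤ (F.card + 1) * (n + 1) := Nat.le_mul_of_pos_left _ (by omega)
    have h2 : (n + 1) * ((F.card + 1) * (10 + 1 + 7) + 1 + 7) +
        (n + 1) * ((F.card + 1) * 38 + 18) = 56 * ((F.card + 1) * (n + 1)) + 26 * (n + 1) := by
      ring
    omega

theorem sum_range_ite_notMem (F : Finset (Fin n)) (f : ℕ → ℝ) (I : ℕ → ℕ)
    (hI : ∀ i : Fin n, I i = if i ∈ F then 1 else 0) :
    ∑ i ∈ Finset.range n, (if I i = 0 then f i else 0) = ∑ i : {i // i ∉ F}, f (i : Fin n) := by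
  rw [Finset.sum_range, ← Finset.sum_subtype (Finset.univ.filter fun i => i ∉ F) (by simp)
    (fun i : Fin n => f i), Finset.sum_filter]
  refine Finset.sum_congr rfl fun i _ => ?_
  rw [hI]
  by_cases hi : i ∈ F <;> simp [hi]

/-- There are k² entries, each an inner product over the vertices outside `F`; this is the second
step of cost k²n besides the elimination. The summand from the inverse block stands in the last k
columns of array 3. -/
theorem run_fillFeedback {σ : Mem} {S : Matrix (Fin n) (Fin n) ℝ}
    {e : Fin F.card ≃ {i // i ∈ F}} (h : IsSwept σ S e) (hS : S.PosDef)
    {X N : Matrix {i // i ∉ F} {i // i ∈ F} ℝ} (hX : X = blockM F S * (blockF F S)⁻¹)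
    (hN : ∀ (i : {i // i ∉ F}) (a : Fin F.card), σ.ra 7 (i : Fin n) a = N i (e a)) :
    Run fillFeedback σ (60 * ((F.card + 1) ^ 2 * (n + 1))) fun σ' =>
      ∀ a b : Fin F.card, σ'.ra 8 a b = ((blockF F S)⁻¹ + Xᵀ * N) (e a) (e b) := by
  obtain ⟨h0, h1, hF⟩ := h.fvs
  refine (Run.fillRect (A := 8) (N := F.card) (M := F.card) (B := 6 + ((n + 1) * 32 + 4))
    (fun a b => σ.ra 3 a (n + b) + ∑ i ∈ Finset.range n,
      if σ.ia 0 i 0 = 0 then σ.ra 3 a i * σ.ra 7 i b else 0)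
    (by decide) (by decide) ?_ ?_ ?_ ?_).mono le_rfl ?_
  · intro σ' hf'
    exact (hf'.iv 1 (by decide)).trans h1
  · intro σ' hf'
    exact (hf'.iv 1 (by decide)).trans h1
  · intro a ha b hb σ' hf' hx hy hI
    have e0 := (hf'.iv 0 (by decide)).trans h0
    have e3 : σ'.ra 3 = σ.ra 3 := hf'.ra 3 (by decide)
    have e7 : σ'.ra 7 = σ.ra 7 := hf'.ra 7 (by decide)
    have ei : σ'.ia 0 = σ.ia 0 := hf'.ia 0 (by decide)
    refine Run.seq (T₁ := 6) (P := fun σ'' => σ''.rv 0 = σ.ra 3 a (n + b))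
      (Run.straight rfl (by decide) ?_) ?_ le_rfl
    · simp [Cmd.step, IExp.eval, RExp.eval, hx, hy, e0, e3]
    intro σ₁ hf₁ h₁
    refine Run.seq (Run.forLoop (N := n) (B := 24) (fun t σ'' => σ''.rv 0 = σ.ra 3 a (n + b) +
      ∑ i ∈ Finset.range t, if σ.ia 0 i 0 = 0 then σ.ra 3 a i * σ.ra 7 i b else 0)
      (by decide) ?_ ?_ (fun _ _ _ h => h) ?_ ?_) (T₂ := 4) ?_ le_rfl
    · intro σ'' hf''
      exact (hf''.iv 0 (by decide)).trans ((hf₁.iv 0 (by decide)).trans e0)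
    · simpa using h₁
    · intro t ht σ'' hf'' hz hI''
      refine Run.straight rfl (by decide) ?_
      have d5 := (hf''.iv 5 (by decide)).trans ((hf₁.iv 5 (by decide)).trans hx)
      have d6 := (hf''.iv 6 (by decide)).trans ((hf₁.iv 6 (by decide)).trans hy)
      have d3 : σ''.ra 3 = σ.ra 3 :=
        (hf''.ra 3 (by decide)).trans ((hf₁.ra 3 (by decide)).trans e3)
      have d7 : σ''.ra 7 = σ.ra 7 :=
        (hf''.ra 7 (by decide)).trans ((hf₁.ra 7 (by decide)).trans e7)
      have d0 : σ''.ia 0 = σ.ia 0 :=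
        (hf''.ia 0 (by decide)).trans ((hf₁.ia 0 (by decide)).trans ei)
      rw [Finset.sum_range_succ, ← add_assoc, ← hI'']
      by_cases hc : σ.ia 0 t 0 = 0
      · simp [Cmd.step, BExp.Holds, IExp.eval, RExp.eval, d5, d6, d3, d7, d0, hz, hc]
      · simp [Cmd.step, BExp.Holds, IExp.eval, d0, hz, hc]
    · simp only [IExp.cost]; omega
    · intro σ₂ hf₂ h₂
      refine Run.straight rfl (by decide) fun a' b' => ?_
      simp only [Cmd.step, IExp.eval, RExp.eval, updateCell_same, h₂,
        hf₂.iv 5 (by decide), hf₁.iv 5 (by decide), hx, hf₂.iv 6 (by decide),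
        hf₁.iv 6 (by decide), hy, hf₂.ra 8 (by decide), hf₁.ra 8 (by decide)]
  · simp only [IExp.cost]
    have h2 : (F.card + 1) * ((F.card + 1) * (6 + ((n + 1) * 32 + 4) + 1 + 7) + 1 + 7) =
      32 * ((F.card + 1) ^ 2 * (n + 1)) + 18 * (F.card + 1) ^ 2 + 8 * (F.card + 1) := by ring
    have h3 : (F.card + 1) ^ 2 ≤ (F.card + 1) ^ 2 * (n + 1) :=
      Nat.le_mul_of_pos_right _ (by omega)
    have h4 : F.card + 1 ≤ (F.card + 1) ^ 2 := Nat.le_self_pow two_ne_zero _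
    omega
  · intro σ' _ hg a b
    rw [hg, if_pos ⟨a.2, b.2⟩, h.apply_add, Matrix.add_apply, Matrix.mul_apply,
      sum_range_ite_notMem F (fun i => σ.ra 3 a i * σ.ra 7 i b) (fun i => σ.ia 0 i 0) hF]
    congr 1
    refine Finset.sum_congr rfl fun i _ => ?_
    rw [h.apply_notMem hS, hN, hX]
    rfl

end

/-! ### The information matrix: output -/

/-- Appends an entry to the output list. -/
def emit (i j : IExp) (v : RExp) : Cmd :=
  .seq (.iput 2 (.var 3) (.lit 0) i) <| .seq (.iput 2 (.var 3) (.lit 1) j) <|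
  .seq (.rput 2 (.var 3) (.lit 0) v) (.iset 3 (.add (.var 3) (.lit 1)))

/-- The memory holds a list of entries of `J` that contains the positions in `s`. -/
def Mem.Lists (σ : Mem) {n : ℕ} (J : Matrix (Fin n) (Fin n) ℝ) (s : Set (Fin n × Fin n)) : Prop :=
  (∀ r < σ.iv 3, ∃ i j : Fin n, σ.ia 2 r 0 = i ∧ σ.ia 2 r 1 = j ∧ σ.ra 2 r 0 = J i j) ∧
  ∀ p ∈ s, ∃ r < σ.iv 3, σ.ia 2 r 0 = (p.1 : Fin n) ∧ σ.ia 2 r 1 = (p.2 : Fin n)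

section

variable {n : ℕ}

theorem Mem.Lists.mono {σ : Mem} {J : Matrix (Fin n) (Fin n) ℝ} {s s' : Set (Fin n × Fin n)}
    (h : σ.Lists J s) (hs : s' ⊆ s) : σ.Lists J s' :=
  ⟨h.1, fun p hp => h.2 p (hs hp)⟩

/-- The locations that are changed by output. -/
def emitWrites : List (ℕ × ℕ) := [(2, 2), (2, 2), (3, 2), (0, 3)]

/-- The second index and the value are evaluated after parts of the output have been written, so
they must be stable under such writes. Besides the expressions, the three writes cost 3 each and the
increment of the length costs 4, hence 13. -/
theorem run_emit {σ : Mem} {J : Matrix (Fin n) (Fin n) ℝ} {s : Set (Fin n × Fin n)}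
    (h : σ.Lists J s) {i j : IExp} {v : RExp} {i' j' : Fin n}
    (hi : i.eval σ = i') (hj : ∀ σ', Frame emitWrites σ σ' → j.eval σ' = j')
    (hv : ∀ σ', Frame emitWrites σ σ' → v.eval σ' = J i' j') {T : ℕ}
    (hT : i.cost + j.cost + v.cost + 13 ≤ T) :
    Run (emit i j v) σ T fun σ' => σ'.Lists J (s ∪ {(i', j')}) := by
  refine Run.straight rfl (by simp only [emit, Cmd.maxCost, IExp.cost]; omega) ?_
  have e1 : j.eval { σ with ia := updateCell σ.ia 2 (σ.iv 3) 0 i' } = j' := by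
    refine hj _ ⟨fun _ _ => rfl, fun _ _ => rfl, fun a ha => ?_, fun _ _ => rfl⟩
    exact updateCell_of_ne _ (by rintro rfl; exact ha (by decide)) _ _ _
  have e2 : v.eval { σ with
      ia := updateCell (updateCell σ.ia 2 (σ.iv 3) 0 i') 2 (σ.iv 3) 1 j' } = J i' j' := by
    refine hv _ ⟨fun _ _ => rfl, fun _ _ => rfl, fun a ha => ?_, fun _ _ => rfl⟩
    have : a ≠ 2 := by rintro rfl; exact ha (by decide)
    simp only [updateCell_of_ne _ this]
  have hstep : (emit i j v).step σ = ⟨Function.update σ.iv 3 (σ.iv 3 + 1), σ.rv,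
      updateCell (updateCell σ.ia 2 (σ.iv 3) 0 i') 2 (σ.iv 3) 1 j',
      updateCell σ.ra 2 (σ.iv 3) 0 (J i' j')⟩ := by
    simp only [emit, Cmd.step, IExp.eval, hi, e1, e2]
  rw [hstep]
  refine ⟨fun r hr => ?_, fun p hp => ?_⟩
  · simp only [Function.update_self] at hr
    simp only [updateCell_same]
    by_cases hr' : r = σ.iv 3
    · exact ⟨i', j', by simp [hr'], by simp [hr'], by simp [hr']⟩
    · obtain ⟨a, b, h1, h2, h3⟩ := h.1 r (by omega)
      exact ⟨a, b, by simp [hr', h1], by simp [hr', h2], by simp [hr', h3]⟩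
  · simp only [Function.update_self, updateCell_same]
    rcases hp with hp | hp
    · obtain ⟨r, hr, h1, h2⟩ := h.2 p hp
      exact ⟨r, by omega, by simp [hr.ne, h1], by simp [hr.ne, h2]⟩
    · rw [Set.mem_singleton_iff] at hp
      subst hp
      exact ⟨σ.iv 3, by omega, by simp, by simp⟩

/-- A loop that writes output. -/
theorem Run.forLoop_lists {x : ℕ} {e : IExp} {body : Cmd} {σ : Mem} {N B T : ℕ}
    {J : Matrix (Fin n) (Fin n) ℝ} {s : Set (Fin n × Fin n)} (t : ℕ → Set (Fin n × Fin n))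
    (hx : (0, x) ∉ body.writes) (hx3 : x ≠ 3)
    (he : ∀ σ', Frame (FVSLearning.forLoop x e body).writes σ σ' → e.eval σ' = N)
    (h : σ.Lists J s)
    (hs : ∀ i < N, ∀ σ' s', Frame (FVSLearning.forLoop x e body).writes σ σ' → σ'.iv x = i →
      σ'.Lists J s' → Run body σ' B fun σ'' => σ''.Lists J (s' ∪ t i))
    (hT : (N + 1) * (B + e.cost + 7) ≤ T) :
    Run (FVSLearning.forLoop x e body) σ T fun σ' =>
      σ'.Lists J (s ∪ {p | ∃ i < N, p ∈ t i}) := by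
  refine Run.forLoop (fun i σ' => σ'.Lists J (s ∪ {p | ∃ i' < i, p ∈ t i'})) hx he ?_ ?_ ?_ hT
  · exact h.mono (by simp)
  · intro i σ' v hI
    simpa [Mem.Lists, Function.update_of_ne hx3.symm] using hI
  · intro i hi σ' hf hxi hI
    refine (hs i hi σ' _ hf hxi hI).mono le_rfl fun σ'' _ h' => h'.mono ?_
    rintro p (hp | ⟨i', hi', hp⟩)
    · exact Or.inl (Or.inl hp)
    · rcases Nat.lt_succ_iff_lt_or_eq.1 hi' with h1 | rfl
      · exact Or.inl (Or.inr ⟨i', h1, hp⟩)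
      · exact Or.inr hp

/-- Output of the diagonal entries outside `F`. -/
def emitDiagonal : Cmd :=
  forLoop 5 (.var 0) (.branch (.ieq (.get 0 (.var 5) (.lit 0)) (.lit 0))
    (emit (.var 5) (.var 5) (.get 5 (.var 5) (.lit 0))) .skip)

/-- Output of the entries for the edges. -/
def emitEdges : Cmd :=
  forLoop 5 (.var 2) (.seq
    (emit (.get 1 (.var 5) (.lit 0)) (.get 1 (.var 5) (.lit 1)) (.get 6 (.var 5) (.lit 0)))
    (emit (.get 1 (.var 5) (.lit 1)) (.get 1 (.var 5) (.lit 0)) (.get 6 (.var 5) (.lit 0))))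

/-- Output of the entries for the pairs of a vertex outside `F` and a vertex in `F`. -/
def emitCross : Cmd :=
  forLoop 5 (.var 0) (.branch (.ieq (.get 0 (.var 5) (.lit 0)) (.lit 0))
    (forLoop 6 (.var 1) (.seq
      (emit (.var 5) (.get 3 (.var 6) (.lit 0)) (.sub (.lit 0) (.get 7 (.var 5) (.var 6))))
      (emit (.get 3 (.var 6) (.lit 0)) (.var 5) (.sub (.lit 0) (.get 7 (.var 5) (.var 6))))))
    .skip)

/-- Output of the entries for pairs in `F`. -/
def emitFeedback : Cmd :=
  forLoop 5 (.var 1) (forLoop 6 (.var 1)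
    (emit (.get 3 (.var 5) (.lit 0)) (.get 3 (.var 6) (.lit 0)) (.get 8 (.var 5) (.var 6))))

/-- The computation of the information matrix. -/
def invert : Cmd :=
  .seq listFVS <| .seq (sweep 1) <| .seq fillDiagonal <| .seq fillEdges <| .seq fillCross <|
  .seq fillFeedback <| .seq (.iset 3 (.lit 0)) <| .seq emitDiagonal <| .seq emitEdges <|
  .seq emitCross emitFeedback

variable {F : Finset (Fin n)} {J : Matrix (Fin n) (Fin n) ℝ}

/-- A branch for the vertices outside `F`. -/
theorem Run.branch_notMem {σ : Mem} {s : Set (Fin n × Fin n)} {c : Cmd} {B : ℕ} {i : ℕ}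
    (hF : ∀ i : Fin n, σ.ia 0 i 0 = if i ∈ F then 1 else 0) (hi : i < n) (h5 : σ.iv 5 = i)
    (h : σ.Lists J s) (t : {i // i ∉ F} → Set (Fin n × Fin n))
    (hc : ∀ v : {i // i ∉ F}, ((v : Fin n) : ℕ) = i →
      Run c σ B fun σ' => σ'.Lists J (s ∪ t v)) :
    Run (.branch (.ieq (.get 0 (.var 5) (.lit 0)) (.lit 0)) c .skip) σ (B + 8) fun σ' =>
      σ'.Lists J (s ∪ {p | ∃ v : {i // i ∉ F}, ((v : Fin n) : ℕ) = i ∧ p ∈ t v}) := by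
  have hFi := hF ⟨i, hi⟩
  simp only at hFi
  by_cases hiF : (⟨i, hi⟩ : Fin n) ∈ F
  · refine ⟨_, σ, Exec.branchFalse ?_ (Exec.skip _), ?_, h.mono ?_⟩
    · simp [BExp.Holds, IExp.eval, h5, hFi, hiF]
    · simp only [BExp.cost, IExp.cost]; omega
    · rintro p (hp | ⟨v, hv, -⟩)
      · exact hp
      · exact absurd (by convert hiF) v.2
  · obtain ⟨t', σ', hex, ht, hq⟩ := hc ⟨⟨i, hi⟩, hiF⟩ rfl
    refine ⟨_, σ', Exec.branchTrue ?_ hex, ?_, hq.mono ?_⟩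
    · simp [BExp.Holds, IExp.eval, h5, hFi, hiF]
    · simp only [BExp.cost, IExp.cost]; omega
    · rintro p (hp | ⟨v, hv, hp⟩)
      · exact Or.inl hp
      · have : v = ⟨⟨i, hi⟩, hiF⟩ := Subtype.ext (Fin.ext hv)
        exact Or.inr (this ▸ hp)

theorem run_emitDiagonal {σ : Mem} {s : Set (Fin n × Fin n)} (h : σ.HoldsFVS F)
    (hl : σ.Lists J s) (h5 : ∀ i : {i // i ∉ F}, σ.ra 5 (i : Fin n) 0 = J i i) :
    Run emitDiagonal σ (40 * (n + 1)) fun σ' =>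
      σ'.Lists J (s ∪ {p | ∃ i : {i // i ∉ F}, p = ((i : Fin n), (i : Fin n))}) := by
  refine (Run.forLoop_lists (N := n) (B := 18 + 8)
    (fun i => {p | ∃ v : {i // i ∉ F}, ((v : Fin n) : ℕ) = i ∧ p ∈ ({((v : Fin n), (v : Fin n))} :
      Set (Fin n × Fin n))}) (by decide) (by decide) ?_ hl ?_
    (by simp only [IExp.cost]; omega)).mono le_rfl ?_
  · intro σ' hf
    exact (hf.iv 0 (by decide)).trans h.1
  · intro i hi σ' s' hf hx hl'
    refine Run.branch_notMem (fun i => by rw [hf.ia 0 (by decide)]; exact h.2.2 i) hi hx hl'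
      (fun v => {((v : Fin n), (v : Fin n))}) fun v hv => ?_
    refine run_emit hl' (by exact hx.trans hv.symm) (fun σ'' hf' => ?_) (fun σ'' hf' => ?_) (by decide)
    · exact (hf'.iv 5 (by decide)).trans (hx.trans hv.symm)
    · simp only [RExp.eval, IExp.eval, hf'.iv 5 (by decide), hf'.ra 5 (by decide),
        hf.ra 5 (by decide), hx, ← hv, h5]
  · intro σ' _ hl'
    refine hl'.mono (Set.union_subset_union_right _ ?_)
    rintro p ⟨v, rfl⟩
    exact ⟨(v : Fin n), (v : Fin n).2, v, rfl, rfl⟩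

theorem run_emitEdges {σ : Mem} {s : Set (Fin n × Fin n)} (hl : σ.Lists J s)
    {m : ℕ} (hm : σ.iv 2 = m) (hmn : m ≤ n) {E : SimpleGraph {i // i ∉ F}}
    {u v : Fin m → {i // i ∉ F}} (huv : EdgeEnum E u v)
    (h1 : ∀ r : Fin m, σ.ia 1 r 0 = (u r : Fin n) ∧ σ.ia 1 r 1 = (v r : Fin n))
    (h6 : ∀ r : Fin m, σ.ra 6 r 0 = J (u r) (v r) ∧ σ.ra 6 r 0 = J (v r) (u r)) :
    Run emitEdges σ (60 * (n + 1)) fun σ' =>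
      σ'.Lists J (s ∪ {p | ∃ i j, E.Adj i j ∧ p = ((i : Fin n), (j : Fin n))}) := by
  refine (Run.forLoop_lists (N := m) (B := 24 + 24)
    (fun i => {p | ∃ r : Fin m, (r : ℕ) = i ∧ (p = ((u r : Fin n), (v r : Fin n)) ∨
      p = ((v r : Fin n), (u r : Fin n)))}) (by decide) (by decide) ?_ hl ?_
    ?_).mono le_rfl ?_
  · intro σ' hf
    exact (hf.iv 2 (by decide)).trans hm
  · intro i hi σ' s' hf hx hl'
    obtain ⟨r, rfl⟩ : ∃ r : Fin m, (r : ℕ) = i := ⟨⟨i, hi⟩, rfl⟩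
    have g1 : ∀ w, (0, 5) ∉ w → (2, 1) ∉ w → (3, 6) ∉ w → ∀ σ'', Frame w σ' σ'' →
        σ''.ia 1 (σ''.iv 5) 0 = (u r : Fin n) ∧ σ''.ia 1 (σ''.iv 5) 1 = (v r : Fin n) ∧
        σ''.ra 6 (σ''.iv 5) 0 = J (u r) (v r) ∧ σ''.ra 6 (σ''.iv 5) 0 = J (v r) (u r) := by
      intro w hw1 hw2 hw3 σ'' hf'
      rw [hf'.iv 5 hw1, hf'.ia 1 hw2, hf'.ra 6 hw3, hx, hf.ia 1 (by decide), hf.ra 6 (by decide)]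
      exact ⟨(h1 r).1, (h1 r).2, (h6 r).1, (h6 r).2⟩
    have g2 := g1 emitWrites (by decide) (by decide) (by decide)
    refine Run.seq (run_emit hl' (i' := (u r : Fin n)) (j' := (v r : Fin n))
      (by exact (g2 σ' (Frame.refl _ _)).1) (fun σ'' hf' => by exact (g2 σ'' hf').2.1)
      (fun σ'' hf' => by exact (g2 σ'' hf').2.2.1) (by decide)) (T₂ := 24) ?_ le_rfl
    intro σ₁ hf₁ hl₁
    have g3 : ∀ σ'', Frame emitWrites σ₁ σ'' → Frame emitWrites σ' σ'' :=
      fun σ'' hf'' => Frame.trans hf₁ hf''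
    refine (run_emit hl₁ (i' := (v r : Fin n)) (j' := (u r : Fin n))
      (by exact (g2 σ₁ hf₁).2.1) (fun σ'' hf' => by exact (g2 σ'' (g3 σ'' hf')).1)
      (fun σ'' hf' => by exact (g2 σ'' (g3 σ'' hf')).2.2.2) (by decide)).mono le_rfl ?_
    intro σ₂ _ hl₂
    refine hl₂.mono ?_
    rintro p (hp | ⟨r', hr', hp⟩)
    · exact Or.inl (Or.inl hp)
    · rw [Fin.ext hr'] at hp
      rcases hp with hp | hp
      · exact Or.inl (Or.inr hp)
      · exact Or.inr hp
  · simp only [IExp.cost]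
    omega
  · intro σ' _ hl'
    refine hl'.mono (Set.union_subset_union_right _ ?_)
    rintro p ⟨i, j, hij, rfl⟩
    obtain ⟨r, hr⟩ := huv.surj i j hij
    refine ⟨r, r.2, r, rfl, ?_⟩
    rcases Sym2.eq_iff.1 hr with ⟨h1, h2⟩ | ⟨h1, h2⟩
    · left; rw [h1, h2]
    · right; rw [h1, h2]

theorem run_emitCross {σ : Mem} {s : Set (Fin n × Fin n)} (h : σ.HoldsFVS F)
    {e : Fin F.card ≃ {i // i ∈ F}} (he : σ.HoldsList e) (hl : σ.Lists J s)
    (h7 : ∀ (i : {i // i ∉ F}) (a : Fin F.card),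
      -σ.ra 7 (i : Fin n) a = J i (e a) ∧ -σ.ra 7 (i : Fin n) a = J (e a) i) :
    Run emitCross σ (90 * ((F.card + 1) * (n + 1))) fun σ' =>
      σ'.Lists J (s ∪ {p | ∃ (i : {i // i ∉ F}) (j : {i // i ∈ F}),
        p = ((i : Fin n), (j : Fin n)) ∨ p = ((j : Fin n), (i : Fin n))}) := by
  refine (Run.forLoop_lists (N := n) (B := (F.card + 1) * 68 + 8)
    (fun i => {p | ∃ v : {i // i ∉ F}, ((v : Fin n) : ℕ) = i ∧
      p ∈ {p : Fin n × Fin n | ∃ j : {i // i ∈ F},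
        p = ((v : Fin n), (j : Fin n)) ∨ p = ((j : Fin n), (v : Fin n))}})
    (by decide) (by decide) ?_ hl ?_ ?_).mono le_rfl ?_
  · intro σ' hf
    exact (hf.iv 0 (by decide)).trans h.1
  · intro i hi σ' s' hf hx hl'
    refine Run.branch_notMem (fun i => by rw [hf.ia 0 (by decide)]; exact h.2.2 i) hi hx hl'
      (fun v => {p : Fin n × Fin n | ∃ j : {i // i ∈ F},
        p = ((v : Fin n), (j : Fin n)) ∨ p = ((j : Fin n), (v : Fin n))}) fun w hw => ?_
    refine (Run.forLoop_lists (N := F.card) (B := 30 + 30)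
      (fun i => {p | ∃ a : Fin F.card, (a : ℕ) = i ∧ (p = ((w : Fin n), (e a : Fin n)) ∨
        p = ((e a : Fin n), (w : Fin n)))}) (by decide) (by decide) ?_ hl' ?_
      (by simp only [IExp.cost]; omega)).mono le_rfl ?_
    · intro σ'' hf'
      exact (hf'.iv 1 (by decide)).trans ((hf.iv 1 (by decide)).trans h.2.1)
    · intro b hb σ'' s'' hf' hy hl''
      obtain ⟨a, rfl⟩ : ∃ a : Fin F.card, (a : ℕ) = b := ⟨⟨b, hb⟩, rfl⟩
      have g2 : ∀ σ₁, Frame emitWrites σ'' σ₁ →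
          σ₁.iv 5 = (w : Fin n) ∧ σ₁.ia 3 (σ₁.iv 6) 0 = (e a : Fin n) ∧
          (0 : ℕ) - σ₁.ra 7 (σ₁.iv 5) (σ₁.iv 6) = J w (e a) ∧
          (0 : ℕ) - σ₁.ra 7 (σ₁.iv 5) (σ₁.iv 6) = J (e a) w := by
        intro σ₁ hf₁
        rw [hf₁.iv 5 (by decide), hf₁.iv 6 (by decide), hf₁.ia 3 (by decide),
          hf₁.ra 7 (by decide), hf'.iv 5 (by decide), hx, hy, hf'.ia 3 (by decide),
          hf'.ra 7 (by decide), hf.ia 3 (by decide), hf.ra 7 (by decide), ← hw, Nat.cast_zero,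
          zero_sub]
        exact ⟨rfl, he a, h7 w a⟩
      refine Run.seq (run_emit hl'' (i' := (w : Fin n)) (j' := (e a : Fin n))
        (by exact (g2 σ'' (Frame.refl _ _)).1) (fun σ'' hf' => by exact (g2 σ'' hf').2.1)
        (fun σ'' hf' => by exact (g2 σ'' hf').2.2.1) (by decide)) (T₂ := 30) ?_ le_rfl
      intro σ₁ hf₁ hl₁
      have g3 : ∀ σ₂, Frame emitWrites σ₁ σ₂ → Frame emitWrites σ'' σ₂ :=
        fun σ₂ hf₂ => Frame.trans hf₁ hf₂
      refine (run_emit hl₁ (i' := (e a : Fin n)) (j' := (w : Fin n))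
        (by exact (g2 σ₁ hf₁).2.1) (fun σ'' hf' => by exact (g2 σ'' (g3 σ'' hf')).1)
        (fun σ'' hf' => by exact (g2 σ'' (g3 σ'' hf')).2.2.2) (by decide)).mono le_rfl ?_
      intro σ₂ _ hl₂
      refine hl₂.mono ?_
      rintro p (hp | ⟨r', hr', hp⟩)
      · exact Or.inl (Or.inl hp)
      · rw [Fin.ext hr'] at hp
        rcases hp with hp | hp
        · exact Or.inl (Or.inr hp)
        · exact Or.inr hp
    · intro σ'' _ hl''
      refine hl''.mono (Set.union_subset_union_right _ ?_)
      rintro p ⟨j, hp⟩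
      obtain ⟨a, rfl⟩ := e.surjective j
      exact ⟨a, a.2, a, rfl, hp⟩
  · simp only [IExp.cost]
    have h3 : n + 1 ≤ (F.card + 1) * (n + 1) := Nat.le_mul_of_pos_left _ (by omega)
    have h2 : (n + 1) * ((F.card + 1) * 68 + 8 + 1 + 7) =
      68 * ((F.card + 1) * (n + 1)) + 16 * (n + 1) := by ring
    omega
  · intro σ' _ hl'
    refine hl'.mono (Set.union_subset_union_right _ ?_)
    rintro p ⟨v, j, hp⟩
    exact ⟨(v : Fin n), (v : Fin n).2, v, rfl, j, hp⟩

theorem run_emitFeedback {σ : Mem} {s : Set (Fin n × Fin n)} (h : σ.HoldsFVS F)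
    {e : Fin F.card ≃ {i // i ∈ F}} (he : σ.HoldsList e) (hl : σ.Lists J s)
    (h8 : ∀ a b : Fin F.card, σ.ra 8 a b = J (e a) (e b)) :
    Run emitFeedback σ (60 * (F.card + 1) ^ 2) fun σ' =>
      σ'.Lists J (s ∪ {p | ∃ i j : {i // i ∈ F}, p = ((i : Fin n), (j : Fin n))}) := by
  refine (Run.forLoop_lists (N := F.card) (B := (F.card + 1) * 32)
    (fun i => {p | ∃ b' < F.card, p ∈ {p : Fin n × Fin n | ∃ a b : Fin F.card, (a : ℕ) = i ∧
      (b : ℕ) = b' ∧ p = ((e a : Fin n), (e b : Fin n))}})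
    (by decide) (by decide) ?_ hl ?_ ?_).mono le_rfl ?_
  · intro σ' hf
    exact (hf.iv 1 (by decide)).trans h.2.1
  · intro i hi σ' s' hf hx hl'
    refine Run.forLoop_lists (N := F.card) (B := 24) (fun b' => {p | ∃ a b : Fin F.card,
      (a : ℕ) = i ∧ (b : ℕ) = b' ∧ p = ((e a : Fin n), (e b : Fin n))})
      (by decide) (by decide) ?_ hl' ?_ (by simp only [IExp.cost]; omega)
    · intro σ'' hf'
      exact (hf'.iv 1 (by decide)).trans ((hf.iv 1 (by decide)).trans h.2.1)
    · intro j hj σ'' s'' hf' hy hl''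
      have g2 : ∀ σ₁, Frame emitWrites σ'' σ₁ →
          σ₁.ia 3 (σ₁.iv 5) 0 = (e ⟨i, hi⟩ : Fin n) ∧
          σ₁.ia 3 (σ₁.iv 6) 0 = (e ⟨j, hj⟩ : Fin n) ∧
          σ₁.ra 8 (σ₁.iv 5) (σ₁.iv 6) = J (e ⟨i, hi⟩) (e ⟨j, hj⟩) := by
        intro σ₁ hf₁
        rw [hf₁.iv 5 (by decide), hf₁.iv 6 (by decide), hf₁.ia 3 (by decide),
          hf₁.ra 8 (by decide), hf'.iv 5 (by decide), hx, hy, hf'.ia 3 (by decide),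
          hf'.ra 8 (by decide), hf.ia 3 (by decide), hf.ra 8 (by decide)]
        exact ⟨he ⟨i, hi⟩, he ⟨j, hj⟩, h8 ⟨i, hi⟩ ⟨j, hj⟩⟩
      refine (run_emit hl'' (i' := (e ⟨i, hi⟩ : Fin n)) (j' := (e ⟨j, hj⟩ : Fin n))
        (by exact (g2 σ'' (Frame.refl _ _)).1) (fun σ'' hf' => by exact (g2 σ'' hf').2.1)
        (fun σ'' hf' => by exact (g2 σ'' hf').2.2) (by decide)).mono le_rfl ?_
      intro σ₁ _ hl₁
      refine hl₁.mono (Set.union_subset_union_right _ ?_)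
      rintro p ⟨a, b, rfl, rfl, rfl⟩
      rfl
  · simp only [IExp.cost]
    have h4 : F.card + 1 ≤ (F.card + 1) ^ 2 := Nat.le_self_pow two_ne_zero _
    have h2 : (F.card + 1) * ((F.card + 1) * 32 + 1 + 7) =
      32 * (F.card + 1) ^ 2 + 8 * (F.card + 1) := by ring
    omega
  · intro σ' _ hl'
    refine hl'.mono (Set.union_subset_union_right _ ?_)
    rintro p ⟨i, j, rfl⟩
    obtain ⟨a, rfl⟩ := e.surjective i
    obtain ⟨b, rfl⟩ := e.surjective j
    exact ⟨a, a.2, b, b.2, a, b, rfl, rfl, rfl⟩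

/-- The matrix `Sh` is not in memory; it only guarantees the tree structure of `S`. The inverse
conditional covariance comes from `inv_conditionalCov`, and `inv_blocks` expresses the whole
information matrix through it. -/
theorem run_invert {σ : Mem} {Sh S : Matrix (Fin n) (Fin n) ℝ} (hSh : Sh.PosDef)
    {E : SimpleGraph {i // i ∉ F}} (hout : IsConditionedChowLiuOutput F Sh E S)
    (h : σ.HoldsLearned F E S) :
    Run invert σ (1500 * ((F.card + 1) ^ 2 * (n + 1))) fun σ' => σ'.HoldsNonzeroEntries S⁻¹ := by
  classical
  obtain ⟨hF, hE, hM⟩ := h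
  have hS : S.PosDef := hout.posDef hSh
  obtain ⟨P, hP⟩ : ∃ P, P = conditionalCov F S := ⟨_, rfl⟩
  obtain ⟨X, hX⟩ : ∃ X, X = blockM F S * (blockF F S)⁻¹ := ⟨_, rfl⟩
  obtain ⟨N, hN⟩ : ∃ N, N = (conditionalCov F S)⁻¹ * X := ⟨_, rfl⟩
  obtain ⟨hP0, hP1, hP2⟩ := hout.inv_conditionalCov hSh P hP
  have hPpos : P.PosDef := hP ▸ conditionalCov_posDef hS
  have hJ := inv_blocks hS hX hN
  rw [← hP] at hJ hN
  have hJT : ∀ i j : {i // i ∉ F}, S⁻¹ i j = P⁻¹ i j := fun i j => by rw [hJ, assemble_apply_TT]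
  have hJTF : ∀ (i : {i // i ∉ F}) (j : {i // i ∈ F}), S⁻¹ i j = -N i j := fun i j => by
    rw [hJ, assemble_apply_TF]; rfl
  have hJFT : ∀ (i : {i // i ∉ F}) (j : {i // i ∈ F}), S⁻¹ j i = -N i j := fun i j => by
    rw [hJ, assemble_apply_FT]; rfl
  have hJF : ∀ i j : {i // i ∈ F}, S⁻¹ i j = ((blockF F S)⁻¹ + Xᵀ * N) i j := fun i j => by
    rw [hJ, assemble_apply_FF]
  obtain ⟨m, hm⟩ : ∃ m, σ.iv 2 = m := ⟨_, rfl⟩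
  obtain ⟨u, v, huv, h1⟩ := hE.exists_enum hm
  -- The edge loops run over a tree, hence at most `n` times.
  have hmn : m ≤ n := by
    obtain ⟨M, hmax, -⟩ := hout.exists_treeCov
    obtain ⟨rank, par, ho⟩ := hmax.1.exists_treeOrder
    rw [← hm, hE.1, ho.ncard_edgeSet, card_notMem]
    omega
  have hsymm := PosDef.apply_comm hPpos.inv
  refine Run.seq (run_listFVS hF) (T₂ := 600 * (F.card + 1) ^ 2 * (n + 1) +
    (60 * ((F.card + 1) * (n + 1)) + (120 * ((F.card + 1) * (n + 1)) +
      (100 * ((F.card + 1) * (n + 1)) + (60 * ((F.card + 1) ^ 2 * (n + 1)) + (2 +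
        (40 * (n + 1) + (60 * (n + 1) + (90 * ((F.card + 1) * (n + 1)) +
          60 * (F.card + 1) ^ 2))))))))) ?_ ?_
  rintro σ₁ hf₁ ⟨e, he⟩
  have hF₁ : σ₁.HoldsFVS F := ⟨(hf₁.iv 0 (by decide)).trans hF.1,
    (hf₁.iv 1 (by decide)).trans hF.2.1, fun i => by rw [hf₁.ia 0 (by decide)]; exact hF.2.2 i⟩
  have hM₁ : σ₁.HoldsMatrix 1 S := fun i j => by rw [hf₁.ra 1 (by decide)]; exact hM i j
  refine Run.seq (run_sweep (src := 1) (by decide) hS hF₁ hM₁ he) ?_ le_rfl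
  intro σ₂ hf₂ hr
  have w₂ : IsSwept σ₂ S e := ⟨⟨(hf₂.iv 0 (by decide)).trans hF₁.1,
      (hf₂.iv 1 (by decide)).trans hF₁.2.1,
      fun i => by rw [hf₂.ia 0 (by decide)]; exact hF₁.2.2 i⟩,
    fun i j => by rw [hf₂.ra 1 (by decide)]; exact hM₁ i j,
    fun a => by rw [hf₂.ia 3 (by decide)]; exact he a, hr⟩
  have e₂ : σ₂.iv 2 = m := by rw [hf₂.iv 2 (by decide), hf₁.iv 2 (by decide), hm]
  have i₂ : σ₂.ia 1 = σ.ia 1 := by rw [hf₂.ia 1 (by decide), hf₁.ia 1 (by decide)]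
  refine Run.seq (run_fillDiagonal w₂ hS) ?_ le_rfl
  intro σ₃ hf₃ h₃
  have w₃ := w₂.frame hf₃ (by decide)
  have e₃ : σ₃.iv 2 = m := by rw [hf₃.iv 2 (by decide), e₂]
  have i₃ : σ₃.ia 1 = σ.ia 1 := by rw [hf₃.ia 1 (by decide), i₂]
  refine Run.seq (run_fillEdges w₃ hS hP (hP ▸ h₃) e₃ hmn huv (by rw [i₃]; exact h1)) ?_ le_rfl
  rintro σ₄ hf₄ ⟨h₄, h₄'⟩
  have w₄ := w₃.frame hf₄ (by decide)
  have e₄ : σ₄.iv 2 = m := by rw [hf₄.iv 2 (by decide), e₃]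
  have i₄ : σ₄.ia 1 = σ.ia 1 := by rw [hf₄.ia 1 (by decide), i₃]
  have d₄ : ∀ i : {i // i ∉ F}, σ₄.ra 5 (i : Fin n) 0 = P⁻¹ i i := fun i => by
    rw [h₄, hP2 i]
  have f₄ : ∀ r : Fin m, σ₄.ra 6 r 0 = P⁻¹ (u r) (v r) := fun r => by
    rw [h₄', hP1 _ _ (huv.adj r)]
  refine Run.seq (run_fillCross w₄ hS hX (Q := P⁻¹) d₄ e₄ hmn huv (by rw [i₄]; exact h1) f₄ hsymm
    hP0) ?_ le_rfl
  intro σ₅ hf₅ h₅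
  have w₅ := w₄.frame hf₅ (by decide)
  refine Run.seq (run_fillFeedback w₅ hS hX (N := N) (fun i a => by rw [h₅, hN]; rfl)) ?_ le_rfl
  intro σ₆ hf₆ h₆
  have w₆ := w₅.frame hf₆ (by decide)
  refine Run.seq (T₁ := 2) (P := fun σ' => σ'.iv 3 = 0) (Run.straight rfl (by decide)
    (by simp [Cmd.step, IExp.eval])) ?_ le_rfl
  intro σ₇ hf₇ h₇
  have w₇ := w₆.frame hf₇ (by decide)
  -- Setting the length to zero discards whatever the output arrays held before.
  have l₇ : σ₇.Lists S⁻¹ ∅ := ⟨fun r hr => by omega, fun p hp => hp.elim⟩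
  refine Run.seq (run_emitDiagonal w₇.fvs l₇ fun i => by
    rw [hf₇.ra 5 (by decide), hf₆.ra 5 (by decide), hf₅.ra 5 (by decide), d₄, hJT]) ?_ le_rfl
  intro σ₈ hf₈ l₈
  have w₈ := w₇.frame hf₈ (by decide)
  refine Run.seq (run_emitEdges l₈ (m := m) ?_ hmn huv ?_ ?_) ?_ le_rfl
  · rw [hf₈.iv 2 (by decide), hf₇.iv 2 (by decide), hf₆.iv 2 (by decide), hf₅.iv 2 (by decide), e₄]
  · rw [hf₈.ia 1 (by decide), hf₇.ia 1 (by decide), hf₆.ia 1 (by decide), hf₅.ia 1 (by decide), i₄]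
    exact h1
  · rw [hf₈.ra 6 (by decide), hf₇.ra 6 (by decide), hf₆.ra 6 (by decide), hf₅.ra 6 (by decide)]
    exact fun r => ⟨by rw [f₄, hJT], by rw [f₄, hJT, hsymm]⟩
  intro σ₉ hf₉ l₉
  have w₉ := w₈.frame hf₉ (by decide)
  refine Run.seq (run_emitCross w₉.fvs w₉.list l₉ fun i a => ?_) ?_ le_rfl
  · rw [hf₉.ra 7 (by decide), hf₈.ra 7 (by decide), hf₇.ra 7 (by decide), hf₆.ra 7 (by decide),
      h₅, hJTF, hJFT, hN]
    exact ⟨rfl, rfl⟩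
  intro σ₁₀ hf₁₀ l₁₀
  have w₁₀ := w₉.frame hf₁₀ (by decide)
  refine (run_emitFeedback w₁₀.fvs w₁₀.list l₁₀ fun a b => ?_).mono le_rfl ?_
  · rw [hf₁₀.ra 8 (by decide), hf₉.ra 8 (by decide), hf₈.ra 8 (by decide), hf₇.ra 8 (by decide),
      h₆, hJF]
  · intro σ' _ hl
    refine ⟨hl.1, fun i j hij => hl.2 (i, j) ?_⟩
    by_cases hi : i ∈ F <;> by_cases hj : j ∈ F
    · exact Or.inr ⟨⟨i, hi⟩, ⟨j, hj⟩, rfl⟩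
    · exact Or.inl (Or.inr ⟨⟨j, hj⟩, ⟨i, hi⟩, Or.inr rfl⟩)
    · exact Or.inl (Or.inr ⟨⟨i, hi⟩, ⟨j, hj⟩, Or.inl rfl⟩)
    · by_cases hne : i = j
      · subst hne
        exact Or.inl (Or.inl (Or.inl (Or.inr ⟨⟨i, hi⟩, rfl⟩)))
      -- A non-zero entry between distinct vertices outside `F` must lie on a tree edge.
      · refine Or.inl (Or.inl (Or.inr ⟨⟨i, hi⟩, ⟨j, hj⟩, ?_, rfl⟩))
        by_contra hadj
        exact hij ((hJT ⟨i, hi⟩ ⟨j, hj⟩).trans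
          (hP0 _ _ (fun h => hne (congrArg Subtype.val h)) hadj))
  · have h2 : F.card + 1 ≤ (F.card + 1) ^ 2 := Nat.le_self_pow two_ne_zero _
    have h3 : (F.card + 1) * (n + 1) ≤ (F.card + 1) ^ 2 * (n + 1) := Nat.mul_le_mul_right _ h2
    have h4 : n + 1 ≤ (F.card + 1) * (n + 1) := Nat.le_mul_of_pos_left _ (by omega)
    have h5 : (F.card + 1) ^ 2 ≤ (F.card + 1) ^ 2 * (n + 1) :=
      Nat.le_mul_of_pos_right _ (by omega)
    rw [mul_assoc 600]
    omega

end

end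

end FVSLearning

/-! ### Running times in the stated form -/

namespace FVSLearning

/-- For k = 0 the bound cn² must fit under n² log n, which works because log n ≥ log 2 > 1/2 for n ≥
2. The estimate needs only the constant 9000; 12000 is shared with `invert_bound`. -/
theorem learn_bound {k n : ℕ} (hn : 2 ≤ n) :
    ((1500 * ((k + 1) * (n + 1) ^ 2) : ℕ) : ℝ) ≤
      12000 * ((k : ℝ) * (n : ℝ) ^ 2 + (n : ℝ) ^ 2 * Real.log n) := by
  have hn' : (2 : ℝ) ≤ n := by exact_mod_cast hn
  have h1 : ((n : ℝ) + 1) ^ 2 ≤ 3 * (n : ℝ) ^ 2 := by nlinarith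
  have h2 : (1 : ℝ) / 2 ≤ Real.log n := by
    have := Real.log_le_log (by norm_num) hn'
    linarith [Real.log_two_gt_d9]
  have h3 : (n : ℝ) ^ 2 ≤ 2 * ((n : ℝ) ^ 2 * Real.log n) := by
    have := mul_le_mul_of_nonneg_left h2 (sq_nonneg (n : ℝ))
    linarith
  have hk : (0 : ℝ) ≤ k := Nat.cast_nonneg k
  have h4 : ((k : ℝ) + 1) * ((n : ℝ) + 1) ^ 2 ≤ (k + 1) * (3 * (n : ℝ) ^ 2) := by gcongr
  have h5 : 0 ≤ (k : ℝ) * (n : ℝ) ^ 2 := by positivity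
  push_cast
  linarith

/-- The constant is 1500 · 2² · 2, from k + 1 ≤ 2 max(1, k) and n + 1 ≤ 2n. -/
theorem invert_bound {k n : ℕ} (hn : 1 ≤ n) :
    ((1500 * ((k + 1) ^ 2 * (n + 1)) : ℕ) : ℝ) ≤ 12000 * ((max 1 k : ℕ) : ℝ) ^ 2 * (n : ℝ) := by
  have h1 : k + 1 ≤ 2 * max 1 k := by omega
  have h2 : n + 1 ≤ 2 * n := by omega
  have h3 : 1500 * ((k + 1) ^ 2 * (n + 1)) ≤ 1500 * ((2 * max 1 k) ^ 2 * (2 * n)) := by gcongr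
  calc ((1500 * ((k + 1) ^ 2 * (n + 1)) : ℕ) : ℝ)
      ≤ ((1500 * ((2 * max 1 k) ^ 2 * (2 * n)) : ℕ) : ℝ) := by exact_mod_cast h3
    _ = 12000 * ((max 1 k : ℕ) : ℝ) ^ 2 * (n : ℝ) := by push_cast; ring

end FVSLearning

theorem proposition1 :
    -- every output of the conditioned Chow-Liu algorithm is an exact maximum likelihood estimate
    (∀ (n : ℕ) (F : Finset (Fin n)) (Sh : Matrix (Fin n) (Fin n) ℝ), Sh.PosDef →
      ∀ (E : SimpleGraph {i // i ∉ F}) (S : Matrix (Fin n) (Fin n) ℝ),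
        FVSLearning.IsConditionedChowLiuOutput F Sh E S →
        -- the learned model lies in the family, and the tree `E` is its structure outside `F`
        S ∈ FVSLearning.covFamily F ∧
        FVSLearning.IsSpanningTree E ∧
        FVSLearning.nonFeedbackGraph F (FVSLearning.sparsityGraph S⁻¹) ≤ E ∧
        -- it minimizes the Kullback-Leibler divergence from the empirical distribution
        (∀ m : Fin n → ℝ, ∀ q ∈ FVSLearning.modelFamily F,
          InformationTheory.klDiv (FVSLearning.gaussian m Sh) (FVSLearning.gaussian m S) ≤
            InformationTheory.klDiv (FVSLearning.gaussian m Sh) q) ∧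
        -- it maximizes the log-likelihood of all samples with empirical covariance matrix `Sh`
        (∀ (s : ℕ) (x : Fin s → Fin n → ℝ), FVSLearning.empiricalCov x = Sh →
          ∀ (m : Fin n → ℝ), ∀ S' ∈ FVSLearning.covFamily F,
            ∑ a, Real.log (FVSLearning.gaussianDensity m S' (x a)) ≤
              ∑ a, Real.log
                (FVSLearning.gaussianDensity (FVSLearning.empiricalMean x) S (x a)))) ∧
    -- the running times
    (∃ (learn invert : FVSLearning.Cmd) (C : ℝ),
      (∀ (n : ℕ) (F : Finset (Fin n)) (Sh : Matrix (Fin n) (Fin n) ℝ), Sh.PosDef →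
        ∀ σ : FVSLearning.Mem, σ.HoldsFVS F → σ.HoldsMatrix 0 Sh →
          ∃ (t : ℕ) (σ' : FVSLearning.Mem) (E : SimpleGraph {i // i ∉ F})
            (S : Matrix (Fin n) (Fin n) ℝ),
            FVSLearning.Exec learn σ t σ' ∧
            FVSLearning.IsConditionedChowLiuOutput F Sh E S ∧
            σ'.HoldsLearned F E S ∧
            (2 ≤ n → (t : ℝ) ≤ C * ((F.card : ℝ) * (n : ℝ) ^ 2 + (n : ℝ) ^ 2 * Real.log n))) ∧
      (∀ (n : ℕ) (F : Finset (Fin n)) (Sh : Matrix (Fin n) (Fin n) ℝ), Sh.PosDef →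
        ∀ (E : SimpleGraph {i // i ∉ F}) (S : Matrix (Fin n) (Fin n) ℝ),
          FVSLearning.IsConditionedChowLiuOutput F Sh E S →
          ∀ σ : FVSLearning.Mem, σ.HoldsLearned F E S →
            ∃ (t : ℕ) (σ' : FVSLearning.Mem),
              FVSLearning.Exec invert σ t σ' ∧
              σ'.HoldsNonzeroEntries S⁻¹ ∧
              (1 ≤ n → (t : ℝ) ≤ C * ((max 1 F.card : ℕ) : ℝ) ^ 2 * (n : ℝ)))) := by
  refine ⟨fun n F Sh hSh E S h => ⟨h.mem_covFamily hSh, ?_, h.graph_le hSh,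
    fun m q hq => h.klDiv_le hSh m hq, fun s x hx m S' hS' => h.sum_log_le hSh x hx m hS'⟩,
    FVSLearning.learn, FVSLearning.invert, 12000, fun n F Sh hSh σ hF hM => ?_,
    fun n F Sh hSh E S h σ hL => ?_⟩
  · obtain ⟨M, hmax, -⟩ := h.exists_treeCov
    exact hmax.1
  · obtain ⟨t, σ', hex, ht, E, S, hout, hL⟩ := FVSLearning.run_learn hF hSh hM
    exact ⟨t, σ', E, S, hex, hout, hL, fun hn =>
      le_trans (by exact_mod_cast ht) (FVSLearning.learn_bound hn)⟩
  · obtain ⟨t, σ', hex, ht, hJ⟩ := FVSLearning.run_invert hSh h hL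
    exact ⟨t, σ', hex, hJ, fun hn =>
      le_trans (by exact_mod_cast ht) (FVSLearning.invert_bound hn)⟩
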